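/- Consider the uplink of a network with $L\ge 1$ cells and $K$ users per cell, where each base station (BS) has $N$ antennas. Within a coherence block, the channel from user $k$ of cell $l$ to BS $j$ is $h_{jlk}\sim\mathcal{CN}(0,\lambda_{jlk}I_N)$ with $\lambda_{jlk}>0$, independent over users and cells. At channel use $t=1,2,\dots$ BS $j$ receives $$y_j(t)=D_{\phi_j(t)}\sum_{l=1}^{L}\sum_{k=1}^{K}h_{jlk}x_{lk}(t)+\upsilon_j(t)+\eta_j(t),\qquad D_{\phi_j(t)}=\mathrm{diag}(e^{i\phi_{j1}(t)},\dots,e^{i\phi_{jN}(t)}),$$ where $x_{lk}(t)$ has power $p_{lk}\ge 0$. Each phase drift $\phi_{jn}(t)$ is a random walk in $t$ with independent $\mathcal N(0,\delta)$ increments and an arbitrary independent initial phase; the drifts are identical for all $n$ with a common local oscillator (CLO) and independent over $n$ with separate local oscillators (SLOs). Given the channels, the distortion noise is $\upsilon_j(t)\sim\mathcal{CN}(0,\kappa^2\sum_{l,k}p_{lk}\,\mathrm{diag}(|h_{jlk}^{(1)}|^2,\dots,|h_{jlk}^{(N)}|^2))$, independent over time; the receiver noise is $\eta_j(t)\sim\mathcal{CN}(0,\sigma^2\xi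 I_N)$ with $\sigma^2>0$, independent over time. Channels, phase drifts, receiver noise and normalized distortion noise are mutually independent. At the channel uses $1,\dots,B$, $B\ge1$, the users send deterministic pilot symbols, $|x_{lk}(b)|^2=p_{lk}$. Let $h_{jlm}(t)=D_{\phi_j(t)}h_{jlm}$, and let the maximum ratio combining (MRC) filter $v_{jk}(t)$ be the linear minimum mean squared error estimate of $h_{jjk}(t)$ from $y_j(1),\dots,y_j(B)$. For $t>B$ put $$\mathrm{SINR}_{jk}(t)=\frac{p_{jk}|\mathbb E\{v_{jk}^{H}(t)h_{jjk}(t)\}|^2}{\sum_{l,m}p_{lm}\mathbb E\{|v_{jk}^{H}(t)h_{jlm}(t)|^2\}-p_{jk}|\mathbb E\{v_{jk}^{H}(t)h_{jjk}(t)\}|^2+\mathbb E\{|v_{jk}^{H}(t)\upsilon_j(t)|^2\}+\sigma^2\xi\,\mathbb E\{\|v_{jk}(t)\|^2\}}.$$ Let the hardware parameters depend on $N$ as $\kappa^2=\kappa_0^2N^{\tau_1}$, $\xi=\xi_0N^{\tau_2}$ and $\delta=\delta_0(1+\ln(N^{\tau_3}))$ with $\tau_1,\tau_2,\tau_3,\kappa_0,\xi_0,\delta_0\ge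 0$, all other parameters being fixed. Let $t>B$ and $p_{jk}>0$. If $$\begin{cases}\max(\tau_1,\tau_2)\le\frac12\ \text{and}\ \tau_3=0&\text{with a CLO},\\ \max(\tau_1,\tau_2)+\frac{\delta_0(t-B)}{2}\tau_3\le\frac12&\text{with SLOs},\end{cases}$$ then $\mathrm{SINR}_{jk}(t)$ with MRC has a non-zero limit in $(0,\infty]$ as $N\to\infty$. -/

import Mathlib

open MeasureTheory ProbabilityTheory Filter Topology

namespace MIMO

universe u

/-- The circularly symmetric complex Gaussian law `CN(0, v)`: independent real and imaginary parts,
each with law `N(0, v / 2)`. -/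
noncomputable def complexGaussian (v : NNReal) : Measure ℂ :=
  ((gaussianReal 0 (v / 2)).prod (gaussianReal 0 (v / 2))).map Complex.measurableEquivRealProd.symm

/-- The network: `L` cells with `K` users each, pilot sequences of length `B`.
* `lam j l m` is the average channel attenuation from user `m` in cell `l` to base station `j`;
* `p l m` is the transmit power of user `m` in cell `l`;
* `pilot l m b` is the (deterministic) pilot symbol sent by user `m` of cell `l` at channel use
  `b + 1`; it satisfies the power constraint of the transmitted signal;
* `sigma ^ 2` is the thermal noise power. -/
structure Network (L K B : ℕ) where
  lam : Fin L → Fin L → Fin K → ℝ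
  lam_pos : ∀ j l m, 0 < lam j l m
  p : Fin L → Fin K → ℝ
  p_nonneg : ∀ l m, 0 ≤ p l m
  pilot : Fin L → Fin K → Fin B → ℂ
  pilot_power : ∀ l m b, ‖pilot l m b‖ ^ 2 = p l m
  sigma : ℝ
  sigma_pos : 0 < sigma

/-- The hardware parameters `κ²`, `ξ`, `δ` of a base station. -/
structure Hardware where
  kappaSq : ℝ
  xi : ℝ
  delta : ℝ

/-- The hardware parameters scaled with the number `N` of antennas. -/
noncomputable def scaledHardware (κ₀ ξ₀ δ₀ τ₁ τ₂ τ₃ : ℝ) (N : ℕ) : Hardware where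
  kappaSq := κ₀ ^ 2 * (N : ℝ) ^ τ₁
  xi := ξ₀ * (N : ℝ) ^ τ₂
  delta := δ₀ * (1 + Real.log ((N : ℝ) ^ τ₃))

/-- One common local oscillator for all antennas of a base station, or separate ones. -/
inductive LOType
  | common
  | separate

/-- The oscillator that drives antenna `n`: oscillator `0` for all antennas in the common case,
oscillator `n` in the separate case. -/
def LOType.oscillator : LOType → {N : ℕ} → Fin N → Fin N
  | .common, _, n => ⟨0, n.pos⟩
  | .separate, _, n => n

/-- Labels of the independent sources of randomness at a base station. -/
inductive Source (L K N : ℕ)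
  | channel (l : Fin L) (m : Fin K) (n : Fin N)
  | initialPhase (o : Fin N)
  | innovation (o : Fin N) (s : ℕ)
  | distortion (n : Fin N) (s : ℕ)
  | noise (n : Fin N) (s : ℕ)

/-- The random quantities at base station `j` with `N` antennas in one coherence block.
* `channel l m n` is the channel coefficient from user `m` of cell `l` to antenna `n`;
* `initialPhase o` and `innovation o s` are the phase of oscillator `o` at time `0` and its phase
  increment from channel use `s - 1` to channel use `s`;
* `stdDistortion n s` is the normalised (unit variance) distortion at antenna `n`, channel use `s`;
* `noise n s` is the receiver noise at antenna `n`, channel use `s`. -/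
structure UplinkModel {L K B : ℕ} (net : Network L K B) (hw : Hardware) (lo : LOType)
    (j : Fin L) (N : ℕ) where
  Ω : Type u
  mΩ : MeasurableSpace Ω
  μ : Measure Ω
  prob : IsProbabilityMeasure μ
  channel : Fin L → Fin K → Fin N → Ω → ℂ
  initialPhase : Fin N → Ω → ℝ
  innovation : Fin N → ℕ → Ω → ℝ
  stdDistortion : Fin N → ℕ → Ω → ℂ
  noise : Fin N → ℕ → Ω → ℂ
  law_channel : ∀ l m n,
    HasLaw (channel l m n) (complexGaussian (net.lam j l m).toNNReal) μ
  measurable_initialPhase : ∀ o, Measurable (initialPhase o)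
  law_innovation : ∀ o s, HasLaw (innovation o s) (gaussianReal 0 hw.delta.toNNReal) μ
  law_stdDistortion : ∀ n s, HasLaw (stdDistortion n s) (complexGaussian 1) μ
  law_noise : ∀ n s,
    HasLaw (noise n s) (complexGaussian (net.sigma ^ 2 * hw.xi).toNNReal) μ
  indep : iIndepFun (fun (i : Source L K N) (ω : Ω) => (match i with
    | .channel l m n => channel l m n ω
    | .initialPhase o => ((initialPhase o ω : ℝ) : ℂ)
    | .innovation o s => ((innovation o s ω : ℝ) : ℂ)
    | .distortion n s => stdDistortion n s ω
    | .noise n s => noise n s ω : ℂ)) μ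

attribute [instance] UplinkModel.mΩ UplinkModel.prob

namespace UplinkModel

variable {L K B : ℕ} {net : Network L K B} {hw : Hardware} {lo : LOType} {j : Fin L} {N : ℕ}

/-- The phase drift at antenna `n` at channel use `t`: a random walk with increments `N(0, δ)`. -/
noncomputable def phase (M : UplinkModel.{u} net hw lo j N) (n : Fin N) (t : ℕ) (ω : M.Ω) : ℝ :=
  M.initialPhase (lo.oscillator n) ω + ∑ s ∈ Finset.Icc 1 t, M.innovation (lo.oscillator n) s ω

/-- The effective channel of user `m` of cell `l` at channel use `t`, phase drifts included. -/
noncomputable def effChannel (M : UplinkModel.{u} net hw lo j N) (l : Fin L) (m : Fin K) (t : ℕ)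
    (ω : M.Ω) : Fin N → ℂ :=
  fun n => Complex.exp (Complex.I * (M.phase n t ω : ℂ)) * M.channel l m n ω

/-- The additive distortion noise at channel use `t`. Given the channels, its entries are
independent, and entry `n` has law `CN(0, κ² ∑ l m, p l m * |h l m n| ^ 2)`. -/
noncomputable def distortion (M : UplinkModel.{u} net hw lo j N) (t : ℕ) (ω : M.Ω) : Fin N → ℂ :=
  fun n => (Real.sqrt (hw.kappaSq * ∑ l, ∑ m, net.p l m * ‖M.channel l m n ω‖ ^ 2) : ℂ)
    * M.stdDistortion n t ω

/-- The signal received at all antennas during the `B` pilot channel uses `1, …, B`. -/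
noncomputable def pilotSignal (M : UplinkModel.{u} net hw lo j N) (ω : M.Ω) : Fin N × Fin B → ℂ :=
  fun i => (∑ l, ∑ m, M.effChannel l m (i.2 + 1) ω i.1 * net.pilot l m i.2)
    + M.distortion (i.2 + 1) ω i.1 + M.noise i.1 (i.2 + 1) ω

/-- The mean squared error of the linear estimate `A ψ` of the effective channel of user `m` of
cell `l` at channel use `t`, where `ψ` is the received pilot signal. -/
noncomputable def mse (M : UplinkModel.{u} net hw lo j N) (l : Fin L) (m : Fin K) (t : ℕ)
    (A : Matrix (Fin N) (Fin N × Fin B) ℂ) : ℝ :=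
  ∫ ω, ∑ n, ‖M.effChannel l m t ω n - (A.mulVec (M.pilotSignal ω)) n‖ ^ 2 ∂M.μ

/-- `v` is the linear minimum mean squared error (LMMSE) estimate, from the received pilot signal,
of the effective channel of user `m` of cell `l` at channel use `t`. -/
def IsLMMSE (M : UplinkModel.{u} net hw lo j N) (l : Fin L) (m : Fin K) (t : ℕ)
    (v : M.Ω → Fin N → ℂ) : Prop :=
  ∃ A : Matrix (Fin N) (Fin N × Fin B) ℂ,
    (∀ A' : Matrix (Fin N) (Fin N × Fin B) ℂ, M.mse l m t A ≤ M.mse l m t A') ∧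
      ∀ ω, v ω = A.mulVec (M.pilotSignal ω)

/-- `v` is the maximum ratio combining (MRC) filter for user `k` of the own cell `j` at channel
use `t`: the LMMSE estimate of the user's effective channel. -/
def IsMRC (M : UplinkModel.{u} net hw lo j N) (k : Fin K) (t : ℕ) (v : M.Ω → Fin N → ℂ) : Prop :=
  M.IsLMMSE j k t v

/-- The uplink SINR of user `k` of cell `j` at channel use `t` with receive filter `v`. -/
noncomputable def sinr (M : UplinkModel.{u} net hw lo j N) (k : Fin K) (t : ℕ)
    (v : M.Ω → Fin N → ℂ) : ℝ :=
  (net.p j k * ‖∫ ω, star (v ω) ⬝ᵥ M.effChannel j k t ω ∂M.μ‖ ^ 2) /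
    ((∑ l, ∑ m, net.p l m * ∫ ω, ‖star (v ω) ⬝ᵥ M.effChannel l m t ω‖ ^ 2 ∂M.μ)
      - net.p j k * ‖∫ ω, star (v ω) ⬝ᵥ M.effChannel j k t ω ∂M.μ‖ ^ 2
      + (∫ ω, ‖star (v ω) ⬝ᵥ M.distortion t ω‖ ^ 2 ∂M.μ)
      + net.sigma ^ 2 * hw.xi * ∫ ω, ∑ n, ‖v ω n‖ ^ 2 ∂M.μ)

end UplinkModel

end MIMO

/-!
# Existence of a non-zero limit of the SINR of MRC under hardware scaling laws

Pilot signals at different antennas are uncorrelated, because the channels are. The normal equations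
of the LMMSE estimate therefore decouple over the antennas, and they are the same at each of them:
the MRC filter is almost surely `v n = ∑ b, w b * y (n, b)` for any solution `w` of the `B × B`
system `w ᵥ* pilotCov = crossCov` (`IsMRC.ae_eq_combine`). The covariance matrix may be singular,
but the filter does not depend on the choice of the solution. Consequently the SINR is an explicit
function of `N` and of finitely many Hermitian forms in `w` (`IsMRC.sinr_eq`). Its numerator is of
order `N ^ 2`, and so are in the denominator the contributions of the pairs of different antennas
(`crossAntennaForm`), while the single antennas, the distortion and the receiver noise contribute
terms of order `N`, with factors that grow with the noise level. The moments needed are those of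
order four of the channels and the correlations `g ^ d`, `g = exp (-δ / 2)`, of the phase rotations
over `d` channel uses.

Let `D = N ^ τ` be the growth rate of the noise power, and let `γ = g ^ (t - B)`, by which all phase
correlations decay between the last pilot and channel use `t`. The matrices `pilotCov / D` and the
vectors `crossCov / γ` converge, hence so do the rescaled coefficients `(D / γ) • w`, provided that
the limiting matrix is coercive (`exists_tendsto_coefficients`). It is coercive if some additive
noise survives the rescaling, or if `g → 0`, when the pilot signals of different channel uses
decorrelate. In the remaining case the hardware does not depend on `N`, and one fixed solution `w`
serves for all `N`.

After division of numerator and denominator by `(N * γ ^ 2 / D) ^ 2` the numerator has a positive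
limit, and everything in the denominator converges, if the factor `D ^ 2 / (N * γ ^ 2)` in front of
the single-antenna terms does (`normalizedDenom`, `exists_tendsto_sinr`). This factor is a constant
times a power of `N` whose exponent the scaling law makes non-positive. With a common oscillator the
correlation of two antennas does not decay with `γ`, so that the phase noise must not grow.

The limiting denominator may vanish; then the limit of the SINR is `∞`, because the denominator is
positive for each `N` (`sinrDenom_pos`): the power of the signal fluctuates at a single antenna as
the channel gain does, and the pairs of different antennas contribute at least the square of the
mean.
-/

namespace MIMO

open scoped NNReal ComplexConjugate

universe u

/-! ### Moments of complex Gaussian variables -/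

lemma integral_sq_gaussianReal_zero (v : ℝ≥0) : ∫ x, x ^ 2 ∂(gaussianReal 0 v) = v := by
  have h := variance_fun_id_gaussianReal (μ := 0) (v := v)
  rw [variance_eq_integral measurable_id'.aemeasurable] at h
  simpa using h

/-- The fourth moment is the fourth derivative at `0` of the moment generating function
`exp (v * t ^ 2 / 2)`. -/
lemma integral_pow_four_gaussianReal_zero (v : ℝ≥0) :
    ∫ x, x ^ 4 ∂(gaussianReal 0 v) = 3 * (v : ℝ) ^ 2 := by
  have h0 : ∫ x, x ^ 4 ∂(gaussianReal 0 v)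
      = iteratedDeriv 4 (mgf (fun x ↦ x) (gaussianReal 0 v)) 0 := by
    rw [iteratedDeriv_mgf_zero] <;> simp
  have he (t : ℝ) : HasDerivAt (fun t : ℝ ↦ Real.exp (v * t ^ 2 / 2))
      (v * t * Real.exp (v * t ^ 2 / 2)) t :=
    (((hasDerivAt_pow 2 t).const_mul (v : ℝ)).div_const 2).exp.congr_deriv (by norm_num; ring)
  -- Derivatives of a polynomial times the moment generating function.
  have hp (p p' q : ℝ → ℝ) (h : ∀ t, HasDerivAt p (p' t) t) (hq : ∀ t, p' t + p t * (v * t) = q t) :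
      deriv (fun t ↦ p t * Real.exp (v * t ^ 2 / 2)) = fun t ↦ q t * Real.exp (v * t ^ 2 / 2) := by
    ext t
    rw [((h t).fun_mul (he t)).deriv, ← hq]
    ring
  have hid (c : ℝ) (n : ℕ) (t : ℝ) : HasDerivAt (fun t : ℝ ↦ c * t ^ n) (c * (n * t ^ (n - 1))) t :=
    (hasDerivAt_pow n t).const_mul c
  have h1 : deriv (fun t : ℝ ↦ Real.exp (v * t ^ 2 / 2))
      = fun t ↦ ((v : ℝ) * t ^ 1) * Real.exp (v * t ^ 2 / 2) := by
    ext t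
    rw [(he t).deriv, pow_one]
  have h2 := hp _ _ (fun t ↦ (v : ℝ) + (v : ℝ) ^ 2 * t ^ 2) (hid v 1) (fun t ↦ by simp; ring)
  have h3 := hp _ _ (fun t ↦ 3 * (v : ℝ) ^ 2 * t ^ 1 + (v : ℝ) ^ 3 * t ^ 3)
    (fun t ↦ (hid ((v : ℝ) ^ 2) 2 t).const_add (v : ℝ)) (fun t ↦ by norm_num; ring)
  have h4 := hp _ _ (fun t ↦ 3 * (v : ℝ) ^ 2 + 6 * (v : ℝ) ^ 3 * t ^ 2 + (v : ℝ) ^ 4 * t ^ 4)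
    (fun t ↦ (hid (3 * (v : ℝ) ^ 2) 1 t).fun_add (hid ((v : ℝ) ^ 3) 3 t))
    (fun t ↦ by norm_num; ring)
  rw [h0, mgf_fun_id_gaussianReal, iteratedDeriv_eq_iterate]
  simp only [zero_mul, zero_add, Function.iterate_succ, Function.iterate_zero, Function.comp_apply,
    id]
  rw [h1, h2, h3, h4]
  simp

lemma memLp_id_complexGaussian (v p : ℝ≥0) : MemLp id p (complexGaussian v) := by
  have h1 : MemLp (fun x : ℝ × ℝ ↦ (x.1 : ℂ)) p
      ((gaussianReal 0 (v / 2)).prod (gaussianReal 0 (v / 2))) :=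
    (memLp_id_gaussianReal (μ := 0) (v := v / 2) p).ofReal.comp_fst _
  have h2 : MemLp (fun x : ℝ × ℝ ↦ (x.2 : ℂ)) p
      ((gaussianReal 0 (v / 2)).prod (gaussianReal 0 (v / 2))) :=
    (memLp_id_gaussianReal (μ := 0) (v := v / 2) p).ofReal.comp_snd _
  rw [complexGaussian, memLp_map_measure_iff (by fun_prop) (by fun_prop)]
  convert h1.add (h2.const_mul Complex.I) using 1
  ext x
  simp [Complex.measurableEquivRealProd, Complex.ext_iff]

instance (v : ℝ≥0) : IsProbabilityMeasure (complexGaussian v) :=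
  Measure.isProbabilityMeasure_map (by fun_prop)

lemma integral_complexGaussian_eq (v : ℝ≥0) {f : ℂ → ℂ} (hf : Continuous f) :
    ∫ z, f z ∂(complexGaussian v)
      = ∫ x, f ⟨x.1, x.2⟩ ∂((gaussianReal 0 (v / 2)).prod (gaussianReal 0 (v / 2))) := by
  rw [complexGaussian, integral_map (by fun_prop) hf.aestronglyMeasurable]
  rfl

lemma integrable_gaussian_prod_monomial (v : ℝ≥0) (m n : ℕ) :
    Integrable (fun x : ℝ × ℝ ↦ x.1 ^ m * x.2 ^ n)
      ((gaussianReal 0 v).prod (gaussianReal 0 v)) := by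
  have h (n : ℕ) : Integrable (fun x : ℝ ↦ x ^ n) (gaussianReal 0 v) :=
    integrable_pow_of_mem_interior_integrableExpSet (X := fun x ↦ x) (by simp) n
  exact (h m).mul_prod (h n)

lemma integral_id_complexGaussian (v : ℝ≥0) : ∫ z, z ∂(complexGaussian v) = 0 := by
  have h := integral_id_gaussianReal (μ := 0) (v := v / 2)
  rw [integral_complexGaussian_eq v (f := fun z ↦ z) continuous_id]
  have e (x : ℝ × ℝ) : (⟨x.1, x.2⟩ : ℂ) = ((x.1 ^ 1 * x.2 ^ 0 : ℝ) : ℂ)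
      + ((x.1 ^ 0 * x.2 ^ 1 : ℝ) : ℂ) * Complex.I := by
    simp [Complex.ext_iff]
  simp_rw [e]
  rw [integral_add (integrable_gaussian_prod_monomial _ 1 0).ofReal
    ((integrable_gaussian_prod_monomial _ 0 1).ofReal.mul_const _), integral_mul_const,
    integral_complex_ofReal, integral_complex_ofReal,
    integral_prod_mul (fun x : ℝ ↦ x ^ 1) (fun x : ℝ ↦ x ^ 0),
    integral_prod_mul (fun x : ℝ ↦ x ^ 0) (fun x : ℝ ↦ x ^ 1)]
  simp [h]

lemma integral_mul_conj_complexGaussian (v : ℝ≥0) :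
    ∫ z, z * conj z ∂(complexGaussian v) = (v : ℂ) := by
  have h := integral_sq_gaussianReal_zero (v / 2)
  rw [integral_complexGaussian_eq v (by fun_prop)]
  have e (x : ℝ × ℝ) : (⟨x.1, x.2⟩ : ℂ) * conj (⟨x.1, x.2⟩ : ℂ)
      = ((x.1 ^ 2 * x.2 ^ 0 + x.1 ^ 0 * x.2 ^ 2 : ℝ) : ℂ) := by
    rw [Complex.mul_conj]
    simp [Complex.normSq_apply, sq]
  simp_rw [e]
  rw [integral_complex_ofReal, integral_add (integrable_gaussian_prod_monomial _ 2 0)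
    (integrable_gaussian_prod_monomial _ 0 2),
    integral_prod_mul (fun x : ℝ ↦ x ^ 2) (fun x : ℝ ↦ x ^ 0),
    integral_prod_mul (fun x : ℝ ↦ x ^ 0) (fun x : ℝ ↦ x ^ 2)]
  simp [h]

/-- The fourth absolute moment is twice the square of the variance. This excess over the square of
the variance makes the signal power at a single antenna fluctuate. -/
lemma integral_mul_conj_sq_complexGaussian (v : ℝ≥0) :
    ∫ z, (z * conj z) * (z * conj z) ∂(complexGaussian v) = 2 * (v : ℂ) ^ 2 := by
  have h := integral_sq_gaussianReal_zero (v / 2)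
  have h' := integral_pow_four_gaussianReal_zero (v / 2)
  rw [integral_complexGaussian_eq v (by fun_prop)]
  have e (x : ℝ × ℝ) : ((⟨x.1, x.2⟩ : ℂ) * conj (⟨x.1, x.2⟩ : ℂ))
        * ((⟨x.1, x.2⟩ : ℂ) * conj (⟨x.1, x.2⟩ : ℂ))
      = ((x.1 ^ 4 * x.2 ^ 0 + 2 * (x.1 ^ 2 * x.2 ^ 2) + x.1 ^ 0 * x.2 ^ 4 : ℝ) : ℂ) := by
    rw [Complex.mul_conj, ← Complex.ofReal_mul]
    congr 1
    simp [Complex.normSq_apply]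
    ring
  simp_rw [e]
  rw [integral_complex_ofReal, integral_add ((integrable_gaussian_prod_monomial _ 4 0).fun_add
      ((integrable_gaussian_prod_monomial _ 2 2).const_mul 2))
    (integrable_gaussian_prod_monomial _ 0 4),
    integral_add (integrable_gaussian_prod_monomial _ 4 0)
      ((integrable_gaussian_prod_monomial _ 2 2).const_mul 2),
    integral_const_mul,
    integral_prod_mul (fun x : ℝ ↦ x ^ 4) (fun x : ℝ ↦ x ^ 0),
    integral_prod_mul (fun x : ℝ ↦ x ^ 2) (fun x : ℝ ↦ x ^ 2),
    integral_prod_mul (fun x : ℝ ↦ x ^ 0) (fun x : ℝ ↦ x ^ 4), h, h']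
  simp
  ring

/-! ### Random variables with all moments, and independence -/

section MomentAlgebra

variable {Ω I : Type*} [mΩ : MeasurableSpace Ω] {μ : Measure Ω} {X : I → Ω → ℂ}

/-- The σ-algebra generated by measurable versions of the variables `X i`, `i ∈ S`. Measurable
versions are taken because the `X i` are only almost everywhere measurable; `X i` itself need not be
measurable with respect to this σ-algebra, but it is almost everywhere equal to a function that
is. -/
@[reducible]
noncomputable def sourceSigma (hX : ∀ i, AEMeasurable (X i) μ) (S : Set I) : MeasurableSpace Ω :=
  ⨆ i ∈ S, MeasurableSpace.comap ((hX i).mk (X i)) inferInstance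

lemma sourceSigma_mono (hX : ∀ i, AEMeasurable (X i) μ) {S T : Set I} (h : S ⊆ T) :
    sourceSigma hX S ≤ sourceSigma hX T :=
  biSup_mono h

lemma sourceSigma_le (hX : ∀ i, AEMeasurable (X i) μ) (S : Set I) : sourceSigma hX S ≤ mΩ :=
  iSup₂_le fun i _ ↦ (hX i).measurable_mk.comap_le

lemma aestronglyMeasurable_source (hX : ∀ i, AEMeasurable (X i) μ) {S : Set I} {i : I}
    (hi : i ∈ S) : AEStronglyMeasurable[sourceSigma hX S] (X i) μ := by
  have h : Measurable[sourceSigma hX S] ((hX i).mk (X i)) := by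
    have h1 : MeasurableSpace.comap ((hX i).mk (X i)) inferInstance ≤ sourceSigma hX S :=
      le_iSup₂_of_le i hi le_rfl
    exact (comap_measurable _).mono h1 le_rfl
  exact ⟨(hX i).mk (X i), h.stronglyMeasurable, (hX i).ae_eq_mk⟩

/-- The `*`-algebra of complex random variables that have finite moments of all orders and are,
up to a null set, functions of the variables `X i`, `i ∈ S`. -/
noncomputable def momentAlgebra (hX : ∀ i, AEMeasurable (X i) μ) [IsFiniteMeasure μ] (S : Set I) :
    StarSubalgebra ℂ (Ω → ℂ) where
  carrier := {f | AEStronglyMeasurable[sourceSigma hX S] f μ ∧ ∀ p : ℝ≥0, MemLp f p μ}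
  mul_mem' := by
    rintro f g ⟨hf, hf'⟩ ⟨hg, hg'⟩
    refine ⟨hf.mul hg, fun p ↦ ?_⟩
    -- Hölder's inequality with exponents `2 * p` and `2 * p`.
    have : ENNReal.HolderTriple ((2 * p : ℝ≥0) : ENNReal)
        ((2 * p : ℝ≥0) : ENNReal) (p : ENNReal) := by
      constructor
      push_cast
      rw [ENNReal.mul_inv (by simp) (by simp), ← two_mul, ← mul_assoc,
        ENNReal.mul_inv_cancel (by simp) (by simp), one_mul]
    exact (hg' (2 * p)).mul (hf' (2 * p))
  add_mem' := by
    rintro f g ⟨hf, hf'⟩ ⟨hg, hg'⟩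
    exact ⟨hf.add hg, fun p ↦ (hf' p).add (hg' p)⟩
  algebraMap_mem' c := ⟨aestronglyMeasurable_const, fun p ↦ memLp_const c⟩
  star_mem' := by
    rintro f ⟨hf, hf'⟩
    exact ⟨continuous_star.comp_aestronglyMeasurable hf, fun p ↦ (hf' p).star⟩

variable [IsProbabilityMeasure μ] {hX : ∀ i, AEMeasurable (X i) μ} {S T : Set I} {f g : Ω → ℂ}

lemma momentAlgebra_mono (h : S ⊆ T) (hf : f ∈ momentAlgebra hX S) : f ∈ momentAlgebra hX T :=
  ⟨hf.1.mono (sourceSigma_mono hX h), hf.2⟩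

lemma integrable_of_mem_momentAlgebra (hf : f ∈ momentAlgebra hX S) : Integrable f μ := by
  simpa using (memLp_one_iff_integrable.1 (by simpa using hf.2 1))

lemma const_mem_momentAlgebra (c : ℂ) : (fun _ ↦ c) ∈ momentAlgebra hX S :=
  algebraMap_mem (momentAlgebra hX S) c

lemma mul_mem_momentAlgebra (hf : f ∈ momentAlgebra hX S) (hg : g ∈ momentAlgebra hX S) :
    (fun ω ↦ f ω * g ω) ∈ momentAlgebra hX S :=
  mul_mem hf hg

lemma const_mul_mem_momentAlgebra (c : ℂ) (hf : f ∈ momentAlgebra hX S) :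
    (fun ω ↦ c * f ω) ∈ momentAlgebra hX S :=
  mul_mem (const_mem_momentAlgebra c) hf

lemma add_mem_momentAlgebra (hf : f ∈ momentAlgebra hX S) (hg : g ∈ momentAlgebra hX S) :
    (fun ω ↦ f ω + g ω) ∈ momentAlgebra hX S :=
  add_mem hf hg

lemma sub_mem_momentAlgebra (hf : f ∈ momentAlgebra hX S) (hg : g ∈ momentAlgebra hX S) :
    (fun ω ↦ f ω - g ω) ∈ momentAlgebra hX S :=
  sub_mem hf hg

lemma conj_mem_momentAlgebra (hf : f ∈ momentAlgebra hX S) :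
    (fun ω ↦ conj (f ω)) ∈ momentAlgebra hX S :=
  star_mem hf

lemma sum_mem_momentAlgebra {ι : Type*} {s : Finset ι} {F : ι → Ω → ℂ}
    (hF : ∀ i ∈ s, F i ∈ momentAlgebra hX S) :
    (fun ω ↦ ∑ i ∈ s, F i ω) ∈ momentAlgebra hX S := by
  convert sum_mem hF using 1
  ext ω
  simp

/-- Domination transfers the moments, whatever sources the dominating variable depends on. -/
lemma mem_momentAlgebra_of_norm_le (hf : AEStronglyMeasurable[sourceSigma hX S] f μ)
    (hg : g ∈ momentAlgebra hX T) (h : ∀ ω, ‖f ω‖ ≤ ‖g ω‖) : f ∈ momentAlgebra hX S :=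
  ⟨hf, fun p ↦ (hg.2 p).mono (hf.mono (sourceSigma_le hX S)) (ae_of_all _ h)⟩

/-- Random variables built from disjoint families of independent variables are uncorrelated. -/
lemma integral_mul_of_disjoint (hind : iIndepFun X μ) (hST : Disjoint S T)
    (hf : f ∈ momentAlgebra hX S) (hg : g ∈ momentAlgebra hX T) :
    ∫ ω, f ω * g ω ∂μ = (∫ ω, f ω ∂μ) * ∫ ω, g ω ∂μ := by
  have h1 : iIndepFun (fun i ↦ (hX i).mk (X i)) μ := hind.congr fun i ↦ (hX i).ae_eq_mk
  have h2 : Indep (sourceSigma hX S) (sourceSigma hX T) μ :=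
    indep_iSup_of_disjoint (fun i ↦ (hX i).measurable_mk.comap_le) h1.iIndep hST
  have h3 : IndepFun (hf.1.mk f) (hg.1.mk g) μ := by
    rw [IndepFun_iff_Indep]
    exact indep_of_indep_of_le_left (indep_of_indep_of_le_right h2
      hg.1.stronglyMeasurable_mk.measurable.comap_le) hf.1.stronglyMeasurable_mk.measurable.comap_le
  have h4 : IndepFun f g μ := h3.congr hf.1.ae_eq_mk.symm hg.1.ae_eq_mk.symm
  exact h4.integral_fun_mul_eq_mul_integral (hf.1.mono (sourceSigma_le hX S))
    (hg.1.mono (sourceSigma_le hX T))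

end MomentAlgebra

/-! ### The independent sources and the phase rotations -/

namespace Source

variable {L K N B : ℕ}

/-- The sources with a circularly symmetric complex Gaussian law. -/
def IsGaussian : Source L K N → Prop
  | .channel _ _ _ => True
  | .initialPhase _ => False
  | .innovation _ _ => False
  | .distortion _ _ => True
  | .noise _ _ => True

lemma isGaussian_channel (l : Fin L) (m : Fin K) (n : Fin N) : (channel l m n).IsGaussian := trivial

lemma isGaussian_distortion (n : Fin N) (s : ℕ) :
    (distortion n s : Source L K N).IsGaussian := trivial

lemma isGaussian_noise (n : Fin N) (s : ℕ) : (noise n s : Source L K N).IsGaussian := trivial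

/-- The variance of a Gaussian source; the value `0` at the other sources is never used. -/
noncomputable def power (net : Network L K B) (hw : Hardware) (j : Fin L) : Source L K N → ℝ
  | .channel l m _ => net.lam j l m
  | .initialPhase _ => 0
  | .innovation _ _ => 0
  | .distortion _ _ => 1
  | .noise _ _ => net.sigma ^ 2 * hw.xi

/-- The channels to antenna `n`. -/
def channelSet (n : Fin N) : Set (Source L K N) :=
  {i | match i with
    | .channel _ _ n' => n' = n
    | _ => False}

/-- The phase increments of oscillator `o` up to channel use `s`, and its initial phase. -/
def phaseSetUpTo (o : Fin N) (s : ℕ) : Set (Source L K N) :=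
  {i | match i with
    | .initialPhase o' => o' = o
    | .innovation o' r => o' = o ∧ r ≤ s
    | _ => False}

/-- The sources that drive the phase of oscillator `o`. -/
def phaseSet (o : Fin N) : Set (Source L K N) :=
  {i | match i with
    | .initialPhase o' => o' = o
    | .innovation o' _ => o' = o
    | _ => False}

/-- All phase sources. -/
def phases : Set (Source L K N) :=
  {i | match i with
    | .initialPhase _ => True
    | .innovation _ _ => True
    | _ => False}

/-- All channels. -/
def channels : Set (Source L K N) :=
  {i | match i with
    | .channel _ _ _ => True
    | _ => False}

/-- All sources but the additive noises (distortion and receiver noise). -/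
def multiplicative : Set (Source L K N) :=
  {i | match i with
    | .distortion _ _ => False
    | .noise _ _ => False
    | _ => True}

/-- All sources but the distortion at channel use `t`. -/
def withoutDistortionAt (t : ℕ) : Set (Source L K N) :=
  {i | match i with
    | .distortion _ s => s ≠ t
    | _ => True}

lemma distortion_notMem_multiplicative (n : Fin N) (s : ℕ) :
    (distortion n s : Source L K N) ∉ multiplicative := id

lemma noise_notMem_multiplicative (n : Fin N) (s : ℕ) :
    (noise n s : Source L K N) ∉ multiplicative := id

lemma channelSet_subset_channels (n : Fin N) :
    channelSet n ⊆ (channels : Set (Source L K N)) := by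
  rintro (_ | _ | _ | _ | _) h <;> simp_all [channelSet, channels]

lemma channels_subset_multiplicative :
    (channels : Set (Source L K N)) ⊆ multiplicative := by
  rintro (_ | _ | _ | _ | _) h <;> simp_all [multiplicative, channels]

lemma phases_subset_multiplicative :
    (phases : Set (Source L K N)) ⊆ multiplicative := by
  rintro (_ | _ | _ | _ | _) h <;> simp_all [multiplicative, phases]

lemma multiplicative_subset_withoutDistortionAt (t : ℕ) :
    (multiplicative : Set (Source L K N)) ⊆ withoutDistortionAt t := by
  rintro (_ | _ | _ | _ | _) h <;> simp_all [multiplicative, withoutDistortionAt]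

lemma phaseSetUpTo_subset_phaseSet (o : Fin N) (s : ℕ) :
    (phaseSetUpTo o s : Set (Source L K N)) ⊆ phaseSet o := by
  rintro (_ | _ | _ | _ | _) h <;> simp_all [phaseSet, phaseSetUpTo]

lemma phaseSetUpTo_mono (o : Fin N) {s s' : ℕ} (hs : s ≤ s') :
    (phaseSetUpTo o s : Set (Source L K N)) ⊆ phaseSetUpTo o s' := by
  rintro (_ | _ | _ | _ | _) h <;> simp_all [phaseSetUpTo]
  omega

lemma phaseSet_subset_phases (o : Fin N) : (phaseSet o : Set (Source L K N)) ⊆ phases := by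
  rintro (_ | _ | _ | _ | _) h <;> simp_all [phaseSet, phases]

lemma disjoint_phases_channels : Disjoint (phases : Set (Source L K N)) channels := by
  rw [Set.disjoint_left]
  rintro (_ | _ | _ | _ | _) h <;> simp_all [channels, phases]

lemma disjoint_phaseSet {o o' : Fin N} (h : o ≠ o') :
    Disjoint (phaseSet o : Set (Source L K N)) (phaseSet o') := by
  rw [Set.disjoint_left]
  rintro (_ | _ | _ | _ | _) h' <;> simp_all [phaseSet]

lemma disjoint_channelSet {n n' : Fin N} (h : n ≠ n') :
    Disjoint (channelSet n : Set (Source L K N)) (channelSet n') := by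
  rw [Set.disjoint_left]
  rintro (_ | _ | _ | _ | _) h' <;> simp_all [channelSet]

end Source

namespace UplinkModel

variable {L K B : ℕ} {net : Network L K B} {hw : Hardware} {lo : LOType} {j : Fin L} {N : ℕ}
  (M : UplinkModel.{u} net hw lo j N)

/-- The independent random variables of the model, all regarded as complex. -/
noncomputable def source : Source L K N → M.Ω → ℂ
  | .channel l m n => M.channel l m n
  | .initialPhase o => fun ω ↦ (M.initialPhase o ω : ℂ)
  | .innovation o s => fun ω ↦ (M.innovation o s ω : ℂ)
  | .distortion n s => M.stdDistortion n s
  | .noise n s => M.noise n s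

lemma iIndepFun_source : iIndepFun M.source M.μ := by
  convert M.indep using 1
  ext i ω
  cases i <;> rfl

lemma aemeasurable_source (i : Source L K N) : AEMeasurable (M.source i) M.μ := by
  cases i with
  | channel l m n => exact (M.law_channel l m n).aemeasurable
  | initialPhase o =>
    exact (Complex.measurable_ofReal.comp (M.measurable_initialPhase o)).aemeasurable
  | innovation o s =>
    exact Complex.measurable_ofReal.comp_aemeasurable (M.law_innovation o s).aemeasurable
  | distortion n s => exact (M.law_stdDistortion n s).aemeasurable
  | noise n s => exact (M.law_noise n s).aemeasurable

/-- The random variables with finite moments of all orders that depend on the sources in `S`. -/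
noncomputable abbrev alg (S : Set (Source L K N)) : StarSubalgebra ℂ (M.Ω → ℂ) :=
  momentAlgebra M.aemeasurable_source S

section Gaussian

variable {M}

lemma hasLaw_source {a : Source L K N} (ha : a.IsGaussian) :
    HasLaw (M.source a) (complexGaussian (a.power net hw j).toNNReal) M.μ := by
  cases a with
  | channel l m n => exact M.law_channel l m n
  | initialPhase o => exact ha.elim
  | innovation o s => exact ha.elim
  | distortion n s => simpa [Source.power, source] using M.law_stdDistortion n s
  | noise n s => exact M.law_noise n s

lemma power_nonneg (hxi : 0 ≤ hw.xi) (a : Source L K N) : 0 ≤ a.power net hw j := by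
  cases a with
  | channel l m n => exact (net.lam_pos j l m).le
  | noise n s => exact mul_nonneg (sq_nonneg _) hxi
  | _ => simp [Source.power]

lemma source_mem {a : Source L K N} (ha : a.IsGaussian) {S : Set (Source L K N)} (haS : a ∈ S) :
    M.source a ∈ M.alg S := by
  refine ⟨aestronglyMeasurable_source _ haS, fun p ↦ ?_⟩
  have h := hasLaw_source (M := M) ha
  have h1 := memLp_id_complexGaussian (a.power net hw j).toNNReal p
  rw [← h.map_eq] at h1
  exact (memLp_map_measure_iff h1.1 h.aemeasurable).1 h1

lemma integral_source {a : Source L K N} (ha : a.IsGaussian) : ∫ ω, M.source a ω ∂M.μ = 0 := by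
  rw [(hasLaw_source ha).integral_eq, integral_id_complexGaussian]

lemma integral_source_mul_conj (hxi : 0 ≤ hw.xi) {a : Source L K N} (ha : a.IsGaussian) :
    ∫ ω, M.source a ω * conj (M.source a ω) ∂M.μ = (a.power net hw j : ℂ) := by
  have h := (hasLaw_source (M := M) ha).integral_comp (f := fun z ↦ z * conj z)
    (by fun_prop)
  rw [integral_mul_conj_complexGaussian, Real.coe_toNNReal _ (power_nonneg hxi a)] at h
  exact h

lemma integral_source_mul_conj_sq (hxi : 0 ≤ hw.xi) {a : Source L K N} (ha : a.IsGaussian) :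
    ∫ ω, (M.source a ω * conj (M.source a ω)) * (M.source a ω * conj (M.source a ω)) ∂M.μ
      = 2 * (a.power net hw j : ℂ) ^ 2 := by
  have h := (hasLaw_source (M := M) ha).integral_comp (f := fun z ↦ (z * conj z) * (z * conj z))
    (by fun_prop)
  rw [integral_mul_conj_sq_complexGaussian, Real.coe_toNNReal _ (power_nonneg hxi a)] at h
  exact h

variable {S : Set (Source L K N)} {a a' : Source L K N} {Y : M.Ω → ℂ}

lemma integral_mul_source_eq_zero (hY : Y ∈ M.alg S) (ha : a.IsGaussian) (haS : a ∉ S) :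
    ∫ ω, Y ω * M.source a ω ∂M.μ = 0 := by
  rw [integral_mul_of_disjoint M.iIndepFun_source (Set.disjoint_singleton_right.2 haS) hY
    (source_mem ha rfl), integral_source ha, mul_zero]

lemma integral_mul_conj_source_eq_zero (hY : Y ∈ M.alg S) (ha : a.IsGaussian) (haS : a ∉ S) :
    ∫ ω, Y ω * conj (M.source a ω) ∂M.μ = 0 := by
  rw [integral_mul_of_disjoint M.iIndepFun_source (Set.disjoint_singleton_right.2 haS) hY
    (conj_mem_momentAlgebra (source_mem ha rfl)), integral_conj, integral_source ha, map_zero,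
    mul_zero]

open Classical in
/-- Gaussian sources outside `S` are white, also against a weight that depends on `S`. -/
lemma integral_mul_source_mul_conj_source (hxi : 0 ≤ hw.xi) (hY : Y ∈ M.alg S)
    (ha : a.IsGaussian) (haS : a ∉ S) (ha' : a'.IsGaussian) :
    ∫ ω, Y ω * (M.source a ω * conj (M.source a' ω)) ∂M.μ
      = if a = a' then (∫ ω, Y ω ∂M.μ) * (a.power net hw j : ℂ) else 0 := by
  split_ifs with h
  · subst h
    rw [integral_mul_of_disjoint M.iIndepFun_source (Set.disjoint_singleton_right.2 haS) hY
      (mul_mem_momentAlgebra (source_mem ha rfl) (conj_mem_momentAlgebra (source_mem ha rfl))),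
      integral_source_mul_conj hxi ha]
  · have h1 : (fun ω ↦ Y ω * conj (M.source a' ω)) ∈ M.alg (S ∪ {a'}) :=
      mul_mem_momentAlgebra (momentAlgebra_mono Set.subset_union_left hY)
        (conj_mem_momentAlgebra (source_mem ha' (Or.inr rfl)))
    rw [← integral_mul_source_eq_zero h1 ha (by simp [haS, h])]
    congr 1
    ext ω
    ring

end Gaussian

section Phase

variable {M}

/-- The phase rotation at antenna `n`, channel use `t`. -/
noncomputable def rotation (M : UplinkModel.{u} net hw lo j N) (n : Fin N) (t : ℕ) (ω : M.Ω) : ℂ :=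
  Complex.exp (Complex.I * (M.phase n t ω : ℂ))

lemma norm_rotation (n : Fin N) (t : ℕ) (ω : M.Ω) : ‖M.rotation n t ω‖ = 1 := by
  rw [rotation, mul_comm, Complex.norm_exp_ofReal_mul_I]

lemma rotation_mul_conj_self (n : Fin N) (t : ℕ) (ω : M.Ω) :
    M.rotation n t ω * conj (M.rotation n t ω) = 1 := by
  rw [Complex.mul_conj, Complex.normSq_eq_norm_sq, norm_rotation]
  simp

lemma rotation_succ (n : Fin N) (t : ℕ) (ω : M.Ω) :
    M.rotation n (t + 1) ω = M.rotation n t ω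
      * Complex.exp (Complex.I * (M.innovation (lo.oscillator n) (t + 1) ω : ℂ)) := by
  rw [rotation, rotation, ← Complex.exp_add, phase, phase, Finset.sum_Icc_succ_top (by omega)]
  push_cast
  congr 1
  ring

lemma exp_innovation_mem (o : Fin N) (s : ℕ) {S : Set (Source L K N)}
    (hS : .innovation o s ∈ S) :
    (fun ω ↦ Complex.exp (Complex.I * (M.innovation o s ω : ℂ))) ∈ M.alg S := by
  refine mem_momentAlgebra_of_norm_le (T := ∅) ?_ (const_mem_momentAlgebra 1) fun ω ↦ ?_
  · exact (Complex.continuous_exp.comp (continuous_const.mul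
      continuous_id)).comp_aestronglyMeasurable
      (aestronglyMeasurable_source M.aemeasurable_source hS)
  · rw [mul_comm, Complex.norm_exp_ofReal_mul_I]
    simp

/-- The rotation at time `t` does not depend on later phase increments. -/
lemma rotation_mem_upTo (n : Fin N) (t : ℕ) :
    M.rotation n t ∈ M.alg (Source.phaseSetUpTo (lo.oscillator n) t) := by
  induction t with
  | zero =>
    refine mem_momentAlgebra_of_norm_le (T := ∅) ?_ (const_mem_momentAlgebra 1)
      fun ω ↦ by simp [norm_rotation]
    have h0 := aestronglyMeasurable_source M.aemeasurable_source
      (S := Source.phaseSetUpTo (lo.oscillator n) 0) (i := .initialPhase (lo.oscillator n)) rfl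
    have h1 := (Complex.continuous_exp.comp (continuous_const.mul
      continuous_id)).comp_aestronglyMeasurable (g := fun z ↦ Complex.exp (Complex.I * z)) h0
    refine h1.congr (ae_of_all _ fun ω ↦ ?_)
    simp [rotation, phase, source]
  | succ t ih =>
    have h : M.rotation n (t + 1) = fun ω ↦ M.rotation n t ω
        * Complex.exp (Complex.I * (M.innovation (lo.oscillator n) (t + 1) ω : ℂ)) :=
      funext (rotation_succ n t)
    rw [h]
    exact mul_mem_momentAlgebra (momentAlgebra_mono (Source.phaseSetUpTo_mono _ t.le_succ) ih)
      (exp_innovation_mem _ _ ⟨rfl, le_rfl⟩)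

lemma rotation_mem (n : Fin N) (t : ℕ) :
    M.rotation n t ∈ M.alg (Source.phaseSet (lo.oscillator n)) :=
  momentAlgebra_mono (Source.phaseSetUpTo_subset_phaseSet _ _) (rotation_mem_upTo n t)

/-- The characteristic function of the increment, evaluated at `1`. -/
lemma integral_exp_innovation (hδ : 0 ≤ hw.delta) (o : Fin N) (s : ℕ) :
    ∫ ω, Complex.exp (Complex.I * (M.innovation o s ω : ℂ)) ∂M.μ
      = (Real.exp (-hw.delta / 2) : ℂ) := by
  have h := (M.law_innovation o s).integral_comp
    (f := fun x : ℝ ↦ Complex.exp (Complex.I * (x : ℂ))) (by fun_prop)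
  have h2 := charFun_gaussianReal (μ := 0) (v := hw.delta.toNNReal) 1
  rw [charFun_apply_real] at h2
  have h3 : ∫ ω, Complex.exp (Complex.I * (M.innovation o s ω : ℂ)) ∂M.μ
      = ∫ x : ℝ, Complex.exp (((1 : ℝ) : ℂ) * (x : ℂ) * Complex.I)
          ∂(gaussianReal 0 hw.delta.toNNReal) := by
    simp_rw [Complex.ofReal_one, one_mul]
    simp_rw [mul_comm _ Complex.I]
    exact h
  rw [h3, h2]
  push_cast
  congr 1
  simp [hδ]
  ring

lemma integral_rotation_mul_conj_add (hδ : 0 ≤ hw.delta) (n : Fin N) (s d : ℕ) :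
    ∫ ω, M.rotation n (s + d) ω * conj (M.rotation n s ω) ∂M.μ
      = (Real.exp (-hw.delta / 2) : ℂ) ^ d := by
  induction d with
  | zero => simp [rotation_mul_conj_self]
  | succ d ih =>
    have h1 : (fun ω ↦ M.rotation n (s + d) ω * conj (M.rotation n s ω))
        ∈ M.alg (Source.phaseSetUpTo (lo.oscillator n) (s + d)) :=
      mul_mem_momentAlgebra (rotation_mem_upTo n _) (conj_mem_momentAlgebra
        (momentAlgebra_mono (Source.phaseSetUpTo_mono _ (by omega)) (rotation_mem_upTo n _)))
    have h3 : Disjoint (Source.phaseSetUpTo (lo.oscillator n) (s + d) : Set (Source L K N))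
        {.innovation (lo.oscillator n) (s + d + 1)} := by
      rw [Set.disjoint_singleton_right]
      simp [Source.phaseSetUpTo]
    have h4 := integral_mul_of_disjoint M.iIndepFun_source h3 h1 (exp_innovation_mem _ _ rfl)
    rw [ih, integral_exp_innovation hδ, ← pow_succ] at h4
    rw [← h4]
    congr 1
    ext ω
    rw [← add_assoc, rotation_succ]
    ring

/-- The autocorrelation of the phase rotation decays geometrically. -/
lemma integral_rotation_mul_conj (hδ : 0 ≤ hw.delta) (n : Fin N) (s s' : ℕ) :
    ∫ ω, M.rotation n s ω * conj (M.rotation n s' ω) ∂M.μ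
      = (Real.exp (-hw.delta / 2) : ℂ) ^ (Nat.dist s s') := by
  rcases le_total s' s with h | h
  · obtain ⟨d, rfl⟩ := Nat.exists_eq_add_of_le h
    rw [integral_rotation_mul_conj_add hδ, Nat.dist_comm, Nat.dist_eq_sub_of_le h,
      Nat.add_sub_cancel_left]
  · obtain ⟨d, rfl⟩ := Nat.exists_eq_add_of_le h
    rw [Nat.dist_eq_sub_of_le h, Nat.add_sub_cancel_left]
    have h1 := congrArg conj (integral_rotation_mul_conj_add (M := M) hδ n s d)
    rw [← integral_conj] at h1
    simp only [map_mul, map_pow, Complex.conj_ofReal, Complex.conj_conj] at h1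
    rw [← h1]
    congr 1
    ext ω
    ring

end Phase

end UplinkModel

/-! ### The received pilot signal and its additive noise -/

section Deterministic

variable {L K B : ℕ}

/-- The correlation `x(b) * conj x(b')` of the pilot symbols of user `q`. -/
noncomputable def pilotGram (net : Network L K B) (q : Fin L × Fin K) (b b' : Fin B) : ℂ :=
  net.pilot q.1 q.2 b * conj (net.pilot q.1 q.2 b')

/-- The covariance matrix of the pilot signal received at one antenna of base station `j`. Here `κ`
is the distortion level `κ²`, `ν` the power of the receiver noise, and `g = exp (-δ / 2)` the
correlation of the phase rotations at consecutive channel uses. -/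
noncomputable def pilotCov (net : Network L K B) (j : Fin L) (κ ν g : ℝ) :
    Matrix (Fin B) (Fin B) ℂ :=
  fun b b' ↦ (g : ℂ) ^ Nat.dist b b'
      * ∑ q : Fin L × Fin K, (net.lam j q.1 q.2 : ℂ) * pilotGram net q b b'
    + if b = b' then
        (κ : ℂ) * (∑ q : Fin L × Fin K, (net.p q.1 q.2 : ℂ) * (net.lam j q.1 q.2 : ℂ)) + (ν : ℂ)
      else 0

/-- The covariance matrix of the pilot signal received at one antenna, weighted with the squared
modulus of the channel of user `q` to that antenna. -/
noncomputable def weightedCov (net : Network L K B) (j : Fin L) (κ ν g : ℝ) (q : Fin L × Fin K) :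
    Matrix (Fin B) (Fin B) ℂ :=
  fun b b' ↦ (net.lam j q.1 q.2 : ℂ) * pilotCov net j κ ν g b b'
    + (net.lam j q.1 q.2 : ℂ) ^ 2 * ((g : ℂ) ^ Nat.dist b b' * pilotGram net q b b')
    + if b = b' then (κ : ℂ) * ((net.p q.1 q.2 : ℂ) * (net.lam j q.1 q.2 : ℂ) ^ 2) else 0

/-- The covariance of the effective channel of user `q` at channel use `t` with the pilot signal
at the same antenna. -/
noncomputable def crossCov (net : Network L K B) (j : Fin L) (g : ℝ) (t : ℕ) (q : Fin L × Fin K) :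
    Fin B → ℂ :=
  fun b ↦ (net.lam j q.1 q.2 : ℂ) * conj (net.pilot q.1 q.2 b) * (g : ℂ) ^ (t - (b + 1))

/-- For two different antennas, the correlation of the phase drift between channel uses `b` and `t`
at one antenna with the phase drift between `b'` and `t` at the other one. -/
noncomputable def driftCorr (lo : LOType) (g : ℝ) (t : ℕ) (b b' : Fin B) : ℂ :=
  match lo with
  | .common => (g : ℂ) ^ Nat.dist b b'
  | .separate => (g : ℂ) ^ (t - (b + 1)) * (g : ℂ) ^ (t - (b' + 1))

end Deterministic

namespace UplinkModel

variable {L K B : ℕ} {net : Network L K B} {hw : Hardware} {lo : LOType} {j : Fin L} {N : ℕ}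
  {M : UplinkModel.{u} net hw lo j N}

lemma integral_add_of_mem {S : Set (Source L K N)} {f g : M.Ω → ℂ} (hf : f ∈ M.alg S)
    (hg : g ∈ M.alg S) : ∫ ω, (f ω + g ω) ∂M.μ = ∫ ω, f ω ∂M.μ + ∫ ω, g ω ∂M.μ :=
  integral_add (integrable_of_mem_momentAlgebra hf) (integrable_of_mem_momentAlgebra hg)

lemma integral_sum_of_mem {S : Set (Source L K N)} {ι : Type*} {s : Finset ι} {F : ι → M.Ω → ℂ}
    (hF : ∀ i ∈ s, F i ∈ M.alg S) : ∫ ω, ∑ i ∈ s, F i ω ∂M.μ = ∑ i ∈ s, ∫ ω, F i ω ∂M.μ :=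
  integral_finsetSum _ fun i hi ↦ integrable_of_mem_momentAlgebra (hF i hi)

/-- The channel coefficient from user `q` to antenna `n`. -/
def chan (M : UplinkModel.{u} net hw lo j N) (q : Fin L × Fin K) (n : Fin N) : M.Ω → ℂ :=
  M.channel q.1 q.2 n

/-- The undistorted pilot signal at antenna `n`, channel use `b + 1`, before the phase drift. -/
noncomputable def mixture (M : UplinkModel.{u} net hw lo j N) (n : Fin N) (b : Fin B)
    (ω : M.Ω) : ℂ :=
  ∑ q : Fin L × Fin K, net.pilot q.1 q.2 b * M.chan q n ω

/-- The standard deviation of the distortion at antenna `n`, given the channels. -/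
noncomputable def amplitude (M : UplinkModel.{u} net hw lo j N) (n : Fin N) (ω : M.Ω) : ℂ :=
  (Real.sqrt (hw.kappaSq * ∑ l, ∑ m, net.p l m * ‖M.channel l m n ω‖ ^ 2) : ℂ)

/-- The additive noise (distortion and receiver noise) in the pilot signal. -/
noncomputable def pilotNoise (M : UplinkModel.{u} net hw lo j N) (i : Fin N × Fin B)
    (ω : M.Ω) : ℂ :=
  M.amplitude i.1 ω * M.source (.distortion i.1 (i.2 + 1)) ω + M.source (.noise i.1 (i.2 + 1)) ω

lemma pilotSignal_eq (ω : M.Ω) (i : Fin N × Fin B) :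
    M.pilotSignal ω i = M.rotation i.1 (i.2 + 1) ω * M.mixture i.1 i.2 ω + M.pilotNoise i ω := by
  simp only [pilotSignal, pilotNoise, mixture, effChannel, distortion, amplitude, source, rotation,
    chan, add_assoc, Finset.mul_sum, Fintype.sum_prod_type]
  congr 1
  refine Finset.sum_congr rfl fun l _ ↦ Finset.sum_congr rfl fun m _ ↦ ?_
  ring

lemma chan_mem (q : Fin L × Fin K) (n : Fin N) : M.chan q n ∈ M.alg (Source.channelSet n) :=
  source_mem (a := .channel q.1 q.2 n) trivial rfl

lemma mixture_mem (n : Fin N) (b : Fin B) : M.mixture n b ∈ M.alg (Source.channelSet n) :=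
  sum_mem_momentAlgebra fun q _ ↦ const_mul_mem_momentAlgebra _ (chan_mem q n)

lemma amplitude_mul_conj (hκ : 0 ≤ hw.kappaSq) (n : Fin N) (ω : M.Ω) :
    M.amplitude n ω * conj (M.amplitude n ω)
      = (hw.kappaSq : ℂ) * ∑ q : Fin L × Fin K,
          (net.p q.1 q.2 : ℂ) * (M.chan q n ω * conj (M.chan q n ω)) := by
  rw [amplitude, Complex.conj_ofReal, ← Complex.ofReal_mul, Real.mul_self_sqrt]
  · simp [Fintype.sum_prod_type, chan, Complex.mul_conj, Complex.normSq_eq_norm_sq]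
  · exact mul_nonneg hκ (Finset.sum_nonneg fun l _ ↦ Finset.sum_nonneg fun m _ ↦
      mul_nonneg (net.p_nonneg l m) (sq_nonneg _))

lemma amplitude_mem (hκ : 0 ≤ hw.kappaSq) (n : Fin N) :
    M.amplitude n ∈ M.alg (Source.channelSet n) := by
  have h1 : (fun ω ↦ M.amplitude n ω * conj (M.amplitude n ω)) ∈ M.alg (Source.channelSet n) := by
    simp_rw [amplitude_mul_conj hκ]
    exact const_mul_mem_momentAlgebra _ (sum_mem_momentAlgebra fun q _ ↦
      const_mul_mem_momentAlgebra _ (mul_mem_momentAlgebra (chan_mem q n)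
        (conj_mem_momentAlgebra (chan_mem q n))))
  have h2 (ω : M.Ω) : 0 ≤ hw.kappaSq * ∑ l, ∑ m, net.p l m * ‖M.channel l m n ω‖ ^ 2 :=
    mul_nonneg hκ (Finset.sum_nonneg fun l _ ↦ Finset.sum_nonneg fun m _ ↦
      mul_nonneg (net.p_nonneg l m) (sq_nonneg _))
  have h3 (ω : M.Ω) : M.amplitude n ω * conj (M.amplitude n ω)
      = ((hw.kappaSq * ∑ l, ∑ m, net.p l m * ‖M.channel l m n ω‖ ^ 2 : ℝ) : ℂ) := by
    rw [amplitude, Complex.conj_ofReal, ← Complex.ofReal_mul, Real.mul_self_sqrt (h2 ω)]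
  refine mem_momentAlgebra_of_norm_le (T := Source.channelSet n)
    (g := fun ω ↦ 1 + M.amplitude n ω * conj (M.amplitude n ω)) ?_
    (add_mem_momentAlgebra (const_mem_momentAlgebra 1) h1) fun ω ↦ ?_
  · have hc : Continuous fun z : ℂ ↦ ((Real.sqrt z.re : ℝ) : ℂ) := by fun_prop
    refine (hc.comp_aestronglyMeasurable h1.1).congr (ae_of_all _ fun ω ↦ ?_)
    simp only [h3, Complex.ofReal_re]
    rfl
  · rw [h3, ← Complex.ofReal_one, ← Complex.ofReal_add, amplitude, Complex.norm_real,
      Complex.norm_real, Real.norm_of_nonneg (Real.sqrt_nonneg _),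
      Real.norm_of_nonneg (by linarith [h2 ω])]
    -- `√x ≤ 1 + x` for `0 ≤ x`
    nlinarith [Real.sq_sqrt (h2 ω), sq_nonneg (Real.sqrt (hw.kappaSq
      * ∑ l, ∑ m, net.p l m * ‖M.channel l m n ω‖ ^ 2) - 1)]

lemma mem_multiplicative_of_channelSet {n : Fin N} {f : M.Ω → ℂ}
    (hf : f ∈ M.alg (Source.channelSet n)) : f ∈ M.alg Source.multiplicative :=
  momentAlgebra_mono ((Source.channelSet_subset_channels n).trans
    Source.channels_subset_multiplicative) hf

lemma rotation_mem_phases (n : Fin N) (t : ℕ) : M.rotation n t ∈ M.alg Source.phases :=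
  momentAlgebra_mono (Source.phaseSet_subset_phases _) (rotation_mem n t)

lemma rotation_mem_multiplicative (n : Fin N) (t : ℕ) :
    M.rotation n t ∈ M.alg Source.multiplicative :=
  momentAlgebra_mono Source.phases_subset_multiplicative (rotation_mem_phases n t)

lemma rotation_mul_mixture_mem (n : Fin N) (t : ℕ) (b : Fin B) :
    (fun ω ↦ M.rotation n t ω * M.mixture n b ω) ∈ M.alg Source.multiplicative :=
  mul_mem_momentAlgebra (rotation_mem_multiplicative n t)
    (mem_multiplicative_of_channelSet (mixture_mem n b))

/-- The distortion during the pilot phase is not the distortion at a later channel use `t`. -/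
lemma pilotNoise_mem (hκ : 0 ≤ hw.kappaSq) (i : Fin N × Fin B) {t : ℕ} (ht : B < t) :
    M.pilotNoise i ∈ M.alg (Source.withoutDistortionAt t) := by
  refine add_mem_momentAlgebra (mul_mem_momentAlgebra (momentAlgebra_mono
    (Source.multiplicative_subset_withoutDistortionAt t)
    (mem_multiplicative_of_channelSet (amplitude_mem hκ i.1)))
    (source_mem (Source.isGaussian_distortion _ _) ?_))
    (source_mem (Source.isGaussian_noise _ _) trivial)
  have := i.2.2
  change (i.2 : ℕ) + 1 ≠ t
  omega

lemma pilotSignal_mem (hκ : 0 ≤ hw.kappaSq) (i : Fin N × Fin B) {t : ℕ} (ht : B < t) :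
    (fun ω ↦ M.pilotSignal ω i) ∈ M.alg (Source.withoutDistortionAt t) := by
  simp_rw [pilotSignal_eq]
  exact add_mem_momentAlgebra (momentAlgebra_mono
    (Source.multiplicative_subset_withoutDistortionAt t) (rotation_mul_mixture_mem _ _ _))
    (pilotNoise_mem hκ i ht)

lemma pilotSignal_mem_univ (hκ : 0 ≤ hw.kappaSq) (i : Fin N × Fin B) :
    (fun ω ↦ M.pilotSignal ω i) ∈ M.alg Set.univ :=
  momentAlgebra_mono (Set.subset_univ _) (pilotSignal_mem hκ i B.lt_succ_self)

section AdditiveNoise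

variable {Y : M.Ω → ℂ}

lemma integral_mul_pilotNoise (hκ : 0 ≤ hw.kappaSq) (hY : Y ∈ M.alg Source.multiplicative)
    (i : Fin N × Fin B) : ∫ ω, Y ω * M.pilotNoise i ω ∂M.μ = 0 := by
  have ha := mem_multiplicative_of_channelSet (amplitude_mem (M := M) hκ i.1)
  have e (ω : M.Ω) : Y ω * M.pilotNoise i ω
      = (Y ω * M.amplitude i.1 ω) * M.source (.distortion i.1 (i.2 + 1)) ω
        + Y ω * M.source (.noise i.1 (i.2 + 1)) ω := by
    rw [pilotNoise]; ring
  have hu {f : M.Ω → ℂ} (hf : f ∈ M.alg Source.multiplicative) : f ∈ M.alg Set.univ :=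
    momentAlgebra_mono (Set.subset_univ _) hf
  simp_rw [e]
  rw [integral_add_of_mem (S := Set.univ)
    (mul_mem_momentAlgebra (hu (mul_mem_momentAlgebra hY ha))
      (source_mem (Source.isGaussian_distortion _ _) trivial))
    (mul_mem_momentAlgebra (hu hY) (source_mem (Source.isGaussian_noise _ _) trivial)),
    integral_mul_source_eq_zero (mul_mem_momentAlgebra hY ha) (Source.isGaussian_distortion _ _)
      (Source.distortion_notMem_multiplicative _ _),
    integral_mul_source_eq_zero hY (Source.isGaussian_noise _ _)
      (Source.noise_notMem_multiplicative _ _), add_zero]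

lemma integral_mul_conj_pilotNoise (hκ : 0 ≤ hw.kappaSq) (hY : Y ∈ M.alg Source.multiplicative)
    (i : Fin N × Fin B) : ∫ ω, Y ω * conj (M.pilotNoise i ω) ∂M.μ = 0 := by
  have h := congrArg conj (integral_mul_pilotNoise hκ (conj_mem_momentAlgebra hY) i)
  rw [← integral_conj] at h
  simpa using h

open Classical in
/-- The additive noise is white given the channels and phases; its conditional variance is the
squared amplitude of the distortion plus the power of the receiver noise. -/
lemma integral_mul_pilotNoise_mul_conj (hκ : 0 ≤ hw.kappaSq) (hxi : 0 ≤ hw.xi)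
    (hY : Y ∈ M.alg Source.multiplicative) (i i' : Fin N × Fin B) :
    ∫ ω, Y ω * (M.pilotNoise i ω * conj (M.pilotNoise i' ω)) ∂M.μ
      = if i = i' then ∫ ω, Y ω * (M.amplitude i.1 ω * conj (M.amplitude i.1 ω)) ∂M.μ
          + (∫ ω, Y ω ∂M.μ) * ((net.sigma ^ 2 * hw.xi : ℝ) : ℂ) else 0 := by
  have ha (n : Fin N) := mem_multiplicative_of_channelSet (amplitude_mem (M := M) hκ n)
  have hu {f : M.Ω → ℂ} (hf : f ∈ M.alg Source.multiplicative) : f ∈ M.alg Set.univ :=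
    momentAlgebra_mono (Set.subset_univ _) hf
  have e (ω : M.Ω) : Y ω * (M.pilotNoise i ω * conj (M.pilotNoise i' ω))
      = (((Y ω * (M.amplitude i.1 ω * conj (M.amplitude i'.1 ω)))
          * (M.source (.distortion i.1 (i.2 + 1)) ω
            * conj (M.source (.distortion i'.1 (i'.2 + 1)) ω))
        + (Y ω * M.amplitude i.1 ω)
          * (M.source (.distortion i.1 (i.2 + 1)) ω * conj (M.source (.noise i'.1 (i'.2 + 1)) ω)))
        + (Y ω * conj (M.amplitude i'.1 ω))
          * (M.source (.noise i.1 (i.2 + 1)) ω * conj (M.source (.distortion i'.1 (i'.2 + 1)) ω)))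
        + Y ω
          * (M.source (.noise i.1 (i.2 + 1)) ω * conj (M.source (.noise i'.1 (i'.2 + 1)) ω)) := by
    simp only [pilotNoise, map_add, map_mul]
    ring
  have h1 := mul_mem_momentAlgebra hY (mul_mem_momentAlgebra (ha i.1)
    (conj_mem_momentAlgebra (ha i'.1)))
  have h2 := mul_mem_momentAlgebra hY (ha i.1)
  have h3 := mul_mem_momentAlgebra hY (conj_mem_momentAlgebra (ha i'.1))
  have hs {a a' : Source L K N} (h : a.IsGaussian) (h' : a'.IsGaussian) :
      (fun ω ↦ M.source a ω * conj (M.source a' ω)) ∈ M.alg Set.univ :=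
    mul_mem_momentAlgebra (source_mem h trivial) (conj_mem_momentAlgebra (source_mem h' trivial))
  have g1 := mul_mem_momentAlgebra (hu h1) (hs (a := .distortion i.1 (i.2 + 1))
    (a' := .distortion i'.1 (i'.2 + 1)) trivial trivial)
  have g2 := mul_mem_momentAlgebra (hu h2) (hs (a := .distortion i.1 (i.2 + 1))
    (a' := .noise i'.1 (i'.2 + 1)) trivial trivial)
  have g3 := mul_mem_momentAlgebra (hu h3) (hs (a := .noise i.1 (i.2 + 1))
    (a' := .distortion i'.1 (i'.2 + 1)) trivial trivial)
  have g4 := mul_mem_momentAlgebra (hu hY) (hs (a := .noise i.1 (i.2 + 1))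
    (a' := .noise i'.1 (i'.2 + 1)) trivial trivial)
  simp_rw [e]
  rw [integral_add_of_mem (add_mem_momentAlgebra (add_mem_momentAlgebra g1 g2) g3) g4,
    integral_add_of_mem (add_mem_momentAlgebra g1 g2) g3, integral_add_of_mem g1 g2,
    integral_mul_source_mul_conj_source hxi h1 (Source.isGaussian_distortion _ _)
      (Source.distortion_notMem_multiplicative _ _) (Source.isGaussian_distortion _ _),
    integral_mul_source_mul_conj_source hxi h2 (Source.isGaussian_distortion _ _)
      (Source.distortion_notMem_multiplicative _ _) (Source.isGaussian_noise _ _),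
    integral_mul_source_mul_conj_source hxi h3 (Source.isGaussian_noise _ _)
      (Source.noise_notMem_multiplicative _ _) (Source.isGaussian_distortion _ _),
    integral_mul_source_mul_conj_source hxi hY (Source.isGaussian_noise _ _)
      (Source.noise_notMem_multiplicative _ _) (Source.isGaussian_noise _ _)]
  by_cases hi : i = i'
  · subst hi
    simp [Source.power]
  · have h5 : ¬ (i.1 = i'.1 ∧ (i.2 : ℕ) = i'.2) := by
      rintro ⟨h6, h7⟩
      exact hi (Prod.ext h6 (Fin.ext h7))
    simp [hi, h5]

/-- Additive noise is uncorrelated with everything that depends on channels and phases only. -/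
lemma integral_mul_conj_pilotSignal (hκ : 0 ≤ hw.kappaSq) (hY : Y ∈ M.alg Source.multiplicative)
    (i : Fin N × Fin B) :
    ∫ ω, Y ω * conj (M.pilotSignal ω i) ∂M.μ
      = ∫ ω, Y ω * conj (M.rotation i.1 (i.2 + 1) ω * M.mixture i.1 i.2 ω) ∂M.μ := by
  have hu {f : M.Ω → ℂ} (hf : f ∈ M.alg Source.multiplicative) :
      f ∈ M.alg (Source.withoutDistortionAt (B + 1)) :=
    momentAlgebra_mono (Source.multiplicative_subset_withoutDistortionAt _) hf
  simp_rw [pilotSignal_eq, map_add, mul_add]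
  rw [integral_add_of_mem (hu (mul_mem_momentAlgebra hY (conj_mem_momentAlgebra
    (rotation_mul_mixture_mem _ _ _)))) (mul_mem_momentAlgebra (hu hY)
    (conj_mem_momentAlgebra (pilotNoise_mem hκ i B.lt_succ_self))),
    integral_mul_conj_pilotNoise hκ hY, add_zero]

open Classical in
/-- The additive noise contributes only its conditional variance to the second moments of the
pilot signal, also against a weight that depends on channels and phases. -/
lemma integral_mul_pilotSignal_mul_conj (hκ : 0 ≤ hw.kappaSq) (hxi : 0 ≤ hw.xi)
    (hY : Y ∈ M.alg Source.multiplicative) (i i' : Fin N × Fin B) :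
    ∫ ω, Y ω * (M.pilotSignal ω i * conj (M.pilotSignal ω i')) ∂M.μ
      = ∫ ω, Y ω * ((M.rotation i.1 (i.2 + 1) ω * M.mixture i.1 i.2 ω)
          * conj (M.rotation i'.1 (i'.2 + 1) ω * M.mixture i'.1 i'.2 ω)) ∂M.μ
        + if i = i' then ∫ ω, Y ω * (M.amplitude i.1 ω * conj (M.amplitude i.1 ω)) ∂M.μ
          + (∫ ω, Y ω ∂M.μ) * ((net.sigma ^ 2 * hw.xi : ℝ) : ℂ) else 0 := by
  have hu {f : M.Ω → ℂ} (hf : f ∈ M.alg Source.multiplicative) :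
      f ∈ M.alg (Source.withoutDistortionAt (B + 1)) :=
    momentAlgebra_mono (Source.multiplicative_subset_withoutDistortionAt _) hf
  have hS (i : Fin N × Fin B) := rotation_mul_mixture_mem (M := M) i.1 (i.2 + 1) i.2
  have hZ (i : Fin N × Fin B) := pilotNoise_mem (M := M) hκ i B.lt_succ_self
  have e (ω : M.Ω) : Y ω * (M.pilotSignal ω i * conj (M.pilotSignal ω i'))
      = ((Y ω * ((M.rotation i.1 (i.2 + 1) ω * M.mixture i.1 i.2 ω)
          * conj (M.rotation i'.1 (i'.2 + 1) ω * M.mixture i'.1 i'.2 ω))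
        + Y ω * (M.pilotNoise i ω * conj (M.pilotNoise i' ω)))
        + (Y ω * (M.rotation i.1 (i.2 + 1) ω * M.mixture i.1 i.2 ω)) * conj (M.pilotNoise i' ω))
        + (Y ω * conj (M.rotation i'.1 (i'.2 + 1) ω * M.mixture i'.1 i'.2 ω))
          * M.pilotNoise i ω := by
    simp only [pilotSignal_eq, map_add]
    ring
  have h1 := mul_mem_momentAlgebra hY
    (mul_mem_momentAlgebra (hS i) (conj_mem_momentAlgebra (hS i')))
  have h3 := mul_mem_momentAlgebra hY (hS i)
  have h4 := mul_mem_momentAlgebra hY (conj_mem_momentAlgebra (hS i'))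
  have g2 := mul_mem_momentAlgebra (hu hY)
    (mul_mem_momentAlgebra (hZ i) (conj_mem_momentAlgebra (hZ i')))
  have g3 := mul_mem_momentAlgebra (hu h3) (conj_mem_momentAlgebra (hZ i'))
  have g4 := mul_mem_momentAlgebra (hu h4) (hZ i)
  simp_rw [e]
  rw [integral_add_of_mem (add_mem_momentAlgebra (add_mem_momentAlgebra (hu h1) g2) g3) g4,
    integral_add_of_mem (add_mem_momentAlgebra (hu h1) g2) g3, integral_add_of_mem (hu h1) g2,
    integral_mul_pilotNoise_mul_conj hκ hxi hY, integral_mul_conj_pilotNoise hκ h3,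
    integral_mul_pilotNoise hκ h4, add_zero, add_zero]

end AdditiveNoise

end UplinkModel

/-! ### Second and fourth moments of channels, phases and pilot signals -/

namespace UplinkModel

variable {L K B : ℕ} {net : Network L K B} {hw : Hardware} {lo : LOType} {j : Fin L} {N : ℕ}
  {M : UplinkModel.{u} net hw lo j N}

section Channels

lemma chan_mem_channels (q : Fin L × Fin K) (n : Fin N) : M.chan q n ∈ M.alg Source.channels :=
  momentAlgebra_mono (Source.channelSet_subset_channels n) (chan_mem q n)

lemma mixture_mem_channels (n : Fin N) (b : Fin B) : M.mixture n b ∈ M.alg Source.channels :=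
  momentAlgebra_mono (Source.channelSet_subset_channels n) (mixture_mem n b)

lemma integral_chan_mul_conj (hxi : 0 ≤ hw.xi) (q q' : Fin L × Fin K) (n n' : Fin N) :
    ∫ ω, M.chan q n ω * conj (M.chan q' n' ω) ∂M.μ
      = if q = q' ∧ n = n' then (net.lam j q.1 q.2 : ℂ) else 0 := by
  have h := integral_mul_source_mul_conj_source (M := M) hxi (S := ∅) (const_mem_momentAlgebra 1)
    (Source.isGaussian_channel q.1 q.2 n) (Set.notMem_empty _)
    (Source.isGaussian_channel q'.1 q'.2 n')
  simp only [one_mul, integral_const, probReal_univ, one_smul, Source.power,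
    Source.channel.injEq] at h
  refine h.trans (if_congr ?_ rfl rfl)
  rw [← and_assoc, Prod.ext_iff]

/-- The fourth moments of the channel coefficients at one antenna. -/
lemma integral_normSq_chan_mul (hxi : 0 ≤ hw.xi) (q q₁ q₂ : Fin L × Fin K) (n : Fin N) :
    ∫ ω, (M.chan q n ω * conj (M.chan q n ω)) * (M.chan q₁ n ω * conj (M.chan q₂ n ω)) ∂M.μ
      = if q₁ = q₂ then (net.lam j q.1 q.2 : ℂ) * (net.lam j q₁.1 q₁.2 : ℂ)
          + (if q₁ = q then (net.lam j q.1 q.2 : ℂ) ^ 2 else 0) else 0 := by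
  -- If `q₁ ≠ q`, the channel of `q₁` is a white source with respect to that of `q`.
  by_cases h1 : q₁ = q
  · by_cases h2 : q₁ = q₂
    · subst h1 h2
      have h := integral_source_mul_conj_sq (M := M) hxi (Source.isGaussian_channel q₁.1 q₁.2 n)
      refine h.trans ?_
      simp [Source.power]
      ring
    · subst h1
      have hY : (fun ω ↦ (M.chan q₁ n ω * conj (M.chan q₁ n ω)) * M.chan q₁ n ω)
          ∈ M.alg {.channel q₁.1 q₁.2 n} := by
        have := source_mem (M := M) (Source.isGaussian_channel q₁.1 q₁.2 n)
          (Set.mem_singleton (Source.channel q₁.1 q₁.2 n))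
        exact mul_mem_momentAlgebra (mul_mem_momentAlgebra this (conj_mem_momentAlgebra this)) this
      have h := integral_mul_conj_source_eq_zero (a := .channel q₂.1 q₂.2 n) hY trivial (by
        simp only [Set.mem_singleton_iff, Source.channel.injEq, and_true]
        exact fun h ↦ h2 (Prod.ext h.1 h.2).symm)
      rw [if_neg h2, ← h]
      congr 1
      ext ω
      simp only [chan, source]
      ring
  · have hY : (fun ω ↦ M.chan q n ω * conj (M.chan q n ω)) ∈ M.alg {.channel q.1 q.2 n} := by
      have := source_mem (M := M) (Source.isGaussian_channel q.1 q.2 n)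
        (Set.mem_singleton (Source.channel q.1 q.2 n))
      exact mul_mem_momentAlgebra this (conj_mem_momentAlgebra this)
    have h := integral_mul_source_mul_conj_source (a := .channel q₁.1 q₁.2 n)
      (a' := .channel q₂.1 q₂.2 n) hxi hY trivial (by
        simp only [Set.mem_singleton_iff, Source.channel.injEq, and_true]
        exact fun h ↦ h1 (Prod.ext h.1 h.2)) trivial
    rw [integral_chan_mul_conj hxi] at h
    simp only [and_self, if_true, Source.power, Source.channel.injEq, and_true, ← Prod.ext_iff] at h
    rw [if_neg h1, add_zero]
    exact h

lemma integral_normSq_chan (hxi : 0 ≤ hw.xi) (q : Fin L × Fin K) (n : Fin N) :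
    ∫ ω, M.chan q n ω * conj (M.chan q n ω) ∂M.μ = (net.lam j q.1 q.2 : ℂ) := by
  rw [integral_chan_mul_conj hxi, if_pos ⟨rfl, rfl⟩]

lemma integral_chan_mul_conj_mixture (hxi : 0 ≤ hw.xi) (q : Fin L × Fin K) (n n' : Fin N)
    (b : Fin B) :
    ∫ ω, M.chan q n ω * conj (M.mixture n' b ω) ∂M.μ
      = if n = n' then (net.lam j q.1 q.2 : ℂ) * conj (net.pilot q.1 q.2 b) else 0 := by
  simp only [mixture, map_sum, map_mul, Finset.mul_sum]
  rw [integral_sum_of_mem fun q' _ ↦ mul_mem_momentAlgebra (chan_mem_channels q n)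
    (const_mul_mem_momentAlgebra _ (conj_mem_momentAlgebra (chan_mem_channels q' n')))]
  simp_rw [mul_left_comm _ (conj (net.pilot _ _ _)), integral_const_mul,
    integral_chan_mul_conj hxi]
  by_cases h : n = n'
  · simp [h, mul_comm]
  · simp [h]

lemma integral_mixture_mul_conj_chan (hxi : 0 ≤ hw.xi) (q : Fin L × Fin K) (n : Fin N)
    (b : Fin B) :
    ∫ ω, M.mixture n b ω * conj (M.chan q n ω) ∂M.μ
      = (net.lam j q.1 q.2 : ℂ) * net.pilot q.1 q.2 b := by
  have h := congrArg conj (integral_chan_mul_conj_mixture (M := M) hxi q n n b)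
  rw [← integral_conj] at h
  simp only [if_true, map_mul, Complex.conj_ofReal, Complex.conj_conj] at h
  rw [← h]
  congr 1
  ext ω
  ring

lemma integral_mul_mixture_mul_conj {Y : M.Ω → ℂ} (hY : Y ∈ M.alg Source.channels) (n n' : Fin N)
    (b b' : Fin B) :
    ∫ ω, Y ω * (M.mixture n b ω * conj (M.mixture n' b' ω)) ∂M.μ
      = ∑ q₁ : Fin L × Fin K, ∑ q₂ : Fin L × Fin K,
          (net.pilot q₁.1 q₁.2 b * conj (net.pilot q₂.1 q₂.2 b'))
            * ∫ ω, Y ω * (M.chan q₁ n ω * conj (M.chan q₂ n' ω)) ∂M.μ := by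
  have e (ω : M.Ω) : Y ω * (M.mixture n b ω * conj (M.mixture n' b' ω))
      = ∑ q₁ : Fin L × Fin K, ∑ q₂ : Fin L × Fin K,
          (net.pilot q₁.1 q₁.2 b * conj (net.pilot q₂.1 q₂.2 b'))
            * (Y ω * (M.chan q₁ n ω * conj (M.chan q₂ n' ω))) := by
    simp only [mixture, map_sum, map_mul]
    rw [Finset.sum_mul_sum]
    simp only [Finset.mul_sum]
    refine Finset.sum_congr rfl fun q₁ _ ↦ Finset.sum_congr rfl fun q₂ _ ↦ ?_
    ring
  have hm (q₁ q₂ : Fin L × Fin K) : (fun ω ↦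
      (net.pilot q₁.1 q₁.2 b * conj (net.pilot q₂.1 q₂.2 b'))
        * (Y ω * (M.chan q₁ n ω * conj (M.chan q₂ n' ω)))) ∈ M.alg Source.channels :=
    const_mul_mem_momentAlgebra _ (mul_mem_momentAlgebra hY (mul_mem_momentAlgebra
      (chan_mem_channels q₁ n) (conj_mem_momentAlgebra (chan_mem_channels q₂ n'))))
  simp_rw [e]
  rw [integral_sum_of_mem fun q₁ _ ↦ sum_mem_momentAlgebra fun q₂ _ ↦ hm q₁ q₂]
  refine Finset.sum_congr rfl fun q₁ _ ↦ ?_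
  rw [integral_sum_of_mem fun q₂ _ ↦ hm q₁ q₂]
  simp_rw [integral_const_mul]

lemma integral_mixture_mul_conj (hxi : 0 ≤ hw.xi) (n n' : Fin N) (b b' : Fin B) :
    ∫ ω, M.mixture n b ω * conj (M.mixture n' b' ω) ∂M.μ
      = if n = n' then ∑ q : Fin L × Fin K, (net.lam j q.1 q.2 : ℂ) * pilotGram net q b b'
        else 0 := by
  have h := integral_mul_mixture_mul_conj (M := M) (const_mem_momentAlgebra 1) n n' b b'
  simp only [one_mul, integral_chan_mul_conj hxi] at h
  rw [h]
  by_cases hn : n = n'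
  · simp [hn, pilotGram, mul_comm]
  · simp [hn]

/-- The second term is the excess of the fourth moment of the channel of user `q` itself. -/
lemma integral_normSq_chan_mul_mixture (hxi : 0 ≤ hw.xi) (q : Fin L × Fin K) (n : Fin N)
    (b b' : Fin B) :
    ∫ ω, (M.chan q n ω * conj (M.chan q n ω)) * (M.mixture n b ω * conj (M.mixture n b' ω)) ∂M.μ
      = (net.lam j q.1 q.2 : ℂ)
          * (∑ q' : Fin L × Fin K, (net.lam j q'.1 q'.2 : ℂ) * pilotGram net q' b b')
        + (net.lam j q.1 q.2 : ℂ) ^ 2 * pilotGram net q b b' := by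
  rw [integral_mul_mixture_mul_conj (mul_mem_momentAlgebra (chan_mem_channels q n)
    (conj_mem_momentAlgebra (chan_mem_channels q n)))]
  simp only [integral_normSq_chan_mul hxi, mul_ite, mul_zero, Finset.sum_ite_eq,
    Finset.mem_univ, if_true, mul_add, Finset.sum_add_distrib, Finset.sum_ite_eq', Finset.mul_sum]
  refine congr_arg₂ _ (Finset.sum_congr rfl fun q₁ _ ↦ ?_) ?_ <;> simp only [pilotGram] <;> ring

lemma integral_normSq_chan_mul_amplitude (hκ : 0 ≤ hw.kappaSq) (hxi : 0 ≤ hw.xi)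
    (q : Fin L × Fin K) (n : Fin N) :
    ∫ ω, (M.chan q n ω * conj (M.chan q n ω)) * (M.amplitude n ω * conj (M.amplitude n ω)) ∂M.μ
      = (hw.kappaSq : ℂ) * ((net.lam j q.1 q.2 : ℂ)
          * (∑ q' : Fin L × Fin K, (net.p q'.1 q'.2 : ℂ) * (net.lam j q'.1 q'.2 : ℂ))
        + (net.p q.1 q.2 : ℂ) * (net.lam j q.1 q.2 : ℂ) ^ 2) := by
  simp_rw [amplitude_mul_conj hκ, mul_left_comm _ (hw.kappaSq : ℂ), integral_const_mul]
  congr 1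
  simp_rw [Finset.mul_sum]
  have h (q : Fin L × Fin K) : (fun ω ↦ M.chan q n ω * conj (M.chan q n ω))
      ∈ M.alg Source.channels :=
    mul_mem_momentAlgebra (chan_mem_channels q n) (conj_mem_momentAlgebra (chan_mem_channels q n))
  rw [integral_sum_of_mem fun q' _ ↦ mul_mem_momentAlgebra (h q)
    (const_mul_mem_momentAlgebra _ (h q'))]
  simp_rw [mul_left_comm _ (net.p _ _ : ℂ), integral_const_mul, integral_normSq_chan_mul hxi]
  simp [mul_add, Finset.sum_add_distrib]

lemma integral_amplitude_mul_conj (hκ : 0 ≤ hw.kappaSq) (hxi : 0 ≤ hw.xi) (n : Fin N) :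
    ∫ ω, M.amplitude n ω * conj (M.amplitude n ω) ∂M.μ
      = (hw.kappaSq : ℂ)
          * (∑ q' : Fin L × Fin K, (net.p q'.1 q'.2 : ℂ) * (net.lam j q'.1 q'.2 : ℂ)) := by
  simp_rw [amplitude_mul_conj hκ, integral_const_mul]
  rw [integral_sum_of_mem fun q' _ ↦ const_mul_mem_momentAlgebra _ (mul_mem_momentAlgebra
    (chan_mem_channels q' n) (conj_mem_momentAlgebra (chan_mem_channels q' n)))]
  simp_rw [integral_const_mul, integral_normSq_chan hxi]

end Channels

section Moments

/-- Phases and channels are independent. -/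
lemma integral_phase_mul_channel {U C : M.Ω → ℂ} (hU : U ∈ M.alg Source.phases)
    (hC : C ∈ M.alg Source.channels) :
    ∫ ω, U ω * C ω ∂M.μ = (∫ ω, U ω ∂M.μ) * ∫ ω, C ω ∂M.μ :=
  integral_mul_of_disjoint M.iIndepFun_source Source.disjoint_phases_channels hU hC

/-- The correlation `exp (-δ / 2)` of the phase rotations at consecutive channel uses. -/
noncomputable def _root_.MIMO.Hardware.phaseCoherence (hw : Hardware) : ℝ :=
  Real.exp (-hw.delta / 2)

lemma integral_rotation_mul_conj' (hδ : 0 ≤ hw.delta) (n : Fin N) (b b' : Fin B) :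
    ∫ ω, M.rotation n (b + 1) ω * conj (M.rotation n (b' + 1) ω) ∂M.μ
      = (hw.phaseCoherence : ℂ) ^ (Nat.dist b b') := by
  rw [integral_rotation_mul_conj hδ, Nat.dist_add_add_right]
  rfl

lemma integral_rotation_mul_conj_pilot (hδ : 0 ≤ hw.delta) (n : Fin N) {t : ℕ} (ht : B < t)
    (b : Fin B) :
    ∫ ω, M.rotation n t ω * conj (M.rotation n (b + 1) ω) ∂M.μ
      = (hw.phaseCoherence : ℂ) ^ (t - (b + 1)) := by
  rw [integral_rotation_mul_conj hδ, Nat.dist_comm, Nat.dist_eq_sub_of_le (by omega)]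
  rfl

lemma rotation_mul_conj_mem_phases (n n' : Fin N) (t t' : ℕ) :
    (fun ω ↦ M.rotation n t ω * conj (M.rotation n' t' ω)) ∈ M.alg Source.phases :=
  mul_mem_momentAlgebra (rotation_mem_phases n t)
    (conj_mem_momentAlgebra (rotation_mem_phases n' t'))

/-- The second moments of the received pilot signal. -/
lemma integral_pilotSignal_mul_conj (hκ : 0 ≤ hw.kappaSq) (hxi : 0 ≤ hw.xi) (hδ : 0 ≤ hw.delta)
    (i i' : Fin N × Fin B) :
    ∫ ω, M.pilotSignal ω i * conj (M.pilotSignal ω i') ∂M.μ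
      = if i.1 = i'.1 then
          pilotCov net j hw.kappaSq (net.sigma ^ 2 * hw.xi) hw.phaseCoherence i.2 i'.2
        else 0 := by
  obtain ⟨n, b⟩ := i
  obtain ⟨n', b'⟩ := i'
  have h := integral_mul_pilotSignal_mul_conj (M := M) hκ hxi (const_mem_momentAlgebra 1)
    (n, b) (n', b')
  simp only [one_mul, integral_const, probReal_univ, one_smul] at h
  rw [h, integral_amplitude_mul_conj hκ hxi]
  have e (ω : M.Ω) : (M.rotation n (b + 1) ω * M.mixture n b ω)
        * conj (M.rotation n' (b' + 1) ω * M.mixture n' b' ω)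
      = (M.rotation n (b + 1) ω * conj (M.rotation n' (b' + 1) ω))
        * (M.mixture n b ω * conj (M.mixture n' b' ω)) := by
    simp only [map_mul]; ring
  simp_rw [e]
  rw [integral_phase_mul_channel (rotation_mul_conj_mem_phases _ _ _ _)
    (mul_mem_momentAlgebra (mixture_mem_channels _ _)
      (conj_mem_momentAlgebra (mixture_mem_channels _ _))), integral_mixture_mul_conj hxi]
  by_cases hn : n = n'
  · subst hn
    rw [integral_rotation_mul_conj' hδ]
    simp [pilotCov]
  · simp [hn]

/-- The covariance of the effective channels with the received pilot signal. -/
lemma integral_effChannel_mul_conj_pilotSignal (hκ : 0 ≤ hw.kappaSq) (hxi : 0 ≤ hw.xi)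
    (hδ : 0 ≤ hw.delta) {t : ℕ} (ht : B < t) (q : Fin L × Fin K) (n : Fin N) (i : Fin N × Fin B) :
    ∫ ω, (M.rotation n t ω * M.chan q n ω) * conj (M.pilotSignal ω i) ∂M.μ
      = if n = i.1 then crossCov net j hw.phaseCoherence t q i.2 else 0 := by
  obtain ⟨n', b⟩ := i
  rw [integral_mul_conj_pilotSignal hκ (mul_mem_momentAlgebra (rotation_mem_multiplicative _ _)
    (mem_multiplicative_of_channelSet (chan_mem q n)))]
  have e (ω : M.Ω) : M.rotation n t ω * M.chan q n ω
        * conj (M.rotation n' (b + 1) ω * M.mixture n' b ω)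
      = (M.rotation n t ω * conj (M.rotation n' (b + 1) ω))
        * (M.chan q n ω * conj (M.mixture n' b ω)) := by
    simp only [map_mul]; ring
  simp_rw [e]
  rw [integral_phase_mul_channel (rotation_mul_conj_mem_phases _ _ _ _)
    (mul_mem_momentAlgebra (chan_mem_channels _ _)
      (conj_mem_momentAlgebra (mixture_mem_channels _ _))), integral_chan_mul_conj_mixture hxi]
  by_cases hn : n = n'
  · subst hn
    rw [integral_rotation_mul_conj_pilot hδ n ht]
    simp [crossCov, mul_comm]
  · simp [hn]

/-- The second moments of the pilot signal at one antenna, weighted with the squared modulus of a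
channel coefficient. -/
lemma integral_normSq_chan_mul_pilotSignal (hκ : 0 ≤ hw.kappaSq) (hxi : 0 ≤ hw.xi)
    (hδ : 0 ≤ hw.delta) (q : Fin L × Fin K) (n : Fin N) (b b' : Fin B) :
    ∫ ω, (M.chan q n ω * conj (M.chan q n ω))
        * (M.pilotSignal ω (n, b) * conj (M.pilotSignal ω (n, b'))) ∂M.μ
      = weightedCov net j hw.kappaSq (net.sigma ^ 2 * hw.xi) hw.phaseCoherence q b b' := by
  rw [integral_mul_pilotSignal_mul_conj hκ hxi (mem_multiplicative_of_channelSet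
    (mul_mem_momentAlgebra (chan_mem q n) (conj_mem_momentAlgebra (chan_mem q n)))),
    integral_normSq_chan hxi, integral_normSq_chan_mul_amplitude hκ hxi]
  have e (ω : M.Ω) : (M.chan q n ω * conj (M.chan q n ω)) *
        ((M.rotation n (b + 1) ω * M.mixture n b ω)
        * conj (M.rotation n (b' + 1) ω * M.mixture n b' ω))
      = (M.rotation n (b + 1) ω * conj (M.rotation n (b' + 1) ω))
        * ((M.chan q n ω * conj (M.chan q n ω)) * (M.mixture n b ω * conj (M.mixture n b' ω))) := by
    simp only [map_mul]; ring
  simp_rw [e]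
  rw [integral_phase_mul_channel (rotation_mul_conj_mem_phases _ _ _ _)
    (mul_mem_momentAlgebra (mul_mem_momentAlgebra (chan_mem_channels _ _)
      (conj_mem_momentAlgebra (chan_mem_channels _ _))) (mul_mem_momentAlgebra
      (mixture_mem_channels _ _) (conj_mem_momentAlgebra (mixture_mem_channels _ _)))),
    integral_normSq_chan_mul_mixture hxi, integral_rotation_mul_conj' hδ]
  simp only [weightedCov, pilotCov, Prod.mk.injEq, true_and]
  split_ifs
  · push_cast; ring
  · ring

/-- The correlation of the phase drifts at two different antennas: the drifts coincide with a common
oscillator, and are independent with separate oscillators. -/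
lemma integral_drift_mul_conj_drift (hδ : 0 ≤ hw.delta) {t : ℕ} (ht : B < t)
    {n n' : Fin N} (hn : n ≠ n') (b b' : Fin B) :
    ∫ ω, (M.rotation n t ω * conj (M.rotation n (b + 1) ω))
        * conj (M.rotation n' t ω * conj (M.rotation n' (b' + 1) ω)) ∂M.μ
      = driftCorr lo hw.phaseCoherence t b b' := by
  cases lo with
  | common =>
    have hr (t : ℕ) (ω : M.Ω) : M.rotation n' t ω = M.rotation n t ω := rfl
    simp only [driftCorr, hr]
    rw [Nat.dist_comm, ← integral_rotation_mul_conj' (M := M) hδ n b' b]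
    congr 1
    ext ω
    have h := rotation_mul_conj_self (M := M) n t ω
    rw [map_mul, Complex.conj_conj]
    linear_combination (M.rotation n (b' + 1) ω * conj (M.rotation n (b + 1) ω)) * h
  | separate =>
    have hm (n : Fin N) (b : Fin B) :=
      mul_mem_momentAlgebra (rotation_mem (M := M) n t)
        (conj_mem_momentAlgebra (rotation_mem (M := M) n (b + 1)))
    rw [integral_mul_of_disjoint M.iIndepFun_source (Source.disjoint_phaseSet hn) (hm n b)
      (conj_mem_momentAlgebra (hm n' b')), integral_conj, integral_rotation_mul_conj_pilot hδ n ht,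
      integral_rotation_mul_conj_pilot hδ n' ht]
    simp [driftCorr]

/-- The correlation between two different antennas `n` and `n'` of the effective channels of user
`q` multiplied with the conjugate pilot signals. The channels to the two antennas are independent,
the phase drifts need not be. -/
lemma integral_effChannel_mul_pilotSignal_of_ne (hκ : 0 ≤ hw.kappaSq) (hxi : 0 ≤ hw.xi)
    (hδ : 0 ≤ hw.delta) {t : ℕ} (ht : B < t) (q : Fin L × Fin K) {n n' : Fin N}
    (hn : n ≠ n') (b b' : Fin B) :
    ∫ ω, ((M.rotation n' t ω * M.chan q n' ω) * conj (M.rotation n t ω * M.chan q n ω))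
        * (M.pilotSignal ω (n, b) * conj (M.pilotSignal ω (n', b'))) ∂M.μ
      = (net.lam j q.1 q.2 : ℂ) ^ 2
          * (driftCorr lo hw.phaseCoherence t b b' * pilotGram net q b b') := by
  have hE (n : Fin N) := mul_mem_momentAlgebra (rotation_mem_multiplicative (M := M) n t)
    (mem_multiplicative_of_channelSet (chan_mem (M := M) q n))
  rw [integral_mul_pilotSignal_mul_conj hκ hxi
    (mul_mem_momentAlgebra (hE n') (conj_mem_momentAlgebra (hE n))),
    if_neg (fun h ↦ hn (congrArg Prod.fst h)), add_zero]
  have e (ω : M.Ω) : ((M.rotation n' t ω * M.chan q n' ω) * conj (M.rotation n t ω * M.chan q n ω))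
        * ((M.rotation n (b + 1) ω * M.mixture n b ω)
          * conj (M.rotation n' (b' + 1) ω * M.mixture n' b' ω))
      = ((M.rotation n' t ω * conj (M.rotation n' (b' + 1) ω))
          * conj (M.rotation n t ω * conj (M.rotation n (b + 1) ω)))
        * ((M.chan q n' ω * conj (M.mixture n' b' ω))
          * (M.mixture n b ω * conj (M.chan q n ω))) := by
    simp only [map_mul, Complex.conj_conj]; ring
  simp_rw [e]
  rw [integral_phase_mul_channel (mul_mem_momentAlgebra (rotation_mul_conj_mem_phases _ _ _ _)
      (conj_mem_momentAlgebra (rotation_mul_conj_mem_phases _ _ _ _)))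
    (mul_mem_momentAlgebra (mul_mem_momentAlgebra (chan_mem_channels _ _)
      (conj_mem_momentAlgebra (mixture_mem_channels _ _))) (mul_mem_momentAlgebra
      (mixture_mem_channels _ _) (conj_mem_momentAlgebra (chan_mem_channels _ _)))),
    integral_mul_of_disjoint M.iIndepFun_source (Source.disjoint_channelSet hn.symm)
      (mul_mem_momentAlgebra (chan_mem _ _) (conj_mem_momentAlgebra (mixture_mem _ _)))
      (mul_mem_momentAlgebra (mixture_mem _ _) (conj_mem_momentAlgebra (chan_mem _ _))),
    integral_chan_mul_conj_mixture hxi, integral_mixture_mul_conj_chan hxi,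
    integral_drift_mul_conj_drift hδ ht hn.symm, if_pos rfl]
  have hsymm : driftCorr lo hw.phaseCoherence t b' b = driftCorr lo hw.phaseCoherence t b b' := by
    cases lo
    · simp [driftCorr, Nat.dist_comm]
    · simp [driftCorr, mul_comm]
  rw [hsymm, pilotGram]
  ring

end Moments

end UplinkModel

/-! ### Orthogonality and the normal equations of the LMMSE filter -/

/-- The Hermitian form `∑ b, ∑ b', w b * A b b' * conj (w b')`. -/
noncomputable def quadForm {B : ℕ} (w : Fin B → ℂ) (A : Matrix (Fin B) (Fin B) ℂ) : ℂ :=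
  ∑ b, ∑ b', w b * conj (w b') * A b b'

namespace UplinkModel

variable {L K B : ℕ} {net : Network L K B} {hw : Hardware} {lo : LOType} {j : Fin L} {N : ℕ}
  {M : UplinkModel.{u} net hw lo j N}

section Estimation

lemma normSq_eq_re_mul_conj (z : ℂ) : ‖z‖ ^ 2 = (z * conj z).re := by
  rw [Complex.mul_conj, Complex.normSq_eq_norm_sq, Complex.ofReal_re]

lemma integrable_normSq_of_mem {S : Set (Source L K N)} {f : M.Ω → ℂ} (hf : f ∈ M.alg S) :
    Integrable (fun ω ↦ ‖f ω‖ ^ 2) M.μ := by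
  simp_rw [normSq_eq_re_mul_conj]
  exact (integrable_of_mem_momentAlgebra
    (mul_mem_momentAlgebra hf (conj_mem_momentAlgebra hf))).re

lemma integral_normSq_eq (f : M.Ω → ℂ) :
    ((∫ ω, ‖f ω‖ ^ 2 ∂M.μ : ℝ) : ℂ) = ∫ ω, f ω * conj (f ω) ∂M.μ := by
  rw [← integral_complex_ofReal]
  congr 1
  ext ω
  rw [Complex.mul_conj, Complex.normSq_eq_norm_sq]

lemma integral_normSq_eq_re (f : M.Ω → ℂ) :
    ∫ ω, ‖f ω‖ ^ 2 ∂M.μ = (∫ ω, f ω * conj (f ω) ∂M.μ).re := by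
  rw [← integral_normSq_eq, Complex.ofReal_re]

/-- If no multiple of `f` brings `e` closer to zero in mean square, then `e` is orthogonal to
`f`. -/
lemma integral_mul_conj_eq_zero_of_forall_le {S : Set (Source L K N)} {e f : M.Ω → ℂ}
    (he : e ∈ M.alg S) (hf : f ∈ M.alg S)
    (h : ∀ c : ℂ, ∫ ω, ‖e ω‖ ^ 2 ∂M.μ ≤ ∫ ω, ‖e ω - c * f ω‖ ^ 2 ∂M.μ) :
    ∫ ω, e ω * conj (f ω) ∂M.μ = 0 := by
  set z := ∫ ω, e ω * conj (f ω) ∂M.μ with hz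
  set P := ∫ ω, ‖f ω‖ ^ 2 ∂M.μ with hP
  have hP0 : 0 ≤ P := integral_nonneg fun ω ↦ sq_nonneg _
  have hef := mul_mem_momentAlgebra he (conj_mem_momentAlgebra hf)
  have hexp (c : ℂ) : ∫ ω, ‖e ω - c * f ω‖ ^ 2 ∂M.μ
      = ∫ ω, ‖e ω‖ ^ 2 ∂M.μ - 2 * (conj c * z).re + ‖c‖ ^ 2 * P := by
    have e1 (ω : M.Ω) : ‖e ω - c * f ω‖ ^ 2
        = (‖e ω‖ ^ 2 - 2 * (conj c * (e ω * conj (f ω))).re) + ‖c‖ ^ 2 * ‖f ω‖ ^ 2 := by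
      simp only [← Complex.normSq_eq_norm_sq, Complex.normSq_sub, map_mul]
      rw [show e ω * (conj c * conj (f ω)) = conj c * (e ω * conj (f ω)) by ring]
      ring
    have hi := integrable_of_mem_momentAlgebra (const_mul_mem_momentAlgebra (conj c) hef)
    have hi' : Integrable (fun ω ↦ 2 * (conj c * (e ω * conj (f ω))).re) M.μ := hi.re.const_mul 2
    have hi'' : Integrable (fun ω ↦ ‖e ω‖ ^ 2 - 2 * (conj c * (e ω * conj (f ω))).re) M.μ :=
      (integrable_normSq_of_mem he).sub hi'
    have hre : ∫ ω, (conj c * (e ω * conj (f ω))).re ∂M.μ = (conj c * z).re := by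
      rw [hz, ← integral_const_mul]
      exact integral_re hi
    simp_rw [e1]
    rw [integral_add hi'' ((integrable_normSq_of_mem hf).const_mul _),
      integral_sub (integrable_normSq_of_mem he) hi', integral_const_mul, integral_const_mul, hre]
  -- The step length `1 / (P + 1)` along `z` decreases the error strictly unless `z = 0`.
  have h1 := h (((1 / (P + 1) : ℝ) : ℂ) * z)
  rw [hexp] at h1
  have h2 : (conj (((1 / (P + 1) : ℝ) : ℂ) * z) * z).re = 1 / (P + 1) * ‖z‖ ^ 2 := by
    rw [map_mul, Complex.conj_ofReal, mul_assoc, Complex.conj_mul', Complex.re_ofReal_mul]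
    norm_cast
  rw [h2, norm_mul, Complex.norm_real, Real.norm_of_nonneg (by positivity), mul_pow] at h1
  have h3 : 1 / (P + 1) * P ≤ 1 := by
    rw [one_div, inv_mul_le_iff₀ (by positivity)]
    linarith
  have h4 : 0 < 1 / (P + 1) := by positivity
  have h5 : (1 / (P + 1)) ^ 2 * ‖z‖ ^ 2 * P ≤ 1 / (P + 1) * ‖z‖ ^ 2 := by
    have := mul_le_mul_of_nonneg_left h3 (by positivity : 0 ≤ 1 / (P + 1) * ‖z‖ ^ 2)
    nlinarith
  have h6 : 1 / (P + 1) * ‖z‖ ^ 2 ≤ 0 := by linarith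
  have h7 : ‖z‖ ^ 2 ≤ 0 := by
    by_contra hc
    exact absurd h6 (not_le.2 (mul_pos h4 (not_le.1 hc)))
  exact norm_eq_zero.1 (pow_eq_zero_iff two_ne_zero |>.1 (le_antisymm h7 (sq_nonneg _)))

/-- The linear combination of the pilot signals at antenna `n` with coefficients `w`. -/
noncomputable def combine (M : UplinkModel.{u} net hw lo j N) (w : Fin B → ℂ) (n : Fin N)
    (ω : M.Ω) : ℂ :=
  ∑ b, w b * M.pilotSignal ω (n, b)

lemma effChannel_mem_multiplicative (q : Fin L × Fin K) (n : Fin N) (t : ℕ) :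
    (fun ω ↦ M.rotation n t ω * M.chan q n ω) ∈ M.alg Source.multiplicative :=
  mul_mem_momentAlgebra (rotation_mem_multiplicative n t)
    (mem_multiplicative_of_channelSet (chan_mem q n))

lemma effChannel_mem (q : Fin L × Fin K) (n : Fin N) (t : ℕ) :
    (fun ω ↦ M.rotation n t ω * M.chan q n ω) ∈ M.alg Set.univ :=
  momentAlgebra_mono (Set.subset_univ _) (effChannel_mem_multiplicative q n t)

lemma mulVec_pilotSignal_mem (hκ : 0 ≤ hw.kappaSq) (A : Matrix (Fin N) (Fin N × Fin B) ℂ)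
    (n : Fin N) : (fun ω ↦ A.mulVec (M.pilotSignal ω) n) ∈ M.alg Set.univ := by
  simp only [Matrix.mulVec, dotProduct]
  exact sum_mem_momentAlgebra fun i _ ↦ const_mul_mem_momentAlgebra _ (pilotSignal_mem_univ hκ i)

lemma combine_mem (hκ : 0 ≤ hw.kappaSq) (w : Fin B → ℂ) (n : Fin N) {t : ℕ} (ht : B < t) :
    M.combine w n ∈ M.alg (Source.withoutDistortionAt t) :=
  sum_mem_momentAlgebra fun b _ ↦ const_mul_mem_momentAlgebra _ (pilotSignal_mem hκ (n, b) ht)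

lemma combine_mem_univ (hκ : 0 ≤ hw.kappaSq) (w : Fin B → ℂ) (n : Fin N) :
    M.combine w n ∈ M.alg Set.univ :=
  momentAlgebra_mono (Set.subset_univ _) (combine_mem hκ w n B.lt_succ_self)

/-- The mean squared error splits over the antennas, and row `n` of the estimator enters only into
the error at antenna `n`. -/
lemma mse_eq_sum (hκ : 0 ≤ hw.kappaSq) (q : Fin L × Fin K) (t : ℕ)
    (A : Matrix (Fin N) (Fin N × Fin B) ℂ) :
    M.mse q.1 q.2 t A
      = ∑ n, ∫ ω, ‖M.rotation n t ω * M.chan q n ω - A.mulVec (M.pilotSignal ω) n‖ ^ 2 ∂M.μ :=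
  integral_finsetSum _ fun n _ ↦ integrable_normSq_of_mem
    (sub_mem_momentAlgebra (effChannel_mem q n t) (mulVec_pilotSignal_mem hκ A n))

/-- The orthogonality principle: the estimation error of an LMMSE estimate is uncorrelated with the
received signal. -/
lemma orthogonality_of_forall_mse_le (hκ : 0 ≤ hw.kappaSq) {q : Fin L × Fin K} {t : ℕ}
    {A : Matrix (Fin N) (Fin N × Fin B) ℂ} (hA : ∀ A', M.mse q.1 q.2 t A ≤ M.mse q.1 q.2 t A')
    (n : Fin N) (i : Fin N × Fin B) :
    ∫ ω, (M.rotation n t ω * M.chan q n ω - A.mulVec (M.pilotSignal ω) n)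
      * conj (M.pilotSignal ω i) ∂M.μ = 0 := by
  refine integral_mul_conj_eq_zero_of_forall_le
    (sub_mem_momentAlgebra (effChannel_mem q n t) (mulVec_pilotSignal_mem hκ A n))
    (pilotSignal_mem_univ hκ i) fun c ↦ ?_
  -- Perturb the coefficient with which the signal `i` enters the estimate at antenna `n`.
  have h := hA (A.updateRow n (A n + Pi.single i c))
  rw [mse_eq_sum hκ, mse_eq_sum hκ, ← Finset.add_sum_erase _ _ (Finset.mem_univ n),
    ← Finset.add_sum_erase _ _ (Finset.mem_univ n)] at h
  have h1 : ∀ m ∈ Finset.univ.erase n,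
      ∫ ω, ‖M.rotation m t ω * M.chan q m ω
          - (A.updateRow n (A n + Pi.single i c)).mulVec (M.pilotSignal ω) m‖ ^ 2 ∂M.μ
        = ∫ ω, ‖M.rotation m t ω * M.chan q m ω - A.mulVec (M.pilotSignal ω) m‖ ^ 2 ∂M.μ := by
    intro m hm
    have hm' : m ≠ n := (Finset.mem_erase.1 hm).1
    simp [Matrix.mulVec, Matrix.updateRow_ne hm']
  rw [Finset.sum_congr rfl h1] at h
  have h2 := le_of_add_le_add_right h
  refine h2.trans_eq ?_
  congr 1
  ext ω
  simp only [Matrix.mulVec, Matrix.updateRow_self, add_dotProduct, single_dotProduct]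
  rw [sub_sub]

/-- The normal equations of an LMMSE estimator decouple over the antennas: row `n` solves the
equations of a single antenna at the antenna `n` itself, and the homogeneous equations at the other
ones. -/
lemma normal_equations_of_forall_mse_le (hκ : 0 ≤ hw.kappaSq) (hxi : 0 ≤ hw.xi)
    (hδ : 0 ≤ hw.delta) {q : Fin L × Fin K} {t : ℕ} (ht : B < t)
    {A : Matrix (Fin N) (Fin N × Fin B) ℂ} (hA : ∀ A', M.mse q.1 q.2 t A ≤ M.mse q.1 q.2 t A')
    (n n' : Fin N) (b' : Fin B) :
    ∑ b, A n (n', b) * pilotCov net j hw.kappaSq (net.sigma ^ 2 * hw.xi) hw.phaseCoherence b b'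
      = if n = n' then crossCov net j hw.phaseCoherence t q b' else 0 := by
  have h := orthogonality_of_forall_mse_le hκ hA n (n', b')
  simp_rw [sub_mul] at h
  have hc := conj_mem_momentAlgebra (pilotSignal_mem_univ (M := M) hκ (n', b'))
  rw [integral_sub
    (integrable_of_mem_momentAlgebra (mul_mem_momentAlgebra (effChannel_mem q n t) hc))
    (integrable_of_mem_momentAlgebra (mul_mem_momentAlgebra (mulVec_pilotSignal_mem hκ A n) hc)),
    integral_effChannel_mul_conj_pilotSignal hκ hxi hδ ht, sub_eq_zero] at h
  rw [h]
  simp only [Matrix.mulVec, dotProduct, Finset.sum_mul]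
  rw [integral_sum_of_mem (S := Set.univ) fun i _ ↦ mul_mem_momentAlgebra
    (const_mul_mem_momentAlgebra _ (pilotSignal_mem_univ hκ i)) hc]
  simp_rw [mul_assoc, integral_const_mul, integral_pilotSignal_mul_conj hκ hxi hδ,
    Fintype.sum_prod_type]
  simp [mul_ite]

/-- A combination of pilot signals that is uncorrelated with all of them vanishes. -/
lemma sum_pilotSignal_ae_eq_zero (hκ : 0 ≤ hw.kappaSq) (c : Fin N × Fin B → ℂ)
    (h : ∀ i, ∫ ω, (∑ i', c i' * M.pilotSignal ω i') * conj (M.pilotSignal ω i) ∂M.μ = 0) :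
    (fun ω ↦ ∑ i', c i' * M.pilotSignal ω i') =ᵐ[M.μ] 0 := by
  have hm : (fun ω ↦ ∑ i', c i' * M.pilotSignal ω i') ∈ M.alg Set.univ :=
    sum_mem_momentAlgebra fun i _ ↦ const_mul_mem_momentAlgebra _ (pilotSignal_mem_univ hκ i)
  have h1 : ∫ ω, ‖∑ i', c i' * M.pilotSignal ω i'‖ ^ 2 ∂M.μ = 0 := by
    rw [integral_normSq_eq_re]
    have e (ω : M.Ω) : (∑ i', c i' * M.pilotSignal ω i') * conj (∑ i', c i' * M.pilotSignal ω i')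
        = ∑ i, conj (c i) * ((∑ i', c i' * M.pilotSignal ω i') * conj (M.pilotSignal ω i)) := by
      rw [map_sum, Finset.mul_sum]
      refine Finset.sum_congr rfl fun i _ ↦ ?_
      rw [map_mul]; ring
    simp_rw [e]
    rw [integral_sum_of_mem (S := Set.univ) fun i _ ↦ const_mul_mem_momentAlgebra _
      (mul_mem_momentAlgebra hm (conj_mem_momentAlgebra (pilotSignal_mem_univ hκ i)))]
    simp_rw [integral_const_mul, h]
    simp
  rw [integral_eq_zero_iff_of_nonneg (fun ω ↦ sq_nonneg _) (integrable_normSq_of_mem hm)] at h1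
  filter_upwards [h1] with ω hω
  simpa using hω

variable {k : Fin K} {t : ℕ} {v : M.Ω → Fin N → ℂ}

/-- Every solution `w` of the normal equations of a single antenna gives the MRC filter: different
solutions, and different minimisers of the mean squared error, give filters that agree almost
surely. -/
lemma IsMRC.ae_eq_combine (hκ : 0 ≤ hw.kappaSq) (hxi : 0 ≤ hw.xi) (hδ : 0 ≤ hw.delta)
    (ht : B < t) (hv : M.IsMRC k t v) {w : Fin B → ℂ}
    (hw' : Matrix.vecMul w
        (pilotCov net j hw.kappaSq (net.sigma ^ 2 * hw.xi) hw.phaseCoherence)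
      = crossCov net j hw.phaseCoherence t (j, k)) :
    ∀ᵐ ω ∂M.μ, ∀ n, v ω n = M.combine w n ω := by
  obtain ⟨A, hA, hvA⟩ := hv
  rw [ae_all_iff]
  intro n
  have hN := normal_equations_of_forall_mse_le (q := (j, k)) hκ hxi hδ ht hA
  have h := sum_pilotSignal_ae_eq_zero (M := M) hκ
    (fun i ↦ A n i - if n = i.1 then w i.2 else 0) (fun i ↦ by
      obtain ⟨n', b'⟩ := i
      have hc := conj_mem_momentAlgebra (pilotSignal_mem_univ (M := M) hκ (n', b'))
      simp_rw [Finset.sum_mul]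
      rw [integral_sum_of_mem (S := Set.univ) fun i _ ↦ mul_mem_momentAlgebra
        (const_mul_mem_momentAlgebra _ (pilotSignal_mem_univ hκ i)) hc]
      simp_rw [mul_assoc, integral_const_mul, integral_pilotSignal_mul_conj hκ hxi hδ,
        Fintype.sum_prod_type]
      have h1 := congrFun hw' b'
      simp only [Matrix.vecMul, dotProduct] at h1
      simp only [sub_mul, mul_ite, mul_zero, ite_mul, zero_mul]
      rw [Finset.sum_comm]
      simp only [Finset.sum_ite_eq', Finset.mem_univ, if_true, Finset.sum_sub_distrib]
      rw [sub_eq_zero, hN n n' b']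
      by_cases hn : n = n'
      · subst hn
        simpa using h1.symm
      · simp [hn])
  filter_upwards [h] with ω hω
  rw [hvA, combine]
  simp only [Matrix.mulVec, dotProduct]
  simp only [sub_mul, Finset.sum_sub_distrib, ite_mul, zero_mul, Pi.zero_apply, sub_eq_zero] at hω
  rw [hω, Fintype.sum_prod_type, Finset.sum_comm]
  simp

/-- The row of an LMMSE estimator at one antenna solves the normal equations of that antenna. -/
lemma IsMRC.exists_weights (hκ : 0 ≤ hw.kappaSq) (hxi : 0 ≤ hw.xi) (hδ : 0 ≤ hw.delta)
    (ht : B < t) (hN : 0 < N) (hv : M.IsMRC k t v) :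
    ∃ w : Fin B → ℂ, Matrix.vecMul w
        (pilotCov net j hw.kappaSq (net.sigma ^ 2 * hw.xi) hw.phaseCoherence)
      = crossCov net j hw.phaseCoherence t (j, k) := by
  obtain ⟨A, hA, -⟩ := hv
  refine ⟨fun b ↦ A ⟨0, hN⟩ (⟨0, hN⟩, b), funext fun b' ↦ ?_⟩
  have h := normal_equations_of_forall_mse_le (q := (j, k)) hκ hxi hδ ht hA ⟨0, hN⟩ ⟨0, hN⟩ b'
  rw [if_pos rfl] at h
  exact h

end Estimation

end UplinkModel

/-! ### The SINR as a function of the filter coefficients -/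

/-- The contribution of two different antennas to the received power of user `q`: the Hermitian
form of the product of the correlations of the phase drifts and of the pilot symbols. -/
noncomputable def crossAntennaForm {L K B : ℕ} (net : Network L K B) (j : Fin L) (lo : LOType)
    (g : ℝ) (t : ℕ) (w : Fin B → ℂ) (q : Fin L × Fin K) : ℂ :=
  (net.lam j q.1 q.2 : ℂ) ^ 2 * quadForm w fun b b' ↦ driftCorr lo g t b b' * pilotGram net q b b'

/-- The denominator of the SINR of user `k` in cell `j` with `N` antennas, for the filter with
coefficients `w` at each antenna. All Hermitian forms are given by Hermitian matrices, so that
taking real parts loses nothing. -/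
noncomputable def sinrDenom {L K B : ℕ} (net : Network L K B) (j : Fin L) (k : Fin K) (lo : LOType)
    (t : ℕ) (κ ν g : ℝ) (N : ℕ) (w : Fin B → ℂ) : ℝ :=
  (∑ q : Fin L × Fin K, net.p q.1 q.2 * (N * (quadForm w (weightedCov net j κ ν g q)).re
      + N * (N - 1) * (crossAntennaForm net j lo g t w q).re))
    - net.p j k * ‖(N : ℂ) * (star w ⬝ᵥ crossCov net j g t (j, k))‖ ^ 2
    + N * (κ * ∑ q : Fin L × Fin K, net.p q.1 q.2 * (quadForm w (weightedCov net j κ ν g q)).re)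
    + ν * (N * (star w ⬝ᵥ crossCov net j g t (j, k)).re)

lemma quadForm_eq_of_vecMul_eq {B : ℕ} {w r : Fin B → ℂ} {A : Matrix (Fin B) (Fin B) ℂ}
    (h : Matrix.vecMul w A = r) : quadForm w A = star w ⬝ᵥ r := by
  rw [← h, quadForm, Finset.sum_comm]
  simp only [dotProduct, Matrix.vecMul, Finset.mul_sum, Pi.star_apply, RCLike.star_def]
  refine Finset.sum_congr rfl fun b _ ↦ Finset.sum_congr rfl fun b' _ ↦ ?_
  ring

lemma sum_sum_ite_eq_card {N : ℕ} (a b : ℂ) :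
    ∑ n : Fin N, ∑ n' : Fin N, (if n = n' then a else b) = N * a + N * (N - 1) * b := by
  have h (n n' : Fin N) : (if n = n' then a else b) = (if n = n' then a - b else 0) + b := by
    split_ifs <;> ring
  simp_rw [h, Finset.sum_add_distrib, Finset.sum_ite_eq]
  simp
  ring

namespace UplinkModel

variable {L K B : ℕ} {net : Network L K B} {hw : Hardware} {lo : LOType} {j : Fin L} {N : ℕ}
  {M : UplinkModel.{u} net hw lo j N}

lemma integral_mul_combine_mul_conj (hκ : 0 ≤ hw.kappaSq) {Y : M.Ω → ℂ} (hY : Y ∈ M.alg Set.univ)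
    (w : Fin B → ℂ) (n n' : Fin N) :
    ∫ ω, Y ω * (M.combine w n ω * conj (M.combine w n' ω)) ∂M.μ
      = quadForm w fun b b' ↦
          ∫ ω, Y ω * (M.pilotSignal ω (n, b) * conj (M.pilotSignal ω (n', b'))) ∂M.μ := by
  have e (ω : M.Ω) : Y ω * (M.combine w n ω * conj (M.combine w n' ω))
      = ∑ b, ∑ b', (w b * conj (w b'))
          * (Y ω * (M.pilotSignal ω (n, b) * conj (M.pilotSignal ω (n', b')))) := by
    simp only [combine, map_sum, map_mul]
    rw [Finset.sum_mul_sum]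
    simp only [Finset.mul_sum]
    refine Finset.sum_congr rfl fun b _ ↦ Finset.sum_congr rfl fun b' _ ↦ ?_
    ring
  have hm (b b' : Fin B) : (fun ω ↦ (w b * conj (w b'))
      * (Y ω * (M.pilotSignal ω (n, b) * conj (M.pilotSignal ω (n', b'))))) ∈ M.alg Set.univ :=
    const_mul_mem_momentAlgebra _ (mul_mem_momentAlgebra hY (mul_mem_momentAlgebra
      (pilotSignal_mem_univ hκ _) (conj_mem_momentAlgebra (pilotSignal_mem_univ hκ _))))
  simp_rw [e]
  rw [integral_sum_of_mem fun b _ ↦ sum_mem_momentAlgebra fun b' _ ↦ hm b b']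
  refine Finset.sum_congr rfl fun b _ ↦ ?_
  rw [integral_sum_of_mem fun b' _ ↦ hm b b']
  simp_rw [integral_const_mul]

section SINR

lemma integral_combine_dotProduct_effChannel (hκ : 0 ≤ hw.kappaSq) (hxi : 0 ≤ hw.xi)
    (hδ : 0 ≤ hw.delta) {t : ℕ} (ht : B < t) (w : Fin B → ℂ) (q : Fin L × Fin K) :
    ∫ ω, (∑ n, conj (M.combine w n ω) * (M.rotation n t ω * M.chan q n ω)) ∂M.μ
      = N * (star w ⬝ᵥ crossCov net j hw.phaseCoherence t q) := by
  rw [integral_sum_of_mem (S := Set.univ) fun n _ ↦ mul_mem_momentAlgebra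
    (conj_mem_momentAlgebra (combine_mem_univ hκ w n)) (effChannel_mem q n t)]
  have h (n : Fin N) : ∫ ω, conj (M.combine w n ω) * (M.rotation n t ω * M.chan q n ω) ∂M.μ
      = star w ⬝ᵥ crossCov net j hw.phaseCoherence t q := by
    have e (ω : M.Ω) : conj (M.combine w n ω) * (M.rotation n t ω * M.chan q n ω)
        = ∑ b, conj (w b)
          * ((M.rotation n t ω * M.chan q n ω) * conj (M.pilotSignal ω (n, b))) := by
      simp only [combine, map_sum, map_mul, Finset.sum_mul]
      refine Finset.sum_congr rfl fun b _ ↦ ?_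
      ring
    simp_rw [e]
    rw [integral_sum_of_mem (S := Set.univ) fun b _ ↦ const_mul_mem_momentAlgebra _
      (mul_mem_momentAlgebra (effChannel_mem q n t)
        (conj_mem_momentAlgebra (pilotSignal_mem_univ hκ _)))]
    simp_rw [integral_const_mul, integral_effChannel_mul_conj_pilotSignal hκ hxi hδ ht]
    simp [dotProduct]
  simp_rw [h]
  simp

/-- Each of the `N` antennas contributes `quadForm w weightedCov`, and each of the `N * (N - 1)`
ordered pairs of different antennas contributes `crossAntennaForm`. -/
lemma integral_normSq_combine_dotProduct_effChannel (hκ : 0 ≤ hw.kappaSq) (hxi : 0 ≤ hw.xi)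
    (hδ : 0 ≤ hw.delta) {t : ℕ} (ht : B < t) (w : Fin B → ℂ) (q : Fin L × Fin K) :
    ((∫ ω, ‖∑ n, conj (M.combine w n ω) * (M.rotation n t ω * M.chan q n ω)‖ ^ 2 ∂M.μ : ℝ) : ℂ)
      = N * quadForm w
            (weightedCov net j hw.kappaSq (net.sigma ^ 2 * hw.xi) hw.phaseCoherence q)
        + N * (N - 1) * crossAntennaForm net j lo hw.phaseCoherence t w q := by
  rw [integral_normSq_eq]
  have e (ω : M.Ω) : (∑ n, conj (M.combine w n ω) * (M.rotation n t ω * M.chan q n ω))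
        * conj (∑ n, conj (M.combine w n ω) * (M.rotation n t ω * M.chan q n ω))
      = ∑ n, ∑ n', ((M.rotation n' t ω * M.chan q n' ω) * conj (M.rotation n t ω * M.chan q n ω))
          * (M.combine w n ω * conj (M.combine w n' ω)) := by
    simp only [map_sum, map_mul, Complex.conj_conj]
    rw [Finset.sum_mul_sum, Finset.sum_comm]
    refine Finset.sum_congr rfl fun n _ ↦ Finset.sum_congr rfl fun n' _ ↦ ?_
    ring
  have hE (n n' : Fin N) : (fun ω ↦ (M.rotation n' t ω * M.chan q n' ω)
      * conj (M.rotation n t ω * M.chan q n ω)) ∈ M.alg Set.univ :=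
    mul_mem_momentAlgebra (effChannel_mem q n' t) (conj_mem_momentAlgebra (effChannel_mem q n t))
  have hm (n n' : Fin N) := mul_mem_momentAlgebra (hE n n') (mul_mem_momentAlgebra
    (combine_mem_univ hκ w n) (conj_mem_momentAlgebra (combine_mem_univ hκ w n')))
  simp_rw [e]
  rw [integral_sum_of_mem fun n _ ↦ sum_mem_momentAlgebra fun n' _ ↦ hm n n',
    ← sum_sum_ite_eq_card]
  refine Finset.sum_congr rfl fun n _ ↦ ?_
  rw [integral_sum_of_mem fun n' _ ↦ hm n n']
  refine Finset.sum_congr rfl fun n' _ ↦ ?_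
  rw [integral_mul_combine_mul_conj hκ (hE n n')]
  split_ifs with hn
  · subst hn
    congr 1
    ext b b'
    rw [← integral_normSq_chan_mul_pilotSignal (M := M) hκ hxi hδ q n b b']
    congr 1
    ext ω
    have h := rotation_mul_conj_self (M := M) n t ω
    rw [map_mul]
    linear_combination (M.chan q n ω * conj (M.chan q n ω))
      * (M.pilotSignal ω (n, b) * conj (M.pilotSignal ω (n, b'))) * h
  · rw [crossAntennaForm]
    simp_rw [integral_effChannel_mul_pilotSignal_of_ne hκ hxi hδ ht q hn]
    simp only [quadForm, Finset.mul_sum]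
    refine Finset.sum_congr rfl fun n _ ↦ Finset.sum_congr rfl fun n' _ ↦ ?_
    ring

lemma integral_sum_normSq_combine (hκ : 0 ≤ hw.kappaSq) (hxi : 0 ≤ hw.xi)
    (hδ : 0 ≤ hw.delta) (w : Fin B → ℂ) :
    ((∫ ω, ∑ n, ‖M.combine w n ω‖ ^ 2 ∂M.μ : ℝ) : ℂ)
      = N * quadForm w
            (pilotCov net j hw.kappaSq (net.sigma ^ 2 * hw.xi) hw.phaseCoherence) := by
  rw [integral_finsetSum _ fun n _ ↦ integrable_normSq_of_mem (combine_mem_univ hκ w n)]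
  push_cast
  have h (n : Fin N) : ((∫ ω, ‖M.combine w n ω‖ ^ 2 ∂M.μ : ℝ) : ℂ) = quadForm w
      (pilotCov net j hw.kappaSq (net.sigma ^ 2 * hw.xi) hw.phaseCoherence) := by
    rw [integral_normSq_eq]
    have h := integral_mul_combine_mul_conj (M := M) hκ (const_mem_momentAlgebra 1) w n n
    simp only [one_mul, integral_pilotSignal_mul_conj hκ hxi hδ, if_true] at h
    exact h
  simp_rw [h]
  simp

/-- The distortion at a later channel use is independent of the filter, up to the channels that
determine its amplitude, so only the diagonal terms of the square survive. -/
lemma integral_normSq_combine_dotProduct_distortion (hκ : 0 ≤ hw.kappaSq) (hxi : 0 ≤ hw.xi)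
    (hδ : 0 ≤ hw.delta) {t : ℕ} (ht : B < t) (w : Fin B → ℂ) :
    ((∫ ω, ‖∑ n, conj (M.combine w n ω)
        * (M.amplitude n ω * M.source (.distortion n t) ω)‖ ^ 2 ∂M.μ : ℝ) : ℂ)
      = N * ((hw.kappaSq : ℂ) * ∑ q : Fin L × Fin K, (net.p q.1 q.2 : ℂ) * quadForm w
            (weightedCov net j hw.kappaSq (net.sigma ^ 2 * hw.xi) hw.phaseCoherence q)) := by
  rw [integral_normSq_eq]
  have hc {n : Fin N} {f : M.Ω → ℂ} (hf : f ∈ M.alg (Source.channelSet n)) :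
      f ∈ M.alg (Source.withoutDistortionAt t) :=
    momentAlgebra_mono (Source.multiplicative_subset_withoutDistortionAt t)
      (mem_multiplicative_of_channelSet hf)
  have e (ω : M.Ω) : (∑ n, conj (M.combine w n ω)
          * (M.amplitude n ω * M.source (.distortion n t) ω))
        * conj (∑ n, conj (M.combine w n ω) * (M.amplitude n ω * M.source (.distortion n t) ω))
      = ∑ n, ∑ n', ((M.amplitude n ω * conj (M.amplitude n' ω))
          * (M.combine w n' ω * conj (M.combine w n ω)))
          * (M.source (.distortion n t) ω * conj (M.source (.distortion n' t) ω)) := by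
    simp only [map_sum, map_mul, Complex.conj_conj]
    rw [Finset.sum_mul_sum]
    refine Finset.sum_congr rfl fun n _ ↦ Finset.sum_congr rfl fun n' _ ↦ ?_
    ring
  have hY (n n' : Fin N) : (fun ω ↦ (M.amplitude n ω * conj (M.amplitude n' ω))
      * (M.combine w n' ω * conj (M.combine w n ω))) ∈ M.alg (Source.withoutDistortionAt t) :=
    mul_mem_momentAlgebra (mul_mem_momentAlgebra (hc (amplitude_mem hκ n))
      (conj_mem_momentAlgebra (hc (amplitude_mem hκ n')))) (mul_mem_momentAlgebra
      (combine_mem hκ w n' ht) (conj_mem_momentAlgebra (combine_mem hκ w n ht)))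
  have hs (n : Fin N) := source_mem (M := M) (Source.isGaussian_distortion n t) (Set.mem_univ _)
  have hm (n n' : Fin N) := mul_mem_momentAlgebra
    (momentAlgebra_mono (Set.subset_univ _) (hY n n'))
    (mul_mem_momentAlgebra (hs n) (conj_mem_momentAlgebra (hs n')))
  have hnot (n : Fin N) : (Source.distortion n t : Source L K N) ∉ Source.withoutDistortionAt t :=
    fun h ↦ h rfl
  simp_rw [e]
  rw [integral_sum_of_mem fun n _ ↦ sum_mem_momentAlgebra fun n' _ ↦ hm n n']
  have h1 (n : Fin N) : ∫ ω, (M.amplitude n ω * conj (M.amplitude n ω))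
        * (M.combine w n ω * conj (M.combine w n ω)) ∂M.μ
      = (hw.kappaSq : ℂ) * ∑ q : Fin L × Fin K, (net.p q.1 q.2 : ℂ) * quadForm w
            (weightedCov net j hw.kappaSq (net.sigma ^ 2 * hw.xi) hw.phaseCoherence q) := by
    have hu {f : M.Ω → ℂ} (hf : f ∈ M.alg (Source.channelSet n)) : f ∈ M.alg Set.univ :=
      momentAlgebra_mono (Set.subset_univ _) hf
    have hq (q : Fin L × Fin K) := mul_mem_momentAlgebra (hu (chan_mem q n))
      (conj_mem_momentAlgebra (hu (chan_mem q n)))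
    have hV := combine_mem_univ (M := M) hκ w n
    simp_rw [amplitude_mul_conj hκ, mul_assoc (hw.kappaSq : ℂ), integral_const_mul, Finset.sum_mul,
      mul_assoc]
    rw [integral_sum_of_mem (S := Set.univ) fun q _ ↦ const_mul_mem_momentAlgebra _ (by
      simp_rw [← mul_assoc]
      exact mul_mem_momentAlgebra (mul_mem_momentAlgebra (hq q) hV) (conj_mem_momentAlgebra hV))]
    simp_rw [integral_const_mul]
    congr 1
    refine Finset.sum_congr rfl fun q _ ↦ ?_
    have h := integral_mul_combine_mul_conj hκ (hq q) w n n
    simp_rw [integral_normSq_chan_mul_pilotSignal hκ hxi hδ, mul_assoc] at h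
    rw [h]
  have h2 (n : Fin N) : ∫ ω, (∑ n', ((M.amplitude n ω * conj (M.amplitude n' ω))
          * (M.combine w n' ω * conj (M.combine w n ω)))
          * (M.source (.distortion n t) ω * conj (M.source (.distortion n' t) ω))) ∂M.μ
      = (hw.kappaSq : ℂ) * ∑ q : Fin L × Fin K, (net.p q.1 q.2 : ℂ) * quadForm w
            (weightedCov net j hw.kappaSq (net.sigma ^ 2 * hw.xi) hw.phaseCoherence q) := by
    rw [integral_sum_of_mem fun n' _ ↦ hm n n']
    simp_rw [integral_mul_source_mul_conj_source hxi (hY _ _) (Source.isGaussian_distortion _ t)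
      (hnot _) (Source.isGaussian_distortion _ t)]
    simp [Source.power, h1]
  simp_rw [h2]
  simp

/-- The SINR in terms of the coefficients `w` of the LMMSE filter. -/
lemma IsMRC.sinr_eq {k : Fin K} {t : ℕ} {v : M.Ω → Fin N → ℂ} (hκ : 0 ≤ hw.kappaSq)
    (hxi : 0 ≤ hw.xi) (hδ : 0 ≤ hw.delta) (ht : B < t) (hv : M.IsMRC k t v) {w : Fin B → ℂ}
    (hw' : Matrix.vecMul w
        (pilotCov net j hw.kappaSq (net.sigma ^ 2 * hw.xi) hw.phaseCoherence)
      = crossCov net j hw.phaseCoherence t (j, k)) :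
    M.sinr k t v
      = (net.p j k * ‖(N : ℂ) * (star w ⬝ᵥ crossCov net j hw.phaseCoherence t (j, k))‖ ^ 2)
        / sinrDenom net j k lo t hw.kappaSq (net.sigma ^ 2 * hw.xi) hw.phaseCoherence N w := by
  have hae := hv.ae_eq_combine hκ hxi hδ ht hw'
  have hq (q : Fin L × Fin K) : ∫ ω, ‖star (v ω) ⬝ᵥ M.effChannel q.1 q.2 t ω‖ ^ 2 ∂M.μ
      = N * (quadForm w
              (weightedCov net j hw.kappaSq (net.sigma ^ 2 * hw.xi) hw.phaseCoherence q)).re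
            + N * (N - 1) * (crossAntennaForm net j lo hw.phaseCoherence t w q).re := by
    have h := congrArg Complex.re
      (integral_normSq_combine_dotProduct_effChannel (M := M) hκ hxi hδ ht w q)
    rw [Complex.ofReal_re] at h
    have h' : (N : ℂ) * (N - 1) = ((N * (N - 1) : ℝ) : ℂ) := by push_cast; ring
    rw [h', ← Complex.ofReal_natCast, Complex.add_re, Complex.re_ofReal_mul,
      Complex.re_ofReal_mul] at h
    rw [← h]
    refine integral_congr_ae ?_
    filter_upwards [hae] with ω hω
    simp only [dotProduct, Pi.star_apply, hω]
    rfl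
  have h1 : ∫ ω, star (v ω) ⬝ᵥ M.effChannel j k t ω ∂M.μ
      = N * (star w ⬝ᵥ crossCov net j hw.phaseCoherence t (j, k)) := by
    rw [← integral_combine_dotProduct_effChannel (M := M) hκ hxi hδ ht w (j, k)]
    refine integral_congr_ae ?_
    filter_upwards [hae] with ω hω
    simp only [dotProduct, Pi.star_apply, hω]
    rfl
  have h3 : ∫ ω, ‖star (v ω) ⬝ᵥ M.distortion t ω‖ ^ 2 ∂M.μ
      = N * (hw.kappaSq * ∑ q : Fin L × Fin K, net.p q.1 q.2 * (quadForm w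
              (weightedCov net j hw.kappaSq (net.sigma ^ 2 * hw.xi) hw.phaseCoherence q)).re) := by
    have h := congrArg Complex.re
      (integral_normSq_combine_dotProduct_distortion (M := M) hκ hxi hδ ht w)
    rw [Complex.ofReal_re, ← Complex.ofReal_natCast, Complex.re_ofReal_mul, Complex.re_ofReal_mul,
      Complex.re_sum] at h
    simp_rw [Complex.re_ofReal_mul] at h
    rw [← h]
    refine integral_congr_ae ?_
    filter_upwards [hae] with ω hω
    simp only [dotProduct, Pi.star_apply, hω]
    rfl
  have h4 : ∫ ω, ∑ n, ‖v ω n‖ ^ 2 ∂M.μ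
      = N * (star w ⬝ᵥ crossCov net j hw.phaseCoherence t (j, k)).re := by
    have h := congrArg Complex.re (integral_sum_normSq_combine (M := M) hκ hxi hδ w)
    rw [Complex.ofReal_re, ← Complex.ofReal_natCast, Complex.re_ofReal_mul,
      quadForm_eq_of_vecMul_eq hw'] at h
    rw [← h]
    refine integral_congr_ae ?_
    filter_upwards [hae] with ω hω
    simp only [hω]
  rw [sinr, sinrDenom, h1, h3, h4]
  simp_rw [← hq, Fintype.sum_prod_type]

/-- The inequality `‖E X‖ ^ 2 ≤ E ‖X‖ ^ 2` for the combination `X` with coefficients `z` of the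
phase drifts between the pilot channel uses and channel use `t`. -/
lemma normSq_sum_le_quadForm (hN : 0 < N) (hδ : 0 ≤ hw.delta)
    (M : UplinkModel.{u} net hw lo j N) {t : ℕ} (ht : B < t) (z : Fin B → ℂ) :
    ‖∑ b : Fin B, z b * (hw.phaseCoherence : ℂ) ^ (t - ((b : ℕ) + 1))‖ ^ 2
      ≤ (quadForm z fun b b' ↦ (hw.phaseCoherence : ℂ) ^ Nat.dist b b').re := by
  set n : Fin N := ⟨0, hN⟩
  have hm (b : Fin B) : (fun ω ↦ M.rotation n (b + 1) ω * conj (M.rotation n t ω))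
      ∈ M.alg Source.phases := rotation_mul_conj_mem_phases n n (b + 1) t
  have hf : (fun ω ↦ ∑ b : Fin B, z b * (M.rotation n (b + 1) ω * conj (M.rotation n t ω)))
      ∈ M.alg Source.phases :=
    sum_mem_momentAlgebra fun b _ ↦ const_mul_mem_momentAlgebra _ (hm b)
  have h1 : ∫ ω, ∑ b : Fin B, z b * (M.rotation n (b + 1) ω * conj (M.rotation n t ω)) ∂M.μ
      = ∑ b : Fin B, z b * (hw.phaseCoherence : ℂ) ^ (t - ((b : ℕ) + 1)) := by
    rw [integral_sum_of_mem fun b _ ↦ const_mul_mem_momentAlgebra _ (hm b)]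
    simp_rw [integral_const_mul, integral_rotation_mul_conj hδ]
    refine Finset.sum_congr rfl fun b _ ↦ ?_
    rw [Nat.dist_eq_sub_of_le (by omega)]
    rfl
  have h2 : ∫ ω, ‖∑ b : Fin B, z b * (M.rotation n (b + 1) ω * conj (M.rotation n t ω))‖ ^ 2 ∂M.μ
      = (quadForm z fun b b' ↦ (hw.phaseCoherence : ℂ) ^ Nat.dist b b').re := by
    rw [integral_normSq_eq_re]
    congr 1
    have e (ω : M.Ω) : (∑ b : Fin B, z b * (M.rotation n (b + 1) ω * conj (M.rotation n t ω)))
          * conj (∑ b : Fin B, z b * (M.rotation n (b + 1) ω * conj (M.rotation n t ω)))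
        = ∑ b : Fin B, ∑ b' : Fin B, (z b * conj (z b'))
            * (M.rotation n (b + 1) ω * conj (M.rotation n (b' + 1) ω)) := by
      rw [map_sum, Finset.sum_mul_sum]
      refine Finset.sum_congr rfl fun b _ ↦ Finset.sum_congr rfl fun b' _ ↦ ?_
      have h := rotation_mul_conj_self (M := M) n t ω
      simp only [map_mul, Complex.conj_conj]
      linear_combination (z b * conj (z b'))
        * (M.rotation n (b + 1) ω * conj (M.rotation n (b' + 1) ω)) * h
    have hbb (b b' : Fin B) : (fun ω ↦ (z b * conj (z b'))
        * (M.rotation n (b + 1) ω * conj (M.rotation n (b' + 1) ω))) ∈ M.alg Source.phases :=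
      const_mul_mem_momentAlgebra _ (rotation_mul_conj_mem_phases n n _ _)
    simp_rw [e]
    rw [integral_sum_of_mem fun b _ ↦ sum_mem_momentAlgebra fun b' _ ↦ hbb b b']
    refine Finset.sum_congr rfl fun b _ ↦ ?_
    rw [integral_sum_of_mem fun b' _ ↦ hbb b b']
    simp_rw [integral_const_mul, integral_rotation_mul_conj' hδ]
  rw [← h1, ← h2]
  have h3 := norm_integral_le_integral_norm (μ := M.μ)
    (fun ω ↦ ∑ b : Fin B, z b * (M.rotation n (b + 1) ω * conj (M.rotation n t ω)))
  have h4 : (∫ ω, ‖∑ b : Fin B, z b * (M.rotation n (b + 1) ω * conj (M.rotation n t ω))‖ ∂M.μ) ^ 2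
      ≤ ∫ ω, ‖∑ b : Fin B, z b * (M.rotation n (b + 1) ω * conj (M.rotation n t ω))‖ ^ 2 ∂M.μ :=
    (convexOn_pow 2).map_integral_le (by fun_prop) isClosed_Ici
      (ae_of_all _ fun ω ↦ norm_nonneg _) (integrable_of_mem_momentAlgebra hf).norm
      (integrable_normSq_of_mem hf)
  exact (pow_le_pow_left₀ (norm_nonneg _) h3 2).trans h4

end SINR

end UplinkModel

/-! ### Hermitian forms and positivity of the denominator -/

section QuadForm

variable {B : ℕ}

lemma quadForm_add (w : Fin B → ℂ) (A A' : Matrix (Fin B) (Fin B) ℂ) :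
    quadForm w (fun b b' ↦ A b b' + A' b b') = quadForm w A + quadForm w A' := by
  simp [quadForm, mul_add, Finset.sum_add_distrib]

lemma quadForm_const_mul (w : Fin B → ℂ) (c : ℂ) (A : Matrix (Fin B) (Fin B) ℂ) :
    quadForm w (fun b b' ↦ c * A b b') = c * quadForm w A := by
  simp only [quadForm, Finset.mul_sum]
  refine Finset.sum_congr rfl fun b _ ↦ Finset.sum_congr rfl fun b' _ ↦ ?_
  ring

lemma quadForm_sum {ι : Type*} (s : Finset ι) (w : Fin B → ℂ)
    (A : ι → Matrix (Fin B) (Fin B) ℂ) :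
    quadForm w (fun b b' ↦ ∑ i ∈ s, A i b b') = ∑ i ∈ s, quadForm w (A i) := by
  simp only [quadForm, Finset.mul_sum]
  exact (Finset.sum_congr rfl fun b _ ↦ Finset.sum_comm).trans Finset.sum_comm

lemma quadForm_diagonal (w : Fin B → ℂ) (c : ℂ) :
    quadForm w (fun b b' ↦ if b = b' then c else 0) = c * ((∑ b, ‖w b‖ ^ 2 : ℝ) : ℂ) := by
  simp only [quadForm, mul_ite, mul_zero, Finset.sum_ite_eq, Finset.mem_univ, if_true]
  push_cast
  rw [Finset.mul_sum]
  refine Finset.sum_congr rfl fun b _ ↦ ?_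
  rw [Complex.mul_conj, Complex.normSq_eq_norm_sq]
  push_cast
  ring

lemma quadForm_rankOne (w y : Fin B → ℂ) :
    quadForm w (fun b b' ↦ y b * conj (y b')) = ((‖∑ b, w b * y b‖ ^ 2 : ℝ) : ℂ) := by
  rw [← Complex.normSq_eq_norm_sq, ← Complex.mul_conj, map_sum, Finset.sum_mul_sum]
  refine Finset.sum_congr rfl fun b _ ↦ Finset.sum_congr rfl fun b' _ ↦ ?_
  rw [map_mul]
  ring

lemma quadForm_smul (β : ℝ) (w : Fin B → ℂ) (A : Matrix (Fin B) (Fin B) ℂ) :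
    quadForm ((β : ℂ) • w) A = ((β ^ 2 : ℝ) : ℂ) * quadForm w A := by
  simp only [quadForm, Finset.mul_sum, Pi.smul_apply, smul_eq_mul, map_mul, Complex.conj_ofReal]
  refine Finset.sum_congr rfl fun b _ ↦ Finset.sum_congr rfl fun b' _ ↦ ?_
  push_cast
  ring

lemma tendsto_quadForm {ι : Type*} {l : Filter ι} {w : ι → Fin B → ℂ} {w₀ : Fin B → ℂ}
    {A : ι → Matrix (Fin B) (Fin B) ℂ} {A₀ : Matrix (Fin B) (Fin B) ℂ} (hw : Tendsto w l (𝓝 w₀))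
    (hA : ∀ b b', Tendsto (fun i ↦ A i b b') l (𝓝 (A₀ b b'))) :
    Tendsto (fun i ↦ quadForm (w i) (A i)) l (𝓝 (quadForm w₀ A₀)) := by
  have h := tendsto_pi_nhds.1 hw
  exact tendsto_finsetSum _ fun b _ ↦ tendsto_finsetSum _ fun b' _ ↦
    ((h b).mul ((Complex.continuous_conj.tendsto _).comp (h b'))).mul (hA b b')

end QuadForm

section Formula

variable {L K B : ℕ} (net : Network L K B) (j : Fin L)

/-- The total average power received at an antenna of base station `j`, receiver noise and
distortion aside. -/
noncomputable def receivedPower : ℝ := ∑ q : Fin L × Fin K, net.p q.1 q.2 * net.lam j q.1 q.2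

lemma receivedPower_pos {k : Fin K} (hp : 0 < net.p j k) : 0 < receivedPower net j :=
  Finset.sum_pos' (fun _ _ ↦ mul_nonneg (net.p_nonneg _ _) (net.lam_pos _ _ _).le)
    ⟨(j, k), Finset.mem_univ _, mul_pos hp (net.lam_pos _ _ _)⟩

/-- The Hermitian form of the autocorrelation of the phase drift, evaluated at the coefficients `w`
modulated with the pilots of user `q`. -/
noncomputable def modulatedForm (g : ℝ) (w : Fin B → ℂ) (q : Fin L × Fin K) : ℂ :=
  quadForm (fun b ↦ w b * net.pilot q.1 q.2 b) fun b b' ↦ (g : ℂ) ^ Nat.dist b b'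

lemma quadForm_pilotGram (g : ℝ) (w : Fin B → ℂ) (q : Fin L × Fin K) :
    quadForm w (fun b b' ↦ (g : ℂ) ^ Nat.dist b b' * pilotGram net q b b')
      = modulatedForm net g w q := by
  simp only [quadForm, modulatedForm, pilotGram, map_mul]
  refine Finset.sum_congr rfl fun b _ ↦ Finset.sum_congr rfl fun b' _ ↦ ?_
  ring

lemma quadForm_pilotCov_re (κ ν g : ℝ) (w : Fin B → ℂ) :
    (quadForm w (pilotCov net j κ ν g)).re
      = ∑ q : Fin L × Fin K, net.lam j q.1 q.2 * (modulatedForm net g w q).re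
        + (κ * receivedPower net j + ν) * ∑ b, ‖w b‖ ^ 2 := by
  have h : pilotCov net j κ ν g = fun (b b' : Fin B) ↦
      (∑ q : Fin L × Fin K, (net.lam j q.1 q.2 : ℂ)
        * ((g : ℂ) ^ Nat.dist b b' * pilotGram net q b b'))
      + (if b = b' then ((κ * receivedPower net j + ν : ℝ) : ℂ) else 0) := by
    ext b b'
    simp only [pilotCov, receivedPower, Finset.mul_sum]
    push_cast
    congr 1
    · refine Finset.sum_congr rfl fun q _ ↦ ?_
      ring
  rw [h, quadForm_add w (fun (b b' : Fin B) ↦ ∑ q : Fin L × Fin K, (net.lam j q.1 q.2 : ℂ)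
      * ((g : ℂ) ^ Nat.dist b b' * pilotGram net q b b'))
      (fun b b' ↦ if b = b' then ((κ * receivedPower net j + ν : ℝ) : ℂ) else 0),
    quadForm_sum Finset.univ w fun (q : Fin L × Fin K) (b b' : Fin B) ↦ (net.lam j q.1 q.2 : ℂ)
      * ((g : ℂ) ^ Nat.dist b b' * pilotGram net q b b'), quadForm_diagonal, Complex.add_re,
    Complex.re_sum, ← Complex.ofReal_mul, Complex.ofReal_re]
  congr 1
  refine Finset.sum_congr rfl fun q _ ↦ ?_
  rw [quadForm_const_mul w _ fun b b' ↦ (g : ℂ) ^ Nat.dist b b' * pilotGram net q b b',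
    Complex.re_ofReal_mul, quadForm_pilotGram]

lemma quadForm_weightedCov_re (κ ν g : ℝ) (w : Fin B → ℂ) (q : Fin L × Fin K) :
    (quadForm w (weightedCov net j κ ν g q)).re
      = net.lam j q.1 q.2 * (quadForm w (pilotCov net j κ ν g)).re
        + net.lam j q.1 q.2 ^ 2 * (modulatedForm net g w q).re
        + κ * (net.p q.1 q.2 * net.lam j q.1 q.2 ^ 2) * ∑ b, ‖w b‖ ^ 2 := by
  have h1 := quadForm_add w
    (fun b b' ↦ (net.lam j q.1 q.2 : ℂ) * pilotCov net j κ ν g b b'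
      + (net.lam j q.1 q.2 : ℂ) ^ 2 * ((g : ℂ) ^ Nat.dist b b' * pilotGram net q b b'))
    (fun b b' ↦ if b = b' then (κ : ℂ) * ((net.p q.1 q.2 : ℂ) * (net.lam j q.1 q.2 : ℂ) ^ 2) else 0)
  have h2 := quadForm_add w (fun b b' ↦ (net.lam j q.1 q.2 : ℂ) * pilotCov net j κ ν g b b')
    (fun b b' ↦ (net.lam j q.1 q.2 : ℂ) ^ 2 * ((g : ℂ) ^ Nat.dist b b' * pilotGram net q b b'))
  rw [h2, quadForm_const_mul, quadForm_const_mul w _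
    (fun b b' ↦ (g : ℂ) ^ Nat.dist b b' * pilotGram net q b b'), quadForm_diagonal,
    quadForm_pilotGram] at h1
  refine (congrArg Complex.re h1).trans ?_
  have h3 : (κ : ℂ) * ((net.p q.1 q.2 : ℂ) * (net.lam j q.1 q.2 : ℂ) ^ 2)
      = ((κ * (net.p q.1 q.2 * net.lam j q.1 q.2 ^ 2) : ℝ) : ℂ) := by push_cast; ring
  rw [h3, ← Complex.ofReal_pow, Complex.add_re, Complex.add_re, Complex.re_ofReal_mul,
    Complex.re_ofReal_mul, ← Complex.ofReal_mul, Complex.ofReal_re]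

/-- With a common oscillator the contribution of two antennas is the power of the combined drift. -/
lemma crossAntennaForm_common_re (g : ℝ) (t : ℕ) (w : Fin B → ℂ) (q : Fin L × Fin K) :
    (crossAntennaForm net j .common g t w q).re
      = net.lam j q.1 q.2 ^ 2 * (modulatedForm net g w q).re := by
  rw [crossAntennaForm, ← Complex.ofReal_pow, Complex.re_ofReal_mul, ← quadForm_pilotGram]
  rfl

/-- With separate oscillators the contribution of two antennas is the squared modulus of the mean of
the combined drift. -/
lemma crossAntennaForm_separate_re (g : ℝ) (t : ℕ) (w : Fin B → ℂ) (q : Fin L × Fin K) :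
    (crossAntennaForm net j .separate g t w q).re
      = net.lam j q.1 q.2 ^ 2
        * ‖∑ b : Fin B, (w b * net.pilot q.1 q.2 b) * (g : ℂ) ^ (t - ((b : ℕ) + 1))‖ ^ 2 := by
  have h := quadForm_rankOne w fun b : Fin B ↦ net.pilot q.1 q.2 b * (g : ℂ) ^ (t - ((b : ℕ) + 1))
  simp_rw [← mul_assoc] at h
  rw [crossAntennaForm, ← Complex.ofReal_pow, Complex.re_ofReal_mul, ← Complex.ofReal_re (‖_‖ ^ 2),
    ← h]
  congr 3
  ext b b'
  simp only [driftCorr, pilotGram, map_mul, map_pow, Complex.conj_ofReal]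
  ring

lemma norm_dotProduct_crossCov (g : ℝ) (t : ℕ) (w : Fin B → ℂ) (q : Fin L × Fin K) :
    ‖star w ⬝ᵥ crossCov net j g t q‖ ^ 2
      = net.lam j q.1 q.2 ^ 2
        * ‖∑ b : Fin B, (w b * net.pilot q.1 q.2 b) * (g : ℂ) ^ (t - ((b : ℕ) + 1))‖ ^ 2 := by
  have h : star w ⬝ᵥ crossCov net j g t q = (net.lam j q.1 q.2 : ℂ)
      * conj (∑ b : Fin B, (w b * net.pilot q.1 q.2 b) * (g : ℂ) ^ (t - ((b : ℕ) + 1))) := by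
    simp only [dotProduct, crossCov, map_sum, Finset.mul_sum, map_mul, map_pow, Complex.conj_ofReal,
      Pi.star_apply, RCLike.star_def]
    refine Finset.sum_congr rfl fun b _ ↦ ?_
    ring
  rw [h, norm_mul, mul_pow, RCLike.norm_conj, Complex.norm_real, Real.norm_eq_abs, sq_abs]

/-- The effective channel of the served user is correlated with the pilot signal. -/
lemma crossCov_ne_zero {k : Fin K} (hp : 0 < net.p j k) {g : ℝ} {t : ℕ} {b : Fin B}
    (hg : g ^ (t - ((b : ℕ) + 1)) ≠ 0) : crossCov net j g t (j, k) ≠ 0 := by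
  intro h
  have h1 := congrFun h b
  simp only [crossCov, Pi.zero_apply, mul_eq_zero, Complex.ofReal_eq_zero,
    (net.lam_pos j j k).ne', map_eq_zero, false_or] at h1
  rcases h1 with h1 | h1
  · have h2 := net.pilot_power j k b
    rw [h1, norm_zero] at h2
    simp at h2
    linarith
  · exact hg (by exact_mod_cast h1)

end Formula

namespace UplinkModel

variable {L K B : ℕ} {net : Network L K B} {hw : Hardware} {lo : LOType} {j : Fin L} {N : ℕ}

/-- The form is a second moment of phase rotations. -/
lemma modulatedForm_nonneg (hN : 0 < N) (hδ : 0 ≤ hw.delta) (M : UplinkModel.{u} net hw lo j N)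
    (w : Fin B → ℂ) (q : Fin L × Fin K) : 0 ≤ (modulatedForm net hw.phaseCoherence w q).re :=
  (sq_nonneg _).trans (normSq_sum_le_quadForm hN hδ M B.lt_succ_self _)

/-- A linear combination of the pilot signals of one antenna has positive variance unless it is
uncorrelated with these signals. -/
lemma quadForm_pilotCov_re_pos (hN : 0 < N) (hκ : 0 ≤ hw.kappaSq) (hxi : 0 ≤ hw.xi)
    (hδ : 0 ≤ hw.delta) (M : UplinkModel.{u} net hw lo j N) {w : Fin B → ℂ}
    (h : Matrix.vecMul w
        (pilotCov net j hw.kappaSq (net.sigma ^ 2 * hw.xi) hw.phaseCoherence) ≠ 0) :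
    0 < (quadForm w (pilotCov net j hw.kappaSq (net.sigma ^ 2 * hw.xi) hw.phaseCoherence)).re := by
  set n : Fin N := ⟨0, hN⟩
  have h1 : ∫ ω, ‖M.combine w n ω‖ ^ 2 ∂M.μ
      = (quadForm w (pilotCov net j hw.kappaSq (net.sigma ^ 2 * hw.xi) hw.phaseCoherence)).re := by
    rw [integral_normSq_eq_re]
    have h := integral_mul_combine_mul_conj (M := M) hκ (const_mem_momentAlgebra 1) w n n
    simp only [one_mul, integral_pilotSignal_mul_conj hκ hxi hδ, if_true] at h
    exact congrArg Complex.re h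
  rw [← h1]
  refine lt_of_le_of_ne (integral_nonneg fun ω ↦ sq_nonneg _) fun h0 ↦ h ?_
  rw [eq_comm, integral_eq_zero_iff_of_nonneg (fun ω ↦ sq_nonneg _)
    (integrable_normSq_of_mem (combine_mem_univ hκ w n))] at h0
  ext b'
  have h2 : ∫ ω, M.combine w n ω * conj (M.pilotSignal ω (n, b')) ∂M.μ
      = ∑ b, w b * pilotCov net j hw.kappaSq (net.sigma ^ 2 * hw.xi) hw.phaseCoherence b b' := by
    simp only [combine, Finset.sum_mul]
    rw [integral_sum_of_mem (S := Set.univ) fun b _ ↦ mul_mem_momentAlgebra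
      (const_mul_mem_momentAlgebra _ (pilotSignal_mem_univ hκ _))
      (conj_mem_momentAlgebra (pilotSignal_mem_univ hκ _))]
    simp_rw [mul_assoc, integral_const_mul, integral_pilotSignal_mul_conj hκ hxi hδ]
    simp
  rw [Matrix.vecMul, dotProduct, ← h2, Pi.zero_apply]
  refine integral_eq_zero_of_ae ?_
  filter_upwards [h0] with ω hω
  have : M.combine w n ω = 0 := by simpa using hω
  simp [this]

/-- The denominator of the SINR is positive: at each single antenna the signal power fluctuates,
because the channel gain does. -/
lemma sinrDenom_pos (hN : 0 < N) (hκ : 0 ≤ hw.kappaSq) (hxi : 0 ≤ hw.xi)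
    (hδ : 0 ≤ hw.delta) (M : UplinkModel.{u} net hw lo j N) {t : ℕ} (ht : B < t) {k : Fin K}
    (hp : 0 < net.p j k) {w : Fin B → ℂ}
    (hw' : Matrix.vecMul w
        (pilotCov net j hw.kappaSq (net.sigma ^ 2 * hw.xi) hw.phaseCoherence)
      = crossCov net j hw.phaseCoherence t (j, k))
    (hr : crossCov net j hw.phaseCoherence t (j, k) ≠ 0) :
    0 < sinrDenom net j k lo t hw.kappaSq (net.sigma ^ 2 * hw.xi) hw.phaseCoherence N w := by
  set κ := hw.kappaSq
  set ν := net.sigma ^ 2 * hw.xi with hν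
  have hν0 : 0 ≤ ν := mul_nonneg (sq_nonneg _) hxi
  set g := hw.phaseCoherence
  set s := star w ⬝ᵥ crossCov net j g t (j, k) with hs
  have hpos : 0 < (quadForm w (pilotCov net j κ ν g)).re :=
    quadForm_pilotCov_re_pos hN hκ hxi hδ M (hw' ▸ hr)
  have hspos : 0 < s.re := by rwa [quadForm_eq_of_vecMul_eq hw'] at hpos
  have hmod (q : Fin L × Fin K) := modulatedForm_nonneg hN hδ M w q
  have hCS (q : Fin L × Fin K) : net.lam j q.1 q.2 ^ 2
      * ‖∑ b : Fin B, (w b * net.pilot q.1 q.2 b) * (g : ℂ) ^ (t - ((b : ℕ) + 1))‖ ^ 2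
      ≤ net.lam j q.1 q.2 ^ 2 * (modulatedForm net g w q).re :=
    mul_le_mul_of_nonneg_left (normSq_sum_le_quadForm hN hδ M ht _) (sq_nonneg _)
  have hnorm : 0 ≤ ∑ b, ‖w b‖ ^ 2 := Finset.sum_nonneg fun b _ ↦ sq_nonneg _
  have hQ (q : Fin L × Fin K) : 0 < (quadForm w (weightedCov net j κ ν g q)).re
      - net.lam j q.1 q.2 ^ 2 * (modulatedForm net g w q).re := by
    rw [quadForm_weightedCov_re]
    have h1 := mul_pos (net.lam_pos j q.1 q.2) hpos
    have h2 : 0 ≤ κ * (net.p q.1 q.2 * net.lam j q.1 q.2 ^ 2) * ∑ b, ‖w b‖ ^ 2 :=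
      mul_nonneg (mul_nonneg hκ (mul_nonneg (net.p_nonneg _ _) (sq_nonneg _))) hnorm
    linarith
  have hQ0 (q : Fin L × Fin K) : 0 ≤ (quadForm w (weightedCov net j κ ν g q)).re := by
    have := mul_nonneg (sq_nonneg (net.lam j q.1 q.2)) (hmod q)
    linarith [hQ q]
  have hD0 (q : Fin L × Fin K) : net.lam j q.1 q.2 ^ 2
      * ‖∑ b : Fin B, (w b * net.pilot q.1 q.2 b) * (g : ℂ) ^ (t - ((b : ℕ) + 1))‖ ^ 2
      ≤ (crossAntennaForm net j lo g t w q).re := by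
    cases lo with
    | common => rw [crossAntennaForm_common_re]; exact hCS q
    | separate => rw [crossAntennaForm_separate_re]
  have hD (q : Fin L × Fin K) : 0 ≤ (crossAntennaForm net j lo g t w q).re :=
    (mul_nonneg (sq_nonneg _) (sq_nonneg _)).trans (hD0 q)
  have hDs : ‖s‖ ^ 2 ≤ (crossAntennaForm net j lo g t w (j, k)).re := by
    rw [hs, norm_dotProduct_crossCov]
    exact hD0 (j, k)
  have hQs : ‖s‖ ^ 2 < (quadForm w (weightedCov net j κ ν g (j, k))).re := by
    have h1 := hCS (j, k)
    rw [← norm_dotProduct_crossCov net j] at h1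
    linarith [hQ (j, k)]
  have hN1 : (1 : ℝ) ≤ N := by exact_mod_cast hN
  have hN0 : (0 : ℝ) ≤ (N : ℝ) * (N - 1) := mul_nonneg (by linarith) (by linarith)
  have hterm (q : Fin L × Fin K) : 0 ≤ net.p q.1 q.2
      * (N * (quadForm w (weightedCov net j κ ν g q)).re
        + N * (N - 1) * (crossAntennaForm net j lo g t w q).re) :=
    mul_nonneg (net.p_nonneg _ _) (add_nonneg (mul_nonneg (by linarith) (hQ0 q))
      (mul_nonneg hN0 (hD q)))
  have hsum := Finset.single_le_sum (f := fun q : Fin L × Fin K ↦ net.p q.1 q.2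
      * (N * (quadForm w (weightedCov net j κ ν g q)).re
        + N * (N - 1) * (crossAntennaForm net j lo g t w q).re)) (fun q _ ↦ hterm q)
    (Finset.mem_univ (j, k))
  have hκ' : 0 ≤ (N : ℝ) * (κ * ∑ q : Fin L × Fin K, net.p q.1 q.2
      * (quadForm w (weightedCov net j κ ν g q)).re) :=
    mul_nonneg (by linarith) (mul_nonneg hκ (Finset.sum_nonneg fun q _ ↦
      mul_nonneg (net.p_nonneg _ _) (hQ0 q)))
  have hν' : 0 ≤ ν * (N * s.re) := mul_nonneg hν0 (mul_nonneg (by linarith) hspos.le)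
  have hmain : 0 < net.p j k * (N * (quadForm w (weightedCov net j κ ν g (j, k))).re
        + N * (N - 1) * (crossAntennaForm net j lo g t w (j, k)).re)
      - net.p j k * ‖(N : ℂ) * s‖ ^ 2 := by
    rw [← mul_sub, norm_mul, mul_pow, Complex.norm_natCast]
    refine mul_pos hp ?_
    have h1 := mul_lt_mul_of_pos_left hQs (by linarith : (0 : ℝ) < N)
    have h2 := mul_le_mul_of_nonneg_left hDs hN0
    nlinarith
  rw [sinrDenom]
  simp only [] at hsum
  linarith

end UplinkModel

/-! ### Rescaling, and the limit of the SINR -/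

section Scaling

variable {L K B : ℕ} (net : Network L K B) (j : Fin L) (k : Fin K) (lo : LOType)

/-- From the last pilot at channel use `B` until channel use `t` all phase correlations decay by the
common factor `g ^ (t - B)`. -/
lemma crossCov_eq_pow_mul {t : ℕ} (ht : B < t) (g : ℝ) (q : Fin L × Fin K) :
    crossCov net j g t q = ((g ^ (t - B) : ℝ) : ℂ) • crossCov net j g B q := by
  ext b
  have hb := b.2
  have h : t - ((b : ℕ) + 1) = (t - B) + (B - ((b : ℕ) + 1)) := by omega
  simp only [crossCov, Pi.smul_apply, smul_eq_mul, h, pow_add]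
  push_cast
  ring

lemma dotProduct_smul_crossCov {t : ℕ} (ht : B < t) (g β : ℝ) (w : Fin B → ℂ)
    (q : Fin L × Fin K) :
    star ((β : ℂ) • w) ⬝ᵥ crossCov net j g t q
      = ((β * g ^ (t - B) : ℝ) : ℂ) * (star w ⬝ᵥ crossCov net j g B q) := by
  rw [crossCov_eq_pow_mul net j ht, star_smul, smul_dotProduct, dotProduct_smul]
  simp only [RCLike.star_def, Complex.conj_ofReal, smul_eq_mul]
  push_cast
  ring

lemma crossAntennaForm_smul (g β : ℝ) (t : ℕ) (w : Fin B → ℂ) (q : Fin L × Fin K) :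
    (crossAntennaForm net j lo g t ((β : ℂ) • w) q).re
      = β ^ 2 * (crossAntennaForm net j lo g t w q).re := by
  rw [crossAntennaForm, crossAntennaForm,
    quadForm_smul _ _ (fun b b' ↦ driftCorr lo g t b b' * pilotGram net q b b'), mul_left_comm,
    Complex.re_ofReal_mul]

/-- The denominator of the SINR for the coefficients `(g ^ (t - B) / D) • w`, divided by the square
of `N * (g ^ (t - B)) ^ 2 / D`. With `D` of the order of the noise power, all its ingredients
converge. -/
noncomputable def normalizedDenom (t : ℕ) (κ ν g D : ℝ) (N : ℕ) (w : Fin B → ℂ) : ℝ :=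
  D ^ 2 / (N * (g ^ (t - B)) ^ 2)
      * ((1 / D + κ / D)
          * (∑ q : Fin L × Fin K, net.p q.1 q.2 * ((quadForm w (weightedCov net j κ ν g q)).re / D))
        + ν / D * (star w ⬝ᵥ crossCov net j g B (j, k)).re)
    + (1 - 1 / N) * (∑ q : Fin L × Fin K, net.p q.1 q.2
        * ((crossAntennaForm net j lo g t w q).re / (g ^ (t - B)) ^ 2))
    - net.p j k * ‖star w ⬝ᵥ crossCov net j g B (j, k)‖ ^ 2

/-- The factor is the one by which the same rescaling multiplies the numerator of the SINR. -/
lemma sinrDenom_smul {t : ℕ} (ht : B < t) {κ ν g D : ℝ} (hg : g ≠ 0) (hD : D ≠ 0) {N : ℕ}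
    (hN : N ≠ 0) (w : Fin B → ℂ) :
    sinrDenom net j k lo t κ ν g N (((g ^ (t - B) / D : ℝ) : ℂ) • w)
      = (N * (g ^ (t - B)) ^ 2 / D) ^ 2 * normalizedDenom net j k lo t κ ν g D N w := by
  have hγ : g ^ (t - B) ≠ 0 := pow_ne_zero _ hg
  have hN' : (N : ℝ) ≠ 0 := Nat.cast_ne_zero.2 hN
  rw [sinrDenom, normalizedDenom]
  simp only [quadForm_smul, crossAntennaForm_smul, Complex.re_ofReal_mul,
    dotProduct_smul_crossCov net j ht, norm_mul, Complex.norm_natCast, Complex.norm_real,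
    Real.norm_eq_abs, mul_pow, sq_abs]
  set γ := g ^ (t - B)
  set s := star w ⬝ᵥ crossCov net j g B (j, k)
  have h1 : ∑ q : Fin L × Fin K, net.p q.1 q.2
        * (N * ((γ / D) ^ 2 * (quadForm w (weightedCov net j κ ν g q)).re)
          + N * (N - 1) * ((γ / D) ^ 2 * (crossAntennaForm net j lo g t w q).re))
      = N * (γ / D) ^ 2 * (∑ q : Fin L × Fin K,
          net.p q.1 q.2 * (quadForm w (weightedCov net j κ ν g q)).re)
        + N * (N - 1) * (γ / D) ^ 2 * (∑ q : Fin L × Fin K,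
          net.p q.1 q.2 * (crossAntennaForm net j lo g t w q).re) := by
    simp only [Finset.mul_sum, ← Finset.sum_add_distrib]
    refine Finset.sum_congr rfl fun q _ ↦ ?_
    ring
  have h2 : ∑ q : Fin L × Fin K, net.p q.1 q.2
        * ((γ / D) ^ 2 * (quadForm w (weightedCov net j κ ν g q)).re)
      = (γ / D) ^ 2 * (∑ q : Fin L × Fin K,
          net.p q.1 q.2 * (quadForm w (weightedCov net j κ ν g q)).re) := by
    simp only [Finset.mul_sum]
    refine Finset.sum_congr rfl fun q _ ↦ ?_
    ring
  rw [h1, h2]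
  simp only [← mul_div_assoc, ← Finset.sum_div]
  field_simp
  ring

/-- A quantity with a positive limit, divided by a positive one with a finite limit, has a limit in
`(0, ∞]`. -/
lemma exists_tendsto_div_of_pos {A E : ℕ → ℝ} {a e : ℝ} (hA : Tendsto A atTop (𝓝 a)) (ha : 0 < a)
    (hE : Tendsto E atTop (𝓝 e)) (hpos : ∀ᶠ N in atTop, 0 < E N) :
    ∃ ℓ : EReal, 0 < ℓ ∧ Tendsto (fun N ↦ ((A N / E N : ℝ) : EReal)) atTop (𝓝 ℓ) := by
  have he : 0 ≤ e := ge_of_tendsto hE (hpos.mono fun N h ↦ h.le)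
  rcases he.eq_or_lt with rfl | he
  · refine ⟨⊤, EReal.zero_lt_top, EReal.tendsto_coe_nhds_top_iff.2 ?_⟩
    have h : Tendsto (fun N ↦ (E N)⁻¹) atTop atTop :=
      tendsto_inv_nhdsGT_zero.comp (tendsto_nhdsWithin_iff.2 ⟨hE, hpos⟩)
    simpa [div_eq_mul_inv] using hA.pos_mul_atTop ha h
  · exact ⟨((a / e : ℝ) : EReal), EReal.coe_pos.2 (div_pos ha he),
      (continuous_coe_real_ereal.tendsto _).comp (hA.div hE he.ne')⟩

lemma exists_tendsto_weightedCov_div {κ ν g D : ℕ → ℝ} {κ' ν' e g' : ℝ}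
    (hκ : Tendsto (fun N ↦ κ N / D N) atTop (𝓝 κ')) (hν : Tendsto (fun N ↦ ν N / D N) atTop (𝓝 ν'))
    (he : Tendsto (fun N ↦ 1 / D N) atTop (𝓝 e)) (hg : Tendsto g atTop (𝓝 g'))
    (q : Fin L × Fin K) (b b' : Fin B) :
    ∃ c : ℂ, Tendsto (fun N ↦ weightedCov net j (κ N) (ν N) (g N) q b b' * ((1 / D N : ℝ) : ℂ))
      atTop (𝓝 c) := by
  have hκ' := (Complex.continuous_ofReal.tendsto _).comp hκ
  have hν' := (Complex.continuous_ofReal.tendsto _).comp hν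
  have he' := (Complex.continuous_ofReal.tendsto _).comp he
  have hg' := ((Complex.continuous_ofReal.tendsto _).comp hg).pow (Nat.dist b b')
  by_cases hb : b = b'
  · refine ⟨_, ((((he'.mul hg').mul_const (∑ q : Fin L × Fin K,
      (net.lam j q.1 q.2 : ℂ) * pilotGram net q b b')).add
      ((hκ'.mul_const (∑ q : Fin L × Fin K, (net.p q.1 q.2 : ℂ) * (net.lam j q.1 q.2 : ℂ))).add
        hν')).const_mul (net.lam j q.1 q.2 : ℂ)).add (((he'.mul hg').mul_const
      ((net.lam j q.1 q.2 : ℂ) ^ 2 * pilotGram net q b b')).add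
      (hκ'.mul_const ((net.p q.1 q.2 : ℂ) * (net.lam j q.1 q.2 : ℂ) ^ 2))) |>.congr fun N ↦ ?_⟩
    simp only [weightedCov, pilotCov, hb, if_true, Function.comp_apply]
    push_cast
    ring
  · refine ⟨_, (((he'.mul hg').mul_const (∑ q : Fin L × Fin K,
      (net.lam j q.1 q.2 : ℂ) * pilotGram net q b b')).const_mul (net.lam j q.1 q.2 : ℂ)).add
      ((he'.mul hg').mul_const ((net.lam j q.1 q.2 : ℂ) ^ 2 * pilotGram net q b b')) |>.congr
      fun N ↦ ?_⟩
    simp only [weightedCov, pilotCov, hb, if_false, Function.comp_apply]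
    push_cast
    ring

/-- If the rescaled parameters and the rescaled filter coefficients converge, and the limit of the
latter correlates with the channel, then the SINR has a limit in `(0, ∞]`. -/
lemma exists_tendsto_sinr (hp : 0 < net.p j k) {t : ℕ} (ht : B < t) {κ ν g D : ℕ → ℝ}
    {κ' ν' e g' T : ℝ} {w : ℕ → Fin B → ℂ} {w' : Fin B → ℂ} {Δ : Fin B → Fin B → ℂ}
    (hg0 : ∀ᶠ N in atTop, 0 < g N) (hD0 : ∀ᶠ N in atTop, 0 < D N)
    (hκ : Tendsto (fun N ↦ κ N / D N) atTop (𝓝 κ')) (hν : Tendsto (fun N ↦ ν N / D N) atTop (𝓝 ν'))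
    (he : Tendsto (fun N ↦ 1 / D N) atTop (𝓝 e)) (hg : Tendsto g atTop (𝓝 g'))
    (hT : Tendsto (fun N : ℕ ↦ D N ^ 2 / (N * (g N ^ (t - B)) ^ 2)) atTop (𝓝 T))
    (hΔ : ∀ b b', Tendsto (fun N ↦ driftCorr lo (g N) t b b' * ((1 / (g N ^ (t - B)) ^ 2 : ℝ) : ℂ))
      atTop (𝓝 (Δ b b')))
    (hw : Tendsto w atTop (𝓝 w')) (hs : star w' ⬝ᵥ crossCov net j g' B (j, k) ≠ 0)
    (hpos : ∀ᶠ N in atTop, 0 < sinrDenom net j k lo t (κ N) (ν N) (g N) N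
      (((g N ^ (t - B) / D N : ℝ) : ℂ) • w N)) :
    ∃ ℓ : EReal, 0 < ℓ ∧ Tendsto (fun N : ℕ ↦ ((net.p j k * ‖(N : ℂ)
      * (star (((g N ^ (t - B) / D N : ℝ) : ℂ) • w N) ⬝ᵥ crossCov net j (g N) t (j, k))‖ ^ 2
        / sinrDenom net j k lo t (κ N) (ν N) (g N) N (((g N ^ (t - B) / D N : ℝ) : ℂ) • w N) : ℝ)
        : EReal)) atTop (𝓝 ℓ) := by
  have hgc := (Complex.continuous_ofReal.tendsto _).comp hg
  have hcross : Tendsto (fun N ↦ star (w N) ⬝ᵥ crossCov net j (g N) B (j, k)) atTop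
      (𝓝 (star w' ⬝ᵥ crossCov net j g' B (j, k))) :=
    tendsto_finsetSum _ fun b _ ↦ ((Complex.continuous_conj.tendsto _).comp
      (tendsto_pi_nhds.1 hw b)).mul ((hgc.pow _).const_mul _)
  have hnum : Tendsto (fun N ↦ net.p j k * ‖star (w N) ⬝ᵥ crossCov net j (g N) B (j, k)‖ ^ 2) atTop
      (𝓝 (net.p j k * ‖star w' ⬝ᵥ crossCov net j g' B (j, k)‖ ^ 2)) :=
    (hcross.norm.pow 2).const_mul _
  choose c hc using fun q b b' ↦ exists_tendsto_weightedCov_div net j hκ hν he hg q b b'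
  have hQ (q : Fin L × Fin K) : Tendsto
      (fun N ↦ (quadForm (w N) (weightedCov net j (κ N) (ν N) (g N) q)).re / D N) atTop
      (𝓝 (quadForm w' (c q)).re) := by
    refine ((Complex.continuous_re.tendsto _).comp (tendsto_quadForm (A := fun N b b' ↦
      ((1 / D N : ℝ) : ℂ) * weightedCov net j (κ N) (ν N) (g N) q b b') hw fun b b' ↦ ?_)).congr
      fun N ↦ ?_
    · simpa only [mul_comm] using hc q b b'
    · rw [Function.comp_apply, quadForm_const_mul, Complex.re_ofReal_mul]
      ring
  have hY (q : Fin L × Fin K) : Tendsto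
      (fun N ↦ (crossAntennaForm net j lo (g N) t (w N) q).re / (g N ^ (t - B)) ^ 2) atTop
      (𝓝 ((net.lam j q.1 q.2 : ℂ) ^ 2
        * quadForm w' fun b b' ↦ Δ b b' * pilotGram net q b b').re) := by
    refine ((Complex.continuous_re.tendsto _).comp ((tendsto_quadForm (A := fun N b b' ↦
      ((1 / (g N ^ (t - B)) ^ 2 : ℝ) : ℂ)
        * (driftCorr lo (g N) t b b' * pilotGram net q b b')) hw fun b b' ↦ ?_).const_mul _)).congr
      fun N ↦ ?_
    · refine ((hΔ b b').mul_const _).congr fun N ↦ ?_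
      ring
    · rw [Function.comp_apply, quadForm_const_mul _ _
        (fun b b' ↦ driftCorr lo (g N) t b b' * pilotGram net q b b'), mul_left_comm,
        Complex.re_ofReal_mul, crossAntennaForm]
      ring
  have hden : ∃ d, Tendsto (fun N : ℕ ↦
      normalizedDenom net j k lo t (κ N) (ν N) (g N) (D N) N (w N)) atTop (𝓝 d) :=
    ⟨_, ((hT.mul (((he.add hκ).mul (tendsto_finsetSum _ fun q _ ↦ (hQ q).const_mul _)).add
      (hν.mul ((Complex.continuous_re.tendsto _).comp hcross)))).add
      (((tendsto_const_nhds (x := (1 : ℝ))).sub tendsto_one_div_atTop_nhds_zero_nat).mul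
        (tendsto_finsetSum _ fun q _ ↦ (hY q).const_mul _))).sub hnum⟩
  obtain ⟨d, hd⟩ := hden
  have hsc : ∀ᶠ N : ℕ in atTop, 0 < g N ∧ 0 < D N ∧ N ≠ 0 :=
    hg0.and (hD0.and (eventually_ne_atTop 0))
  have hpos' : ∀ᶠ N : ℕ in atTop,
      0 < normalizedDenom net j k lo t (κ N) (ν N) (g N) (D N) N (w N) := by
    filter_upwards [hpos, hsc] with N h1 h2
    rw [sinrDenom_smul net j k lo ht h2.1.ne' h2.2.1.ne' h2.2.2] at h1
    exact pos_of_mul_pos_right h1 (sq_nonneg _)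
  obtain ⟨ℓ, hℓ, hlim⟩ := exists_tendsto_div_of_pos hnum
    (mul_pos hp (pow_pos (norm_pos_iff.2 hs) 2)) hd hpos'
  refine ⟨ℓ, hℓ, hlim.congr' ?_⟩
  filter_upwards [hsc] with N h
  obtain ⟨h1, h2, h3⟩ := h
  have hN : (N : ℝ) ≠ 0 := Nat.cast_ne_zero.2 h3
  have hγ : (g N) ^ (t - B) ≠ 0 := pow_ne_zero _ h1.ne'
  have hne : ((N : ℝ) * (g N ^ (t - B)) ^ 2 / D N) ^ 2 ≠ 0 := by positivity
  rw [sinrDenom_smul net j k lo ht h1.ne' h2.ne' h3, dotProduct_smul_crossCov net j ht, norm_mul,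
    norm_mul, Complex.norm_natCast, Complex.norm_real, Real.norm_eq_abs,
    show net.p j k * (N * (|g N ^ (t - B) / D N * g N ^ (t - B)|
        * ‖star (w N) ⬝ᵥ crossCov net j (g N) B (j, k)‖)) ^ 2
      = (N * (g N ^ (t - B)) ^ 2 / D N) ^ 2
        * (net.p j k * ‖star (w N) ⬝ᵥ crossCov net j (g N) B (j, k)‖ ^ 2) by
      rw [mul_pow, mul_pow, sq_abs]; field_simp, mul_div_mul_left _ _ hne]

end Scaling

/-! ### Convergence of the filter coefficients -/

section Coefficients

variable {L K B : ℕ} (net : Network L K B) (j : Fin L)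

/-- Solutions of linear systems converge if the systems converge to one with a coercive matrix; the
limiting solution pairs non-trivially with the right-hand side `r'` unless `r' = 0`. -/
lemma exists_tendsto_of_vecMul_eq {A : ℕ → Matrix (Fin B) (Fin B) ℂ}
    {A' : Matrix (Fin B) (Fin B) ℂ} {r w : ℕ → Fin B → ℂ} {r' : Fin B → ℂ} {c : ℝ}
    (hA : ∀ b b', Tendsto (fun N ↦ A N b b') atTop (𝓝 (A' b b'))) (hr : Tendsto r atTop (𝓝 r'))
    (hw : ∀ᶠ N in atTop, Matrix.vecMul (w N) (A N) = r N) (hc : 0 < c)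
    (hcoer : ∀ z : Fin B → ℂ, c * ∑ b, ‖z b‖ ^ 2 ≤ (quadForm z A').re) (hr' : r' ≠ 0) :
    ∃ w', Tendsto w atTop (𝓝 w') ∧ star w' ⬝ᵥ r' ≠ 0 := by
  have hzero (z : Fin B → ℂ) (h : (quadForm z A').re ≤ 0) : z = 0 := by
    have h0 : ∑ b, ‖z b‖ ^ 2 ≤ 0 := by
      by_contra hneg
      exact absurd ((hcoer z).trans h) (not_le.2 (mul_pos hc (not_le.1 hneg)))
    have h1 := (Finset.sum_eq_zero_iff_of_nonneg fun b _ ↦ sq_nonneg ‖z b‖).1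
      (h0.antisymm (Finset.sum_nonneg fun b _ ↦ sq_nonneg _))
    ext b
    simpa using h1 b (Finset.mem_univ b)
  have hdet : A'.det ≠ 0 := by
    intro h
    obtain ⟨z, hz, hz'⟩ := Matrix.exists_vecMul_eq_zero_iff.2 h
    refine hz (hzero z ?_)
    rw [quadForm_eq_of_vecMul_eq hz', dotProduct_zero, Complex.zero_re]
  have hA' : Tendsto A atTop (𝓝 A') := tendsto_pi_nhds.2 fun b ↦ tendsto_pi_nhds.2 (hA b)
  have hdetN : Tendsto (fun N ↦ (A N).det) atTop (𝓝 A'.det) :=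
    ((continuous_id.matrix_det).tendsto A').comp hA'
  have hinv : Tendsto (fun N ↦ (A N)⁻¹) atTop (𝓝 A'⁻¹) := by
    simp only [Matrix.inv_def, Ring.inverse_eq_inv']
    exact (hdetN.inv₀ hdet).smul (((continuous_id.matrix_adjugate).tendsto A').comp hA')
  have hlim : Tendsto (fun N ↦ Matrix.vecMul (r N) (A N)⁻¹) atTop
      (𝓝 (Matrix.vecMul r' A'⁻¹)) := by
    refine tendsto_pi_nhds.2 fun b' ↦ ?_
    simp only [Matrix.vecMul, dotProduct]
    refine tendsto_finsetSum _ fun b _ ↦ ?_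
    exact (tendsto_pi_nhds.1 hr b).mul (tendsto_pi_nhds.1 (tendsto_pi_nhds.1 hinv b) b')
  refine ⟨Matrix.vecMul r' A'⁻¹, hlim.congr' ?_, fun h ↦ ?_⟩
  · filter_upwards [hw, hdetN.eventually_ne hdet] with N h1 h2
    rw [← h1, Matrix.vecMul_vecMul, Matrix.mul_nonsing_inv _ (isUnit_iff_ne_zero.2 h2),
      Matrix.vecMul_one]
  · have h1 : Matrix.vecMul (Matrix.vecMul r' A'⁻¹) A' = r' := by
      rw [Matrix.vecMul_vecMul, Matrix.nonsing_inv_mul _ (isUnit_iff_ne_zero.2 hdet),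
        Matrix.vecMul_one]
    rw [← quadForm_eq_of_vecMul_eq h1] at h
    have h2 := hzero _ (by rw [h, Complex.zero_re])
    rw [h2, Matrix.zero_vecMul] at h1
    exact hr' h1.symm

lemma tendsto_modulatedForm {g : ℕ → ℝ} {g' : ℝ} (hg : Tendsto g atTop (𝓝 g')) (z : Fin B → ℂ)
    (q : Fin L × Fin K) :
    Tendsto (fun N ↦ (modulatedForm net (g N) z q).re) atTop (𝓝 (modulatedForm net g' z q).re) :=
  (Complex.continuous_re.tendsto _).comp (tendsto_quadForm tendsto_const_nhds fun _ _ ↦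
    ((Complex.continuous_ofReal.tendsto _).comp hg).pow _)

/-- With completely decorrelated phases the pilot signals of different channel uses are orthogonal.
-/
lemma modulatedForm_zero (z : Fin B → ℂ) (q : Fin L × Fin K) :
    (modulatedForm net 0 z q).re = net.p q.1 q.2 * ∑ b, ‖z b‖ ^ 2 := by
  have h := quadForm_diagonal (fun b ↦ z b * net.pilot q.1 q.2 b) 1
  have h1 : (fun b b' : Fin B ↦ ((0 : ℝ) : ℂ) ^ Nat.dist b b')
      = fun b b' : Fin B ↦ if b = b' then (1 : ℂ) else 0 := by
    ext b b'
    by_cases hb : b = b'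
    · simp [hb, Nat.dist_self]
    · have : Nat.dist b b' ≠ 0 := fun h ↦ hb (Fin.ext (Nat.eq_of_dist_eq_zero h))
      simp [hb, this]
  rw [modulatedForm, h1, h, one_mul, Complex.ofReal_re, Finset.mul_sum]
  refine Finset.sum_congr rfl fun b _ ↦ ?_
  rw [norm_mul, mul_pow, net.pilot_power, mul_comm]

/-- The coefficients of the LMMSE filter converge after rescaling if the rescaled noise power does
not vanish in the limit, or if the phases decorrelate completely between channel uses. -/
lemma exists_tendsto_coefficients {k : Fin K} (hp : 0 < net.p j k) (hB : 1 ≤ B) {t : ℕ}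
    (ht : B < t) {κ ν g D : ℕ → ℝ} {κ' ν' e g' : ℝ} {w : ℕ → Fin B → ℂ}
    (hg0 : ∀ᶠ N in atTop, 0 < g N) (hD0 : ∀ᶠ N in atTop, 0 < D N)
    (hκ : Tendsto (fun N ↦ κ N / D N) atTop (𝓝 κ')) (hν : Tendsto (fun N ↦ ν N / D N) atTop (𝓝 ν'))
    (he : Tendsto (fun N ↦ 1 / D N) atTop (𝓝 e)) (hg : Tendsto g atTop (𝓝 g'))
    (hmod : ∀ᶠ N in atTop, ∀ (z : Fin B → ℂ) (q : Fin L × Fin K),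
      0 ≤ (modulatedForm net (g N) z q).re)
    (hw : ∀ᶠ N in atTop, Matrix.vecMul (w N) (pilotCov net j (κ N) (ν N) (g N))
      = crossCov net j (g N) t (j, k))
    (hκ' : 0 ≤ κ') (hν' : 0 ≤ ν') (hpos : 0 < κ' ∨ 0 < ν' ∨ (0 < e ∧ g' = 0)) :
    ∃ w', Tendsto (fun N ↦ ((D N / g N ^ (t - B) : ℝ) : ℂ) • w N) atTop (𝓝 w')
      ∧ star w' ⬝ᵥ crossCov net j g' B (j, k) ≠ 0 := by
  have hκc := (Complex.continuous_ofReal.tendsto _).comp hκ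
  have hνc := (Complex.continuous_ofReal.tendsto _).comp hν
  have hec := (Complex.continuous_ofReal.tendsto _).comp he
  have hgc := (Complex.continuous_ofReal.tendsto _).comp hg
  have hP := receivedPower_pos net j hp
  have hex (b b' : Fin B) : ∃ c : ℂ, Tendsto
      (fun N ↦ ((1 / D N : ℝ) : ℂ) * pilotCov net j (κ N) (ν N) (g N) b b') atTop (𝓝 c) := by
    by_cases hb : b = b'
    · refine ⟨_, ((hec.mul (hgc.pow (Nat.dist b b'))).mul_const (∑ q : Fin L × Fin K,
        (net.lam j q.1 q.2 : ℂ) * pilotGram net q b b')).add ((hκc.mul_const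
        (∑ q : Fin L × Fin K, (net.p q.1 q.2 : ℂ) * (net.lam j q.1 q.2 : ℂ))).add hνc) |>.congr
        fun N ↦ ?_⟩
      simp only [pilotCov, hb, if_true, Function.comp_apply]
      push_cast
      ring
    · refine ⟨_, ((hec.mul (hgc.pow (Nat.dist b b'))).mul_const (∑ q : Fin L × Fin K,
        (net.lam j q.1 q.2 : ℂ) * pilotGram net q b b')) |>.congr fun N ↦ ?_⟩
      simp only [pilotCov, hb, if_false, Function.comp_apply]
      push_cast
      ring
  choose A' hA' using hex
  have hmod' (z : Fin B → ℂ) (q : Fin L × Fin K) : 0 ≤ (modulatedForm net g' z q).re :=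
    ge_of_tendsto (tendsto_modulatedForm net hg z q) (hmod.mono fun N h ↦ h z q)
  have he0 : 0 ≤ e := ge_of_tendsto he (hD0.mono fun N h ↦ (one_div_pos.2 h).le)
  have hform (z : Fin B → ℂ) : (quadForm z A').re
      = e * (∑ q : Fin L × Fin K, net.lam j q.1 q.2 * (modulatedForm net g' z q).re)
        + (κ' * receivedPower net j + ν') * ∑ b, ‖z b‖ ^ 2 := by
    have h1 := (Complex.continuous_re.tendsto _).comp
      (tendsto_quadForm (w := fun _ : ℕ ↦ z) tendsto_const_nhds hA')
    have h2 : Tendsto (fun N ↦ 1 / D N * (∑ q : Fin L × Fin K,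
          net.lam j q.1 q.2 * (modulatedForm net (g N) z q).re)
        + (κ N / D N * receivedPower net j + ν N / D N) * ∑ b, ‖z b‖ ^ 2) atTop
        (𝓝 (e * (∑ q : Fin L × Fin K, net.lam j q.1 q.2 * (modulatedForm net g' z q).re)
        + (κ' * receivedPower net j + ν') * ∑ b, ‖z b‖ ^ 2)) :=
      (he.mul (tendsto_finsetSum _ fun q _ ↦ (tendsto_modulatedForm net hg z q).const_mul _)).add
        (((hκ.mul_const _).add hν).mul_const _)
    refine tendsto_nhds_unique (h1.congr fun N ↦ ?_) h2
    rw [Function.comp_apply, quadForm_const_mul, Complex.re_ofReal_mul, quadForm_pilotCov_re]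
    ring
  have hcoer : ∃ c : ℝ, 0 < c ∧ ∀ z : Fin B → ℂ, c * ∑ b, ‖z b‖ ^ 2 ≤ (quadForm z A').re := by
    have hnoise (h : 0 < κ' * receivedPower net j + ν') : ∃ c : ℝ, 0 < c ∧
        ∀ z : Fin B → ℂ, c * ∑ b, ‖z b‖ ^ 2 ≤ (quadForm z A').re := by
      refine ⟨_, h, fun z ↦ ?_⟩
      rw [hform]
      have h1 : 0 ≤ ∑ q : Fin L × Fin K, net.lam j q.1 q.2 * (modulatedForm net g' z q).re :=
        Finset.sum_nonneg fun q _ ↦ mul_nonneg (net.lam_pos _ _ _).le (hmod' z q)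
      linarith [mul_nonneg he0 h1]
    rcases hpos with h | h | ⟨h, rfl⟩
    · exact hnoise (add_pos_of_pos_of_nonneg (mul_pos h hP) hν')
    · exact hnoise (add_pos_of_nonneg_of_pos (mul_nonneg hκ' hP.le) h)
    · refine ⟨e * receivedPower net j, mul_pos h hP, fun z ↦ ?_⟩
      have h1 : ∑ q : Fin L × Fin K, net.lam j q.1 q.2 * (modulatedForm net 0 z q).re
          = receivedPower net j * ∑ b, ‖z b‖ ^ 2 := by
        rw [receivedPower, Finset.sum_mul]
        refine Finset.sum_congr rfl fun q _ ↦ ?_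
        rw [modulatedForm_zero]
        ring
      rw [hform, h1, mul_assoc]
      have h2 : 0 ≤ ∑ b, ‖z b‖ ^ 2 := Finset.sum_nonneg fun b _ ↦ sq_nonneg _
      have h3 := mul_nonneg (add_nonneg (mul_nonneg hκ' hP.le) hν') h2
      linarith
  obtain ⟨c, hc, hcoer⟩ := hcoer
  have hr : Tendsto (fun N ↦ crossCov net j (g N) B (j, k)) atTop
      (𝓝 (crossCov net j g' B (j, k))) :=
    tendsto_pi_nhds.2 fun b ↦ (hgc.pow _).const_mul _
  refine exists_tendsto_of_vecMul_eq hA' hr ?_ hc hcoer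
    (crossCov_ne_zero net j hp (b := ⟨B - 1, by omega⟩) ?_)
  · filter_upwards [hw, hg0, hD0] with N h1 h2 h3
    have h4 : (fun b b' ↦ ((1 / D N : ℝ) : ℂ) * pilotCov net j (κ N) (ν N) (g N) b b')
        = ((1 / D N : ℝ) : ℂ) • pilotCov net j (κ N) (ν N) (g N) := by
      ext b b'
      simp
    have h5 : (g N : ℝ) ^ (t - B) ≠ 0 := pow_ne_zero _ h2.ne'
    rw [h4, Matrix.vecMul_smul, Matrix.smul_vecMul, h1, crossCov_eq_pow_mul net j ht, smul_smul,
      smul_smul, ← Complex.ofReal_mul, ← Complex.ofReal_mul]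
    rw [show 1 / D N * (D N / g N ^ (t - B)) * g N ^ (t - B) = 1 by field_simp]
    simp
  · -- The correlation with the last pilot, at channel use `B`, survives even if `g' = 0`.
    have h1 : B - (B - 1 + 1) = 0 := by omega
    simp [h1]

end Coefficients

/-! ### Hardware that scales with the number of antennas -/

section Parameters

lemma exists_tendsto_rpow {a : ℝ} (ha : a ≤ 0) :
    ∃ l : ℝ, Tendsto (fun N : ℕ ↦ (N : ℝ) ^ a) atTop (𝓝 l) := by
  rcases ha.eq_or_lt with rfl | h
  · exact ⟨1, by simp⟩
  · refine ⟨0, ?_⟩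
    have := (tendsto_rpow_neg_atTop (neg_pos.2 h)).comp tendsto_natCast_atTop_atTop
    simpa [Function.comp_def] using this

/-- The noise power grows like `N ^ τ` with the largest exponent `τ` that occurs with a non-zero
coefficient; the last alternative is noiseless hardware. -/
lemma exists_noise_exponent {c d τ₁ τ₂ : ℝ} (hc : 0 ≤ c) (hd : 0 ≤ d) (hτ₁ : 0 ≤ τ₁)
    (hτ₂ : 0 ≤ τ₂) :
    ∃ τ κ' ν' e : ℝ, 0 ≤ τ ∧ τ ≤ max τ₁ τ₂ ∧ 0 ≤ κ' ∧ 0 ≤ ν' ∧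
      Tendsto (fun N : ℕ ↦ c * (N : ℝ) ^ τ₁ / (N : ℝ) ^ τ) atTop (𝓝 κ') ∧
      Tendsto (fun N : ℕ ↦ d * (N : ℝ) ^ τ₂ / (N : ℝ) ^ τ) atTop (𝓝 ν') ∧
      Tendsto (fun N : ℕ ↦ 1 / (N : ℝ) ^ τ) atTop (𝓝 e) ∧
      (0 < κ' ∨ 0 < ν' ∨ (c = 0 ∧ d = 0 ∧ τ = 0)) := by
  have hpow {a τ : ℝ} (h : a ≤ τ) (c : ℝ) (hc : 0 ≤ c) :
      ∃ l, 0 ≤ l ∧ Tendsto (fun N : ℕ ↦ c * (N : ℝ) ^ a / (N : ℝ) ^ τ) atTop (𝓝 l) := by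
    obtain ⟨l, hl⟩ := exists_tendsto_rpow (sub_nonpos.2 h)
    have h1 := hl.const_mul c
    have h2 : Tendsto (fun N : ℕ ↦ c * (N : ℝ) ^ a / (N : ℝ) ^ τ) atTop (𝓝 (c * l)) := by
      refine h1.congr' ?_
      filter_upwards [eventually_gt_atTop 0] with N hN
      rw [Real.rpow_sub (Nat.cast_pos.2 hN), mul_div_assoc]
    exact ⟨_, ge_of_tendsto' h2 fun N ↦ by positivity, h2⟩
  have hself (τ c : ℝ) : Tendsto (fun N : ℕ ↦ c * (N : ℝ) ^ τ / (N : ℝ) ^ τ) atTop (𝓝 c) := by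
    refine tendsto_const_nhds.congr' ?_
    filter_upwards [eventually_gt_atTop 0] with N hN
    rw [mul_div_cancel_right₀ _ (Real.rpow_pos_of_pos (Nat.cast_pos.2 hN) _).ne']
  have hone {τ : ℝ} (h : 0 ≤ τ) : ∃ e, Tendsto (fun N : ℕ ↦ 1 / (N : ℝ) ^ τ) atTop (𝓝 e) := by
    obtain ⟨l, -, hl⟩ := hpow h 1 zero_le_one
    exact ⟨l, by simpa using hl⟩
  by_cases hc0 : c = 0
  · by_cases hd0 : d = 0
    · exact ⟨0, 0, 0, 1, le_rfl, le_max_of_le_left hτ₁, le_rfl, le_rfl, by simp [hc0],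
        by simp [hd0], by simp, Or.inr (Or.inr ⟨hc0, hd0, rfl⟩)⟩
    · obtain ⟨e, he⟩ := hone hτ₂
      exact ⟨τ₂, 0, d, e, hτ₂, le_max_right _ _, le_rfl, hd, by simp [hc0], hself _ _, he,
        Or.inr (Or.inl (lt_of_le_of_ne hd (Ne.symm hd0)))⟩
  · have hc1 : 0 < c := lt_of_le_of_ne hc (Ne.symm hc0)
    by_cases hd0 : d = 0
    · obtain ⟨e, he⟩ := hone hτ₁
      exact ⟨τ₁, c, 0, e, hτ₁, le_max_left _ _, hc, le_rfl, hself _ _, by simp [hd0], he,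
        Or.inl hc1⟩
    · have hd1 : 0 < d := lt_of_le_of_ne hd (Ne.symm hd0)
      rcases le_total τ₁ τ₂ with h | h
      · obtain ⟨e, he⟩ := hone hτ₂
        obtain ⟨l, hl0, hl⟩ := hpow h c hc
        exact ⟨τ₂, l, d, e, hτ₂, le_max_right _ _, hl0, hd, hl, hself _ _, he, Or.inr (Or.inl hd1)⟩
      · obtain ⟨e, he⟩ := hone hτ₁
        obtain ⟨l, hl0, hl⟩ := hpow h d hd
        exact ⟨τ₁, c, l, e, hτ₁, le_max_left _ _, hc, hl0, hself _ _, hl, he, Or.inl hc1⟩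

variable (κ₀ ξ₀ δ₀ τ₁ τ₂ τ₃ : ℝ)

lemma scaledHardware_kappaSq_nonneg (N : ℕ) :
    0 ≤ (scaledHardware κ₀ ξ₀ δ₀ τ₁ τ₂ τ₃ N).kappaSq :=
  mul_nonneg (sq_nonneg _) (Real.rpow_nonneg (Nat.cast_nonneg _) _)

lemma scaledHardware_xi_nonneg (hξ₀ : 0 ≤ ξ₀) (N : ℕ) :
    0 ≤ (scaledHardware κ₀ ξ₀ δ₀ τ₁ τ₂ τ₃ N).xi :=
  mul_nonneg hξ₀ (Real.rpow_nonneg (Nat.cast_nonneg _) _)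

lemma scaledHardware_delta_nonneg (hδ₀ : 0 ≤ δ₀) (hτ₃ : 0 ≤ τ₃) {N : ℕ} (hN : 0 < N) :
    0 ≤ (scaledHardware κ₀ ξ₀ δ₀ τ₁ τ₂ τ₃ N).delta :=
  mul_nonneg hδ₀ (add_nonneg zero_le_one (Real.log_nonneg
    (Real.one_le_rpow (by exact_mod_cast hN) hτ₃)))

lemma phaseCoherence_pos (hw : Hardware) : 0 < hw.phaseCoherence := Real.exp_pos _

/-- Logarithmic growth of the phase noise makes the phase coherence decay polynomially. -/
lemma phaseCoherence_scaledHardware {N : ℕ} (hN : 0 < N) :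
    (scaledHardware κ₀ ξ₀ δ₀ τ₁ τ₂ τ₃ N).phaseCoherence
      = Real.exp (-δ₀ / 2) * (N : ℝ) ^ (-(δ₀ * τ₃) / 2) := by
  have hN' : (0 : ℝ) < N := Nat.cast_pos.2 hN
  change Real.exp (-(δ₀ * (1 + Real.log ((N : ℝ) ^ τ₃))) / 2) = _
  rw [Real.log_rpow hN', Real.rpow_def_of_pos hN', ← Real.exp_add]
  congr 1
  ring

end Parameters

end MIMO

/-! ### The scaling law -/

open MIMO in
theorem lemma3 {L K B : ℕ} (hB : 1 ≤ B) (net : MIMO.Network L K B) (j : Fin L) (k : Fin K)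
    (hp : 0 < net.p j k) (lo : MIMO.LOType) (κ₀ ξ₀ δ₀ τ₁ τ₂ τ₃ : ℝ)
    (hκ₀ : 0 ≤ κ₀) (hξ₀ : 0 ≤ ξ₀) (hδ₀ : 0 ≤ δ₀) (hτ₁ : 0 ≤ τ₁) (hτ₂ : 0 ≤ τ₂) (hτ₃ : 0 ≤ τ₃)
    (t : ℕ) (ht : B < t)
    (hcommon : lo = MIMO.LOType.common → max τ₁ τ₂ ≤ 1 / 2 ∧ τ₃ = 0)
    (hseparate : lo = MIMO.LOType.separate →
      max τ₁ τ₂ + δ₀ * ((t : ℝ) - (B : ℝ)) / 2 * τ₃ ≤ 1 / 2)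
    (M : ∀ N : ℕ,
      MIMO.UplinkModel net (MIMO.scaledHardware κ₀ ξ₀ δ₀ τ₁ τ₂ τ₃ N) lo j N)
    (v : ∀ N : ℕ, (M N).Ω → Fin N → ℂ)
    (hv : ∀ N : ℕ, (M N).IsMRC k t (v N)) :
    ∃ ℓ : EReal, 0 < ℓ ∧
      Tendsto (fun N : ℕ => (((M N).sinr k t (v N) : ℝ) : EReal)) atTop (𝓝 ℓ) := by
  set hw : ℕ → Hardware := scaledHardware κ₀ ξ₀ δ₀ τ₁ τ₂ τ₃ with hwdef
  have hκn (N : ℕ) : 0 ≤ (hw N).kappaSq := scaledHardware_kappaSq_nonneg κ₀ ξ₀ δ₀ τ₁ τ₂ τ₃ N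
  have hxn (N : ℕ) : 0 ≤ (hw N).xi := scaledHardware_xi_nonneg κ₀ ξ₀ δ₀ τ₁ τ₂ τ₃ hξ₀ N
  have hδn {N : ℕ} (hN : 0 < N) : 0 ≤ (hw N).delta :=
    scaledHardware_delta_nonneg κ₀ ξ₀ δ₀ τ₁ τ₂ τ₃ hδ₀ hτ₃ hN
  set κ : ℕ → ℝ := fun N ↦ (hw N).kappaSq with hκdef
  set ν : ℕ → ℝ := fun N ↦ net.sigma ^ 2 * (hw N).xi with hνdef
  set g : ℕ → ℝ := fun N ↦ (hw N).phaseCoherence with hgdef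
  have hg0 (N : ℕ) : 0 < g N := phaseCoherence_pos _
  have hgN {N : ℕ} (hN : 0 < N) : g N = Real.exp (-δ₀ / 2) * (N : ℝ) ^ (-(δ₀ * τ₃) / 2) :=
    phaseCoherence_scaledHardware κ₀ ξ₀ δ₀ τ₁ τ₂ τ₃ hN
  have hne (N : ℕ) : crossCov net j (g N) t (j, k) ≠ 0 :=
    crossCov_ne_zero net j hp (b := ⟨0, hB⟩) (pow_ne_zero _ (hg0 N).ne')
  have hsol {N : ℕ} (hN : 0 < N) := (hv N).exists_weights (hκn N) (hxn N) (hδn hN) ht hN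
  -- The exponent `τ` of the noise power.
  obtain ⟨τ, κ', ν', e, hτ0, hτle, hκ'0, hν'0, hκ', hν', he, hcase⟩ :=
    exists_noise_exponent (c := κ₀ ^ 2) (d := net.sigma ^ 2 * ξ₀) (sq_nonneg κ₀)
      (mul_nonneg (sq_nonneg _) hξ₀) hτ₁ hτ₂
  set D : ℕ → ℝ := fun N ↦ (N : ℝ) ^ τ with hDdef
  have hD0 : ∀ᶠ N in atTop, 0 < D N := by
    filter_upwards [eventually_gt_atTop 0] with N hN
    exact Real.rpow_pos_of_pos (Nat.cast_pos.2 hN) _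
  have hκ' : Tendsto (fun N ↦ κ N / D N) atTop (𝓝 κ') := hκ'
  have hν' : Tendsto (fun N ↦ ν N / D N) atTop (𝓝 ν') := by
    refine hν'.congr fun N ↦ ?_
    simp only [hνdef, hwdef, scaledHardware, hDdef]
    ring
  have hδτ : 0 ≤ δ₀ * τ₃ := mul_nonneg hδ₀ hτ₃
  obtain ⟨l, hl⟩ := exists_tendsto_rpow (a := -(δ₀ * τ₃) / 2) (by linarith)
  have hgl : Tendsto g atTop (𝓝 (Real.exp (-δ₀ / 2) * l)) := by
    refine (hl.const_mul _).congr' ?_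
    filter_upwards [eventually_gt_atTop 0] with N hN
    rw [hgN hN]
  set g' := Real.exp (-δ₀ / 2) * l with hg'
  -- With constant phase noise the phase coherence does not depend on `N`.
  have hgconst (h : δ₀ * τ₃ = 0) {N : ℕ} (hN : 0 < N) : g N = Real.exp (-δ₀ / 2) := by
    rw [hgN hN, h]
    simp
  have htB : ((t - B : ℕ) : ℝ) = (t : ℝ) - B := Nat.cast_sub ht.le
  -- The scaling hypotheses say that this exponent is non-positive.
  have hexp : 2 * τ - 1 + δ₀ * τ₃ * ((t - B : ℕ) : ℝ) ≤ 0 := by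
    cases lo with
    | common =>
      obtain ⟨h1, h2⟩ := hcommon rfl
      rw [h2]
      linarith
    | separate =>
      have h1 := hseparate rfl
      rw [htB]
      linarith
  obtain ⟨T, hT⟩ := exists_tendsto_rpow hexp
  have hT' : Tendsto (fun N : ℕ ↦ D N ^ 2 / (N * (g N ^ (t - B)) ^ 2)) atTop
      (𝓝 (Real.exp (δ₀ * ((t - B : ℕ) : ℝ)) * T)) := by
    refine (hT.const_mul _).congr' ?_
    filter_upwards [eventually_gt_atTop 0] with N hN
    have hN' : (0 : ℝ) < N := Nat.cast_pos.2 hN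
    rw [hgN hN]
    simp only [hDdef, Real.rpow_def_of_pos hN']
    have h1 : (N : ℝ) = Real.exp (Real.log N) := (Real.exp_log hN').symm
    rw [← Real.exp_add, ← Real.exp_add, ← Real.exp_nat_mul, ← Real.exp_nat_mul, ← Real.exp_nat_mul]
    conv_rhs => rw [h1]
    rw [← Real.exp_add, ← Real.exp_sub, Real.log_exp]
    congr 1
    push_cast
    ring
  -- With a common oscillator, phase noise that grows would make this diverge.
  have hΔ : ∃ Δ : Fin B → Fin B → ℂ, ∀ b b', Tendsto
      (fun N ↦ driftCorr lo (g N) t b b' * ((1 / (g N ^ (t - B)) ^ 2 : ℝ) : ℂ)) atTop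
      (𝓝 (Δ b b')) := by
    cases lo with
    | common =>
      refine ⟨fun b b' ↦ driftCorr .common (Real.exp (-δ₀ / 2)) t b b'
        * ((1 / (Real.exp (-δ₀ / 2) ^ (t - B)) ^ 2 : ℝ) : ℂ),
        fun b b' ↦ tendsto_const_nhds.congr' ?_⟩
      filter_upwards [eventually_gt_atTop 0] with N hN
      rw [hgconst (by rw [(hcommon rfl).2, mul_zero]) hN]
    | separate =>
      have hgc := (Complex.continuous_ofReal.tendsto _).comp hgl
      refine ⟨_, fun b b' ↦ ((hgc.pow (B - ((b : ℕ) + 1))).mul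
        (hgc.pow (B - ((b' : ℕ) + 1)))).congr fun N ↦ ?_⟩
      have hb := b.2
      have hb' := b'.2
      have h1 : t - ((b : ℕ) + 1) = (t - B) + (B - ((b : ℕ) + 1)) := by omega
      have h2 : t - ((b' : ℕ) + 1) = (t - B) + (B - ((b' : ℕ) + 1)) := by omega
      have h3 : (g N : ℂ) ≠ 0 := Complex.ofReal_ne_zero.2 (hg0 N).ne'
      simp only [driftCorr, h1, h2, pow_add, Function.comp_apply]
      push_cast
      field_simp
  obtain ⟨Δ, hΔ⟩ := hΔ
  have hcoef : ∃ (w : ℕ → Fin B → ℂ) (w' : Fin B → ℂ),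
      (∀ᶠ N in atTop, Matrix.vecMul (w N) (pilotCov net j (κ N) (ν N) (g N))
        = crossCov net j (g N) t (j, k)) ∧
      Tendsto (fun N ↦ ((D N / g N ^ (t - B) : ℝ) : ℂ) • w N) atTop (𝓝 w') ∧
      star w' ⬝ᵥ crossCov net j g' B (j, k) ≠ 0 := by
    by_cases hconst : κ₀ ^ 2 = 0 ∧ net.sigma ^ 2 * ξ₀ = 0 ∧ τ = 0 ∧ δ₀ * τ₃ = 0
    · -- The hardware does not depend on `N`, and neither need the coefficients. This case is
      -- treated separately because the pilot covariance may be singular.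
      obtain ⟨h1, h2, h3, h4⟩ := hconst
      have hκ0 (N : ℕ) : κ N = κ 1 := by simp [hκdef, hwdef, scaledHardware, h1]
      have hν0 (N : ℕ) : ν N = ν 1 := by
        simp only [hνdef, hwdef, scaledHardware, ← mul_assoc, h2, zero_mul]
      have hg1 {N : ℕ} (hN : 0 < N) : g N = g 1 := by
        rw [hgconst h4 hN, hgconst h4 one_pos]
      have hg1' : g' = g 1 := by
        refine tendsto_nhds_unique hgl (tendsto_const_nhds.congr' ?_)
        filter_upwards [eventually_gt_atTop 0] with N hN
        rw [hg1 hN]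
      obtain ⟨w, hw1⟩ := hsol one_pos
      refine ⟨fun _ ↦ w, ((1 / g 1 ^ (t - B) : ℝ) : ℂ) • w, ?_, tendsto_const_nhds.congr' ?_, ?_⟩
      · filter_upwards [eventually_gt_atTop 0] with N hN
        rw [hκ0, hν0, hg1 hN]
        exact hw1
      · filter_upwards [eventually_gt_atTop 0] with N hN
        rw [hg1 hN]
        simp [hDdef, h3]
      · intro h
        have h5 := UplinkModel.quadForm_pilotCov_re_pos one_pos (hκn 1) (hxn 1) (hδn one_pos) (M 1)
          (hw1 ▸ hne 1)
        rw [quadForm_eq_of_vecMul_eq hw1] at h5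
        rw [hg1', ← one_smul ℂ w] at h
        have h6 := dotProduct_smul_crossCov net j ht (g 1) (g 1 ^ (t - B))
          (((1 / g 1 ^ (t - B) : ℝ) : ℂ) • (1 : ℂ) • w) (j, k)
        rw [h, mul_zero, one_smul, smul_smul, ← Complex.ofReal_mul,
          mul_one_div_cancel (pow_ne_zero _ (hg0 1).ne'), Complex.ofReal_one, one_smul] at h6
        rw [show star w ⬝ᵥ crossCov net j (hw 1).phaseCoherence t (j, k) = 0 from h6] at h5
        simp at h5
    · choose! w hw1 using fun (N : ℕ) (hN : 0 < N) ↦ hsol hN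
      have hw2 : ∀ᶠ N in atTop, Matrix.vecMul (w N) (pilotCov net j (κ N) (ν N) (g N))
          = crossCov net j (g N) t (j, k) := (eventually_gt_atTop 0).mono hw1
      have hpos : 0 < κ' ∨ 0 < ν' ∨ (0 < e ∧ g' = 0) := by
        rcases hcase with h | h | ⟨h1, h2, h3⟩
        · exact Or.inl h
        · exact Or.inr (Or.inl h)
        · have h4 : 0 < δ₀ * τ₃ := lt_of_le_of_ne hδτ fun h ↦ hconst ⟨h1, h2, h3, h.symm⟩
          refine Or.inr (Or.inr ⟨?_, ?_⟩)
          · have h5 : e = 1 := tendsto_nhds_unique he (by simp [h3])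
            rw [h5]
            exact one_pos
          · have h5 := (tendsto_rpow_neg_atTop (half_pos h4)).comp tendsto_natCast_atTop_atTop
            have h6 : l = 0 := tendsto_nhds_unique hl (by
              simpa [neg_div, Function.comp_def] using h5)
            rw [hg', h6, mul_zero]
      obtain ⟨w', hlim, hs⟩ := exists_tendsto_coefficients net j hp hB ht
        (Eventually.of_forall hg0) hD0 hκ' hν' he hgl
        ((eventually_gt_atTop 0).mono fun N hN z q ↦
          UplinkModel.modulatedForm_nonneg hN (hδn hN) (M N) z q) hw2 hκ'0 hν'0 hpos
      exact ⟨w, w', hw2, hlim, hs⟩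
  obtain ⟨w, w', hwsol, hwlim, hws⟩ := hcoef
  have hscale : ∀ᶠ N in atTop,
      ((g N ^ (t - B) / D N : ℝ) : ℂ) • (((D N / g N ^ (t - B) : ℝ) : ℂ) • w N) = w N := by
    filter_upwards [hD0] with N hN
    have h1 : g N ^ (t - B) ≠ 0 := pow_ne_zero _ (hg0 N).ne'
    have h2 := hN.ne'
    rw [smul_smul, ← Complex.ofReal_mul,
      show g N ^ (t - B) / D N * (D N / g N ^ (t - B)) = 1 by field_simp, Complex.ofReal_one,
      one_smul]
  have hpos : ∀ᶠ N in atTop, 0 < sinrDenom net j k lo t (κ N) (ν N) (g N) N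
      (((g N ^ (t - B) / D N : ℝ) : ℂ) • (((D N / g N ^ (t - B) : ℝ) : ℂ) • w N)) := by
    filter_upwards [hscale, hwsol, eventually_gt_atTop 0] with N h1 h2 hN
    rw [h1]
    exact UplinkModel.sinrDenom_pos hN (hκn N) (hxn N) (hδn hN) (M N) ht hp h2 (hne N)
  obtain ⟨ℓ, hℓ, hlim⟩ := exists_tendsto_sinr net j k lo hp ht (Eventually.of_forall hg0) hD0 hκ'
    hν' he hgl hT' hΔ hwlim hws hpos
  refine ⟨ℓ, hℓ, hlim.congr' ?_⟩
  filter_upwards [hscale, hwsol, eventually_gt_atTop 0] with N h1 h2 hN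
  rw [h1, (hv N).sinr_eq (hκn N) (hxn N) (hδn hN) ht h2]
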